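/- Assume the generalized Riemann hypothesis: for every Dirichlet character $\chi$, every zero of $L(s,\chi)$ in the strip $0<\operatorname{Re}s<1$ satisfies $\operatorname{Re}s=\tfrac12$. For a Dirichlet character $\chi$ with conductor $q>1$, let $n_\chi=\operatorname{ord}_{s=1/2}L(s,\chi)$ be the order of vanishing of $L(s,\chi)$ at $s=\tfrac12$. Then \[ n_\chi\le \frac{\log q}{2\log\log q}+\frac{(\log 4+1)\log q}{2(\log\log q)^2}+O\!\left(\frac{\log q}{(\log\log q)^3}\right), \] where the implied constant is absolute, i.e. there is a real number $C$ such that for every Dirichlet character $\chi$ with conductor $q>1$ the inequality holds with the $O$-term replaced by $C\log q/(\log\log q)^3$. (A conductor $q>1$ is at least $3$, so $\log\log q>0$.) -/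

import Mathlib

/-- The generalized Riemann hypothesis for Dirichlet `L`-functions: for every Dirichlet character
`χ` of every modulus `N ≥ 1`, every zero of (the analytic continuation of) `L(s, χ)` in the open
strip `0 < Re s < 1` lies on the line `Re s = 1/2`. -/
def GRH : Prop :=
  ∀ (N : ℕ) [NeZero N] (χ : DirichletCharacter ℂ N) (s : ℂ),
    0 < s.re → s.re < 1 → DirichletCharacter.LFunction χ s = 0 → s.re = 1 / 2

/-- The order of vanishing of `L(s, χ)` at the central point `s = 1/2`. -/
noncomputable def centralOrder {N : ℕ} [NeZero N] (χ : DirichletCharacter ℂ N) : ℕ :=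
  analyticOrderNatAt (DirichletCharacter.LFunction χ) (1 / 2)

/-- For a nontrivial character, `L(s, χ)` is entire and not identically zero, so that
`centralOrder χ` is the genuine (finite) order of vanishing and not a default value. -/
theorem centralOrder_spec {N : ℕ} [NeZero N] (χ : DirichletCharacter ℂ N) (hχ : χ ≠ 1) :
    AnalyticAt ℂ (DirichletCharacter.LFunction χ) (1 / 2) ∧
      (centralOrder χ : ℕ∞) = analyticOrderAt (DirichletCharacter.LFunction χ) (1 / 2) := by
  have hd := DirichletCharacter.differentiable_LFunction hχ
  refine ⟨hd.analyticAt _, ?_⟩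
  refine Nat.cast_analyticOrderNatAt fun htop => ?_
  have hev := analyticOrderAt_eq_top.mp htop
  have han : AnalyticOnNhd ℂ (DirichletCharacter.LFunction χ) Set.univ := fun z _ => hd.analyticAt z
  have h2 := han.eqOn_zero_of_preconnected_of_eventuallyEq_zero isPreconnected_univ
    (Set.mem_univ _) hev (Set.mem_univ (2 : ℂ))
  exact DirichletCharacter.LFunction_ne_zero_of_one_le_re χ (s := 2) (Or.inl hχ) (by norm_num) h2

/-! The proof is an explicit-formula argument with a Fejér kernel, arranged so that neither Hadamard
products nor zero counting is needed. Let `χ` be primitive modulo `q` and let `n` be its central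
order. Put `F(z) = ξ(1/2+z) · q^(z/2) · Λ(1/2+z, χ) / z^n`, where `ξ(s) = s(s-1)Λ(s)`
(`reducedProduct`). `F` is entire, the functional equations give `|F(-z̄)| = |F(z)|`, and under GRH
it has no zero with `Re z > 0`.

Positivity. One has `Re (F'/F) ≥ 0` for `Re z > 0`. Classically this is read off from the sum over
zeros, all on the imaginary axis. Here it comes from Phragmén–Lindelöf applied to `F(z-h)/F(z+h)`:
this quotient has modulus 1 on the imaginary axis by symmetry, grows polynomially and is bounded on
the positive reals, so it is at most 1 in modulus. Letting `h → 0` gives `re_logDeriv_nonneg`. The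
growth conditions are multiplicative, so they are checked factor by factor through `RatioTempered`.

Explicit formula. For `Re z ≥ 1`, `F'/F` equals `-n/z + (log q)/2 + 1/(z+1/2) + 1/(z-1/2)`, plus
Gamma terms, minus the Dirichlet series of `Λ(k)(1+χ(k))` at `1/2+z` (`logDeriv_reducedProduct`).
Including `ξ` makes the real parts of these coefficients nonnegative, so the sum over primes can be
dropped; the price is the pole of `ζ`, that is, the term `1/(z-1/2)`.

Pairing. The kernel is nonnegative on the imaginary axis and is the Laplace transform of a triangle
on `[-T, T]`. Integrating `F'/F` against it near that axis gives something nonnegative; moving to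
the right, where the formula holds, evaluates each term. The result, `exists_explicit_inequality`,
yields `n T/2 ≤ (log q)/2 + 4 e^(T/2)/T + O(T)` uniformly in `χ`.

Choice of `T`. Taking `e^(T/2) = (log q)/4` optimises the second-order term and gives the constant
`log 4 + 1` (`le_asymptotic_of_forall_mul_le`). Imprimitive characters reduce to primitive ones,
because the extra Euler factors do not vanish at `1/2`. -/

open Complex Filter Topology Set ComplexConjugate MeasureTheory

/-! ### Positivity of `Re (f'/f)` from reflection symmetry and Phragmén–Lindelöf -/

/-- A function on `ℂ` is ratio-tempered if its horizontal translates `f (z - h)` and `f (z + h)`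
are comparable up to polynomial factors in the right half-plane, and up to constants on the
positive real axis. -/
def RatioTempered (f : ℂ → ℂ) : Prop :=
  ∀ h ∈ Ioo (0 : ℝ) (1 / 4), ∃ C : ℝ, ∃ k : ℕ, 0 ≤ C ∧
    (∀ z : ℂ, 0 ≤ z.re → 2 ≤ ‖z‖ → ‖f (z - h)‖ ≤ C * (1 + ‖z‖) ^ k * ‖f (z + h)‖) ∧
    ∀ x : ℝ, 2 ≤ x → ‖f (x - h)‖ ≤ C * ‖f (x + h)‖

/-- Ratios of translates multiply, so a product of Gamma, exponential and L-factors can be treated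
one factor at a time. The polynomial allowance serves `ζ` and `L`; the sharper clause on the real
axis is what Phragmén–Lindelöf requires there. -/
theorem RatioTempered.mul {f g : ℂ → ℂ} (hf : RatioTempered f) (hg : RatioTempered g) :
    RatioTempered (fun z ↦ f z * g z) := by
  intro h hh
  obtain ⟨C, k, hC, h1, h2⟩ := hf h hh
  obtain ⟨D, l, hD, h3, h4⟩ := hg h hh
  refine ⟨C * D, k + l, mul_nonneg hC hD, fun z hz hz2 ↦ ?_, fun x hx ↦ ?_⟩
  · rw [norm_mul, norm_mul]
    calc _ ≤ (C * (1 + ‖z‖) ^ k * ‖f (z + h)‖) * (D * (1 + ‖z‖) ^ l * ‖g (z + h)‖) :=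
          mul_le_mul (h1 z hz hz2) (h3 z hz hz2) (norm_nonneg _) (by positivity)
      _ = _ := by rw [pow_add]; ring
  · rw [norm_mul, norm_mul]
    calc _ ≤ (C * ‖f (x + h)‖) * (D * ‖g (x + h)‖) :=
          mul_le_mul (h2 x hx) (h4 x hx) (norm_nonneg _) (by positivity)
      _ = _ := by ring

/-- If the ratio of translates is bounded everywhere in the relevant region, the function is
ratio-tempered. -/
theorem RatioTempered.of_bound {f : ℂ → ℂ}
    (hf : ∀ h ∈ Ioo (0 : ℝ) (1 / 4), ∃ C : ℝ, 0 ≤ C ∧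
      ∀ z : ℂ, 0 ≤ z.re → 2 ≤ ‖z‖ → ‖f (z - h)‖ ≤ C * ‖f (z + h)‖) : RatioTempered f := by
  intro h hh
  obtain ⟨C, hC, h1⟩ := hf h hh
  refine ⟨C, 0, hC, fun z hz hz2 ↦ by simpa using h1 z hz hz2, fun x hx ↦ ?_⟩
  have hx0 : (0 : ℝ) ≤ x := by linarith
  exact h1 x (by simpa using hx0) (by simpa [abs_of_nonneg hx0] using hx)

/-- For an entire function whose modulus is symmetric about the imaginary axis and which has no
zeros in the open right half-plane, translates to the right dominate translates to the left. -/
theorem norm_sub_le_norm_add_of_ratioTempered {f : ℂ → ℂ} (hf : Differentiable ℂ f)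
    (hsym : ∀ z, ‖f (-conj z)‖ = ‖f z‖) (hne : ∀ z : ℂ, 0 < z.re → f z ≠ 0)
    (hr : RatioTempered f) {h : ℝ} (hh : h ∈ Ioo (0 : ℝ) (1 / 4)) {z : ℂ} (hz : 0 ≤ z.re) :
    ‖f (z - h)‖ ≤ ‖f (z + h)‖ := by
  obtain ⟨C, k, hC, h1, h2⟩ := hr h hh
  have hne' : ∀ w : ℂ, 0 ≤ w.re → f (w + h) ≠ 0 := fun w hw ↦
    hne _ (by simpa using add_pos_of_nonneg_of_pos hw hh.1)
  set g : ℂ → ℂ := fun w ↦ f (w - h) / f (w + h) with hg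
  have hgd : ∀ w : ℂ, 0 ≤ w.re → DifferentiableAt ℂ g w := fun w hw ↦ by
    have e1 : DifferentiableAt ℂ (fun w : ℂ ↦ f (w - h)) w := by fun_prop
    have e2 : DifferentiableAt ℂ (fun w : ℂ ↦ f (w + h)) w := by fun_prop
    exact e1.div e2 (hne' w hw)
  have key : ‖g z‖ ≤ 1 := by
    -- The half-plane principle tolerates growth `exp(B |w|^c)` with `c < 2`. Here `c = 1` and `B =
    -- k`, since `(1 + |w|)^k ≤ exp(k |w|)`.
    refine PhragmenLindelof.right_half_plane_of_bounded_on_real (f := g) (C := 1) ⟨?_, ?_⟩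
      ⟨1, by norm_num, k, ?_⟩ ?_ ?_ hz
    · exact fun w hw ↦ (hgd w (le_of_lt hw)).differentiableWithinAt
    · intro w hw
      rw [closure_setOfPred_lt_re] at hw
      exact (hgd w hw).continuousAt.continuousWithinAt
    · refine Asymptotics.IsBigO.of_bound C ?_
      have hev : ∀ᶠ w : ℂ in Bornology.cobounded ℂ, 2 ≤ ‖w‖ :=
        tendsto_norm_cobounded_atTop.eventually_ge_atTop 2
      rw [eventually_inf_principal]
      filter_upwards [hev] with w hw2 hw
      have hw0 : 0 ≤ w.re := le_of_lt hw
      rw [hg, norm_div, div_le_iff₀ (norm_pos_iff.mpr (hne' w hw0))]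
      refine (h1 w hw0 hw2).trans ?_
      gcongr
      rw [Real.rpow_one, Real.norm_of_nonneg (Real.exp_pos _).le, Real.exp_nat_mul]
      gcongr
      rw [add_comm]
      exact Real.add_one_le_exp _
    · refine ⟨C, ?_⟩
      rw [eventually_map]
      filter_upwards [eventually_ge_atTop 2] with x hx
      have hx0 : (0 : ℝ) ≤ x := by linarith
      rw [hg, norm_div, div_le_iff₀ (norm_pos_iff.mpr (hne' x (by simpa using hx0)))]
      exact h2 x hx
    · intro x
      have hs := hsym (x * I + h)
      -- The reflection in the imaginary axis exchanges the two translates of a point of that axis,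
      -- so the quotient has modulus at most 1 there.
      have he : -conj ((x : ℂ) * I + h) = x * I - h := by simp; ring
      rw [he] at hs
      rw [hg, norm_div, hs]
      exact div_self_le_one _
  rw [hg, norm_div, div_le_one₀ (norm_pos_iff.mpr (hne' z hz))] at key
  exact key

/-- If `‖f (z + h)‖ ≥ ‖f (z - h)‖` for small `h > 0`, then `Re (f'/f) ≥ 0` at `z`. -/
theorem re_logDeriv_nonneg_of_norm_le {f : ℂ → ℂ} {z : ℂ} (hf : DifferentiableAt ℂ f z)
    (hz : f z ≠ 0) (h : ∀ᶠ h : ℝ in 𝓝[>] 0, ‖f (z - h)‖ ≤ ‖f (z + h)‖) :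
    0 ≤ (logDeriv f z).re := by
  have hd : HasDerivAt (fun t : ℝ ↦ f (z + t)) (deriv f z) 0 := by
    have h1 : HasDerivAt f (deriv f z) (z + ((0 : ℝ) : ℂ)) := by simpa using hf.hasDerivAt
    have h2 : HasDerivAt (fun t : ℝ ↦ z + (t : ℂ)) 1 0 := by
      simpa using (Complex.ofRealCLM.hasDerivAt (x := (0 : ℝ))).const_add z
    have h3 := h1.comp (0 : ℝ) h2
    rw [mul_one] at h3
    exact h3
  have hN : HasDerivAt (fun t : ℝ ↦ ‖f (z + t)‖ ^ 2)
      (2 * inner ℝ (f (z + (0 : ℝ))) (deriv f z)) 0 := hd.norm_sq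
  have hN2 : HasDerivAt (fun t : ℝ ↦ ‖f (z + t)‖ ^ 2 - ‖f (z - t)‖ ^ 2)
      (4 * inner ℝ (f z) (deriv f z)) 0 := by
    have hN3 : HasDerivAt (fun t : ℝ ↦ ‖f (z + ((-t : ℝ) : ℂ))‖ ^ 2)
        (-(2 * inner ℝ (f z) (deriv f z))) 0 := by
      have := HasDerivAt.comp (0 : ℝ) (h₂ := fun t : ℝ ↦ ‖f (z + t)‖ ^ 2) (h := fun t : ℝ ↦ -t)
        (by simpa using hN) (hasDerivAt_neg (0 : ℝ))
      simpa [Function.comp_def] using this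
    have := hN.sub hN3
    refine (this.congr_deriv ?_).congr_of_eventuallyEq (Eventually.of_forall fun t ↦ ?_)
    · simp; ring
    · simp [sub_eq_add_neg]
  -- The function `|f(z+t)|² - |f(z-t)|²` vanishes at `t = 0` and is nonnegative for small `t > 0`;
  -- its derivative at 0 is a positive multiple of `Re (f'/f)`.
  have hslope := hN2.tendsto_slope_zero_right
  have h0 : 0 ≤ 4 * inner ℝ (f z) (deriv f z) := by
    refine ge_of_tendsto hslope ?_
    filter_upwards [h, self_mem_nhdsWithin] with t ht ht0
    have ht0' : (0 : ℝ) < t := ht0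
    have h2 := pow_le_pow_left₀ (norm_nonneg _) ht 2
    simp only [zero_add, ofReal_zero, add_zero, sub_zero, sub_self, smul_eq_mul]
    exact mul_nonneg (inv_nonneg.mpr ht0'.le) (by linarith)
  have h3 : (logDeriv f z).re = inner ℝ (f z) (deriv f z) / ‖f z‖ ^ 2 := by
    rw [logDeriv_apply, Complex.inner, Complex.div_re, ← Complex.normSq_eq_norm_sq]
    simp
    ring
  rw [h3]
  exact div_nonneg (by linarith) (by positivity)

theorem re_logDeriv_nonneg {f : ℂ → ℂ} (hf : Differentiable ℂ f)
    (hsym : ∀ z, ‖f (-conj z)‖ = ‖f z‖) (hne : ∀ z : ℂ, 0 < z.re → f z ≠ 0)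
    (hr : RatioTempered f) {z : ℂ} (hz : 0 < z.re) : 0 ≤ (logDeriv f z).re := by
  refine re_logDeriv_nonneg_of_norm_le (hf z) (hne z hz) ?_
  filter_upwards [Ioo_mem_nhdsGT (show (0 : ℝ) < 1 / 4 by norm_num)] with h hh
  exact norm_sub_le_norm_add_of_ratioTempered hf hsym hne hr hh hz.le

/-! ### Borel–Carathéodory and polynomial lower bounds for zero-free functions -/

/-- **Borel–Carathéodory** for functions with nonnegative real part on a ball. -/
theorem norm_le_of_re_nonneg {f : ℂ → ℂ} {c z : ℂ} {R r : ℝ} (hr : 0 ≤ r) (hrR : r < R)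
    (hf : DifferentiableOn ℂ f (Metric.ball c R)) (hre : ∀ w ∈ Metric.ball c R, 0 ≤ (f w).re)
    (hz : ‖z - c‖ ≤ r) : ‖f z‖ ≤ (R + r) / (R - r) * ‖f c‖ := by
  have hR : 0 < R := hr.trans_lt hrR
  have hd : DifferentiableOn ℂ (fun w ↦ -f (c + w)) (Metric.ball 0 R) := by
    refine (hf.comp (by fun_prop) fun w hw ↦ ?_).neg
    simpa using hw
  -- The real part of `-f` is at most 0, hence below every `M > 0`; the term proportional to `M`
  -- disappears as `M → 0`.
  have key : ∀ M : ℝ, 0 < M →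
      ‖f z‖ ≤ 2 * M * ‖z - c‖ / (R - ‖z - c‖) + ‖f c‖ * (R + ‖z - c‖) / (R - ‖z - c‖) := by
    intro M hM
    have := Complex.borelCaratheodory (z := z - c) hM hd ?_ hR ?_
    · simpa using this
    · intro w hw
      have := hre (c + w) (by simpa using hw)
      simp only [mem_ofPred_eq, neg_re]
      linarith
    · simpa using hz.trans_lt hrR
  have h1 : ‖f z‖ ≤ ‖f c‖ * (R + ‖z - c‖) / (R - ‖z - c‖) := by
    have ht : Tendsto (fun M : ℝ ↦ 2 * M * ‖z - c‖ / (R - ‖z - c‖) +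
        ‖f c‖ * (R + ‖z - c‖) / (R - ‖z - c‖)) (𝓝[>] 0)
        (𝓝 (2 * 0 * ‖z - c‖ / (R - ‖z - c‖) + ‖f c‖ * (R + ‖z - c‖) / (R - ‖z - c‖))) := by
      refine Tendsto.mono_left (Continuous.tendsto ?_ 0) nhdsWithin_le_nhds
      fun_prop
    have := ge_of_tendsto ht (eventually_of_mem self_mem_nhdsWithin fun M hM ↦ key M hM)
    simpa using this
  refine h1.trans ?_
  rw [mul_comm ‖f c‖, mul_div_right_comm]
  have : 0 < R - r := by linarith
  gcongr

/-- A lower bound for a zero-free holomorphic function on a ball in terms of an upper bound on the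
ball and a lower bound at the centre. -/
theorem norm_ge_of_ne_zero_on_ball {g : ℂ → ℂ} {c z : ℂ} {R r M m : ℝ} (hr : 0 ≤ r)
    (hrR : r < R) (hg : DifferentiableOn ℂ g (Metric.ball c R))
    (hne : ∀ w ∈ Metric.ball c R, g w ≠ 0) (hM : ∀ w ∈ Metric.ball c R, ‖g w‖ ≤ M)
    (hm : 0 < m) (hmM : m < M) (hc : m ≤ ‖g c‖) (hz : ‖z - c‖ ≤ r) :
    m * (m / M) ^ (2 * r / (R - r)) ≤ ‖g z‖ := by
  have hR : 0 < R := hr.trans_lt hrR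
  have hRr : 0 < R - r := by linarith
  have hM0 : 0 < M := hm.trans hmM
  have hcb : c ∈ Metric.ball c R := Metric.mem_ball_self hR
  have hld : DifferentiableOn ℂ (fun w ↦ deriv g w / g w) (Metric.ball c R) :=
    (hg.deriv Metric.isOpen_ball).div hg hne
  obtain ⟨φ, hφc, hφ⟩ := (hld.isExactOn_ball).with_val_at c 0
  have hφd : DifferentiableOn ℂ φ (Metric.ball c R) :=
    fun w hw ↦ (hφ w hw).differentiableAt.differentiableWithinAt
  -- `g = g c * exp φ`
  have hexp : ∀ w ∈ Metric.ball c R, g w = g c * exp (φ w) := by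
    have hconst : ∀ w ∈ Metric.ball c R, g w * exp (-φ w) = g c * exp (-φ c) := by
      intro w hw
      refine (convex_ball c R).is_const_of_fderivWithin_eq_zero (𝕜 := ℂ)
        (f := fun w ↦ g w * exp (-φ w)) (hg.mul hφd.neg.cexp) ?_ hw hcb
      intro x hx
      rw [fderivWithin_of_isOpen Metric.isOpen_ball hx]
      have hgx : HasDerivAt g (deriv g x) x :=
        ((hg x hx).differentiableAt (Metric.isOpen_ball.mem_nhds hx)).hasDerivAt
      have h1 := hgx.mul (hφ x hx).neg.cexp
      have h2 : deriv g x * exp (-φ x) + g x * (exp (-φ x) * -(deriv g x / g x)) = 0 := by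
        field_simp [hne x hx]
        ring
      have h3 : HasDerivAt (fun w ↦ g w * exp (-φ w)) 0 x := h1.congr_deriv (by simpa using h2)
      ext
      simpa using h3.deriv
    intro w hw
    have h1 := hconst w hw
    rw [hφc, neg_zero, exp_zero, mul_one, exp_neg] at h1
    rw [← h1, mul_assoc, inv_mul_cancel₀ (exp_ne_zero _), mul_one]
  have hL : 0 < Real.log (M / m) := Real.log_pos (by rwa [one_lt_div hm])
  have hzb : z ∈ Metric.ball c R := by simpa [dist_eq_norm] using hz.trans_lt hrR
  -- `φ` is a branch of `log (g / g c)` vanishing at the centre, and its real part on the ball is at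
  -- most `log (M / m)`.
  have hbc : ‖φ z‖ ≤ 2 * Real.log (M / m) * r / (R - r) := by
    have := Complex.borelCaratheodory_zero (f := fun w ↦ φ (c + w)) (z := z - c) (R := R)
      hL ?_ ?_ hR ?_ (by simpa using hφc)
    · simp only [add_sub_cancel] at this
      refine this.trans ?_
      gcongr
    · refine hφd.comp (by fun_prop) fun w hw ↦ ?_
      simpa using hw
    · intro w hw
      have hw' : c + w ∈ Metric.ball c R := by simpa using hw
      have h1 := hM _ hw'
      rw [hexp _ hw', norm_mul, norm_exp] at h1
      have h2 : m * Real.exp (φ (c + w)).re ≤ M :=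
        (mul_le_mul_of_nonneg_right hc (Real.exp_pos _).le).trans h1
      simp only [mem_ofPred_eq]
      rw [Real.le_log_iff_exp_le (by positivity), le_div_iff₀ hm, mul_comm]
      exact h2
    · simpa using hz.trans_lt hrR
  rw [hexp z hzb, norm_mul, norm_exp]
  refine mul_le_mul hc ?_ (by positivity) (norm_nonneg _)
  rw [Real.rpow_def_of_pos (by positivity), Real.exp_le_exp]
  have h1 : Real.log (m / M) = -Real.log (M / m) := by rw [← Real.log_inv, inv_div]
  have h2 := abs_le.mp ((abs_re_le_norm (φ z)).trans hbc)
  rw [h1]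
  refine le_trans (le_of_eq ?_) h2.1
  field_simp

/-- The tested points have `Re z ≥ 0` and `|z| ≥ 2`, and the shifts are shorter than `1/4`, so
values near 0 never matter. This permits product formulas that break down at `z = 0`. -/
theorem RatioTempered.congr {f g : ℂ → ℂ} (hf : RatioTempered f)
    (h : ∀ z : ℂ, -(1 / 4) < z.re → 1 ≤ ‖z‖ → f z = g z) : RatioTempered g := by
  intro a ha
  obtain ⟨C, k, hC, h1, h2⟩ := hf a ha
  have hn : ‖(a : ℂ)‖ ≤ 1 / 4 := by
    rw [norm_real, Real.norm_of_nonneg ha.1.le]; exact ha.2.le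
  have ha0 := ha.1
  have ha1 := ha.2
  have e1 : ∀ z : ℂ, 0 ≤ z.re → 2 ≤ ‖z‖ → f (z - a) = g (z - a) := fun z hz0 hz ↦
    h _ (by simp; linarith) (by linarith [norm_sub_norm_le z a])
  have e2 : ∀ z : ℂ, 0 ≤ z.re → 2 ≤ ‖z‖ → f (z + a) = g (z + a) := fun z hz0 hz ↦
    h _ (by simp; linarith) (by have := norm_sub_norm_le z (-a); rw [norm_neg, sub_neg_eq_add] at this; linarith)
  refine ⟨C, k, hC, fun z hz hz2 ↦ ?_, fun x hx ↦ ?_⟩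
  · rw [← e1 z hz hz2, ← e2 z hz hz2]; exact h1 z hz hz2
  · have hx2 : 2 ≤ ‖(x : ℂ)‖ := by rw [norm_real]; exact hx.trans (le_abs_self x)
    have hx0 : 0 ≤ (x : ℂ).re := by rw [ofReal_re]; linarith
    rw [← e1 x hx0 hx2, ← e2 x hx0 hx2]; exact h2 x hx

/-- A zero-free function of polynomial growth which is bounded above and below far to the right
is ratio-tempered. -/
theorem ratioTempered_of_bounds {g : ℂ → ℂ} {K c : ℝ} {k : ℕ}
    (hg : DifferentiableOn ℂ g {z | 0 < z.re}) (hne : ∀ z : ℂ, 0 < z.re → g z ≠ 0)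
    (hup : ∀ z : ℂ, -(1 / 4) ≤ z.re → ‖g z‖ ≤ K * (1 + ‖z‖) ^ k) (hc : 0 < c)
    (hlow : ∀ z : ℂ, 3 / 2 ≤ z.re → c ≤ ‖g z‖) (hbd : ∀ z : ℂ, 3 / 2 ≤ z.re → ‖g z‖ ≤ K) :
    RatioTempered g := by
  intro h hh
  have hh0 := hh.1
  have hh1 := hh.2
  have hK : 0 < K := hc.trans_le ((hlow 2 (by norm_num)).trans (hbd 2 (by norm_num)))
  have hn : ‖(h : ℂ)‖ ≤ 1 / 4 := by
    rw [norm_real, Real.norm_of_nonneg hh.1.le]; exact hh.2.le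
  -- Around a centre with real part `3/2`, the ball of radius `R` stays in `Re > 0`, where `g` has
  -- no zeros, while radius `r` reaches back to `Re = h`. A lower bound is only needed there, since
  -- the denominator is evaluated at `z + h`.
  set R : ℝ := 3 / 2 - h / 2
  set r : ℝ := 3 / 2 - h
  obtain ⟨l, hl⟩ := exists_nat_ge (2 * r / (R - r))
  have hr : 0 ≤ r := by simp only [r]; linarith
  have hrR : r < R := by simp only [r, R]; linarith
  have lower : ∀ w : ℂ, h ≤ w.re →
      1 ≤ ‖g w‖ / c * ((K + c + 1) * (4 * (1 + ‖w‖)) ^ k / c) ^ l := by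
    intro w hw
    -- `M` bounds `g` on the whole ball and exceeds `c`. Being polynomial in `|w|`, it makes the
    -- lower bound a negative power of `1 + |w|`.
    set M : ℝ := (K + c + 1) * (4 * (1 + ‖w‖)) ^ k with hM
    have h1 : (1 : ℝ) ≤ (4 * (1 + ‖w‖)) ^ k := one_le_pow₀ (by linarith [norm_nonneg w])
    have hcM : c < M := by
      have : (K + c + 1) * 1 ≤ M := by rw [hM]; gcongr
      linarith
    have hM1 : 1 ≤ M / c := by rw [one_le_div hc]; exact hcM.le
    rcases le_total (3 / 2) w.re with h2 | h2
    · have : 1 ≤ ‖g w‖ / c := by rw [one_le_div hc]; exact hlow w h2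
      exact one_le_mul_of_one_le_of_one_le this (one_le_pow₀ hM1)
    · set c₀ : ℂ := (3 / 2 : ℝ) + w.im * I with hc₀
      have hre0 : c₀.re = 3 / 2 := by simp [hc₀]
      have hwc : ‖w - c₀‖ ≤ r := by
        have : w - c₀ = ((w.re - 3 / 2 : ℝ) : ℂ) := by
          apply Complex.ext <;> simp [hc₀]
        rw [this, norm_real, Real.norm_of_nonpos (by linarith)]
        simp only [r]; linarith
      have hball : ∀ v ∈ Metric.ball c₀ R, 0 < v.re := by
        intro v hv
        rw [Metric.mem_ball, dist_eq_norm] at hv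
        have := (abs_re_le_norm (v - c₀)).trans_lt hv
        rw [sub_re, hre0] at this
        have := (abs_lt.mp this).1
        simp only [R] at this; linarith
      have hb := norm_ge_of_ne_zero_on_ball (g := g) (c := c₀) (z := w) (M := M) (m := c) hr hrR
        (hg.mono hball) (fun v hv ↦ hne v (hball v hv)) ?_ hc hcM (hlow _ hre0.ge) hwc
      · have h3 : (c / M) ^ l ≤ (c / M) ^ (2 * r / (R - r)) := by
          rw [← Real.rpow_natCast]
          exact Real.rpow_le_rpow_of_exponent_ge (by positivity)
            ((div_le_one (hc.trans hcM)).mpr hcM.le) hl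
        have h4 : c * (c / M) ^ l ≤ ‖g w‖ := (by gcongr : c * (c / M) ^ l ≤ _).trans hb
        have hM0 : 0 < M := hc.trans hcM
        calc (1 : ℝ) = (c * (c / M) ^ l) / c * (M / c) ^ l := by
              rw [mul_div_cancel_left₀ _ hc.ne', ← mul_pow, div_mul_div_cancel₀ hM0.ne',
                div_self hc.ne', one_pow]
          _ ≤ _ := by gcongr
      · intro v hv
        have hv0 := hball v hv
        rw [Metric.mem_ball, dist_eq_norm] at hv
        have h5 : ‖v‖ ≤ ‖w‖ + 3 := by
          have : v = w + (v - c₀) + -(w - c₀) := by ring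
          have h6 : ‖v‖ ≤ ‖w‖ + ‖v - c₀‖ + ‖w - c₀‖ := by
            conv_lhs => rw [this]
            refine (norm_add_le _ _).trans ?_
            rw [norm_neg]
            gcongr
            exact norm_add_le _ _
          have : R + r ≤ 3 := by simp only [R, r]; linarith
          linarith
        refine (hup v (by linarith)).trans ?_
        rw [hM]
        gcongr
        · linarith
        · linarith [norm_nonneg w]
  refine ⟨K * 2 ^ k / c * ((K + c + 1) * 8 ^ k / c) ^ l + K / c, k + k * l, by positivity,
    fun z hz hz2 ↦ ?_, fun x hx ↦ ?_⟩
  · have h1 := lower (z + h) (by simpa using hz)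
    have hzn : ‖z + h‖ ≤ ‖z‖ + 1 / 4 := (norm_add_le _ _).trans (by gcongr)
    have hzn' : ‖z - h‖ ≤ ‖z‖ + 1 / 4 := (norm_sub_le _ _).trans (by gcongr)
    have h2 : ‖g (z - h)‖ ≤ K * (2 * (1 + ‖z‖)) ^ k := by
      refine (hup _ (by simp; linarith)).trans ?_
      gcongr
      linarith [norm_nonneg z]
    have h3 : (4 * (1 + ‖z + h‖)) ^ k ≤ (8 * (1 + ‖z‖)) ^ k :=
      pow_le_pow_left₀ (by positivity) (by linarith [norm_nonneg z]) k
    calc ‖g (z - h)‖ ≤ K * (2 * (1 + ‖z‖)) ^ k * 1 := by rw [mul_one]; exact h2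
      _ ≤ K * (2 * (1 + ‖z‖)) ^ k *
          (‖g (z + h)‖ / c * ((K + c + 1) * (8 * (1 + ‖z‖)) ^ k / c) ^ l) := by
            gcongr
            exact h1.trans (by gcongr)
      _ = K * 2 ^ k / c * ((K + c + 1) * 8 ^ k / c) ^ l * (1 + ‖z‖) ^ (k + k * l) *
          ‖g (z + h)‖ := by
            rw [pow_add, pow_mul, mul_pow, mul_pow]
            rw [show (K + c + 1) * (8 ^ k * (1 + ‖z‖) ^ k) / c =
              (K + c + 1) * 8 ^ k / c * (1 + ‖z‖) ^ k by ring, mul_pow]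
            ring
      _ ≤ _ := by
            gcongr
            have : 0 ≤ K / c := by positivity
            linarith
  · have h1 : 3 / 2 ≤ ((x : ℂ) - h).re := by simp; linarith
    have h2 : 3 / 2 ≤ ((x : ℂ) + h).re := by simp; linarith
    calc ‖g (x - h)‖ ≤ K := hbd _ h1
      _ = K / c * c := by field_simp
      _ ≤ K / c * ‖g (x + h)‖ := by gcongr; exact hlow _ h2
      _ ≤ _ := by
          gcongr
          have : 0 ≤ K * 2 ^ k / c * ((K + c + 1) * 8 ^ k / c) ^ l := by positivity
          linarith

/-! ### Elementary factors and Gamma factors -/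

theorem ratioTempered_exp_mul {a : ℝ} (ha : 0 ≤ a) :
    RatioTempered (fun z ↦ exp (a * z)) := by
  refine RatioTempered.of_bound fun h hh ↦ ⟨1, zero_le_one, fun z _ _ ↦ ?_⟩
  rw [one_mul, norm_exp, norm_exp, Real.exp_le_exp]
  have := mul_nonneg ha hh.1.le
  simp
  nlinarith

theorem ratioTempered_const_add {a : ℝ} (ha : 0 ≤ a) : RatioTempered (fun z ↦ a + z) := by
  refine RatioTempered.of_bound fun h hh ↦ ⟨1, zero_le_one, fun z hz _ ↦ ?_⟩
  rw [one_mul, ← sq_le_sq₀ (norm_nonneg _) (norm_nonneg _), ← normSq_eq_norm_sq,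
    ← normSq_eq_norm_sq, normSq_apply, normSq_apply]
  have := hh.1
  simp
  nlinarith

theorem ratioTempered_inv_pow (n : ℕ) : RatioTempered (fun z ↦ (z ^ n)⁻¹) := by
  refine RatioTempered.of_bound fun h hh ↦ ⟨2 ^ n, by positivity, fun z _ hz2 ↦ ?_⟩
  have hn : ‖(h : ℂ)‖ ≤ 1 / 4 := by
    rw [norm_real, Real.norm_of_nonneg hh.1.le]; exact hh.2.le
  have h1 : ‖z‖ - 1 / 4 ≤ ‖z - h‖ := by linarith [norm_sub_norm_le z h]
  have h2 : ‖z + h‖ ≤ ‖z‖ + 1 / 4 := (norm_add_le _ _).trans (by gcongr)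
  have h3 : ‖z‖ - 1 / 4 ≤ ‖z + h‖ := by
    have := norm_sub_norm_le z (-h); rw [norm_neg, sub_neg_eq_add] at this; linarith
  rw [norm_inv, norm_inv, norm_pow, norm_pow, ← inv_pow, ← inv_pow, ← mul_pow]
  gcongr
  rw [← div_eq_mul_inv, inv_le_comm₀ (by linarith) (div_pos two_pos (by linarith)), inv_div,
    div_le_iff₀ two_pos]
  linarith

/-- Ratios of Gamma values along horizontal shifts are bounded in half-planes `Re a ≥ δ > 0`. -/
theorem norm_Gamma_le_mul_norm_Gamma_add {δ h : ℝ} (hδ : 0 < δ) (hh : 0 < h) :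
    ∃ C : ℝ, 0 ≤ C ∧ ∀ a : ℂ, δ ≤ a.re → ‖Gamma a‖ ≤ C * ‖Gamma (a + h)‖ := by
  have hint : ∀ b : ℝ, 0 < b → IntervalIntegrable
      (fun t : ℝ ↦ t ^ (b - 1) * (1 - t) ^ (h - 1)) MeasureTheory.volume 0 1 := by
    intro b hb
    have := (betaIntegral_convergent (u := b) (v := h) (by simpa) (by simpa)).norm
    refine this.congr ?_
    intro t ht
    rw [uIoc_of_le zero_le_one] at ht
    rcases eq_or_lt_of_le ht.2 with h1 | h1
    · subst h1
      by_cases hz : h - 1 = 0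
      · simp [sub_eq_zero.mp hz]
      · have hz' : (h : ℂ) - 1 ≠ 0 := by exact_mod_cast hz
        simp [Real.zero_rpow hz, Complex.zero_cpow hz']
    · simp only [norm_mul]
      rw [norm_cpow_eq_rpow_re_of_pos ht.1,
        show (1 : ℂ) - (t : ℂ) = ((1 - t : ℝ) : ℂ) by simp,
        norm_cpow_eq_rpow_re_of_pos (by linarith)]
      simp
  -- Since `Γ(a)Γ(h) = Γ(a+h)B(a,h)`, it suffices to bound `B(a,h)`. In modulus it is at most
  -- `B(δ,h)`, independently of `Im a`, because `t^(Re a - 1) ≤ t^(δ-1)` on `(0,1]`.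
  set J : ℝ := ∫ t : ℝ in (0 : ℝ)..1, t ^ (δ - 1) * (1 - t) ^ (h - 1) with hJ
  have hJ0 : 0 ≤ J := by
    refine intervalIntegral.integral_nonneg zero_le_one fun t ht ↦ ?_
    exact mul_nonneg (Real.rpow_nonneg ht.1 _) (Real.rpow_nonneg (by linarith [ht.2]) _)
  have hG : 0 < Real.Gamma h := Real.Gamma_pos_of_pos hh
  refine ⟨J / Real.Gamma h, by positivity, fun a ha ↦ ?_⟩
  have ha0 : 0 < a.re := hδ.trans_le ha
  have hb := Gamma_mul_Gamma_eq_betaIntegral (s := a) (t := h) ha0 (by simpa)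
  have hbn : ‖betaIntegral a h‖ ≤ J := by
    refine intervalIntegral.norm_integral_le_of_norm_le zero_le_one ?_ (hint δ hδ)
    rw [MeasureTheory.ae_iff]
    refine MeasureTheory.measure_mono_null (t := {1}) (fun t ht ↦ ?_) (by simp)
    by_contra h1
    refine ht fun ht' ↦ ?_
    have ht1 : t < 1 := lt_of_le_of_ne ht'.2 h1
    rw [norm_mul, norm_cpow_eq_rpow_re_of_pos ht'.1,
      show (1 : ℂ) - (t : ℂ) = ((1 - t : ℝ) : ℂ) by simp,
      norm_cpow_eq_rpow_re_of_pos (by linarith)]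
    simp only [sub_re, one_re, ofReal_re]
    have : 0 ≤ (1 - t) ^ (h - 1) := Real.rpow_nonneg (by linarith) _
    exact mul_le_mul_of_nonneg_right
      (Real.rpow_le_rpow_of_exponent_ge ht'.1 ht'.2 (by linarith)) this
  have h2 : ‖Gamma a‖ * Real.Gamma h = ‖Gamma (a + h)‖ * ‖betaIntegral a h‖ := by
    rw [← norm_mul, ← hb, norm_mul, Gamma_ofReal, norm_real, Real.norm_of_nonneg hG.le]
  rw [div_mul_eq_mul_div, le_div_iff₀ hG, h2, mul_comm J]
  gcongr

/-- A horizontal step `2h` in the argument of `Gammaℝ` is a step `h` in that of `Γ`. With `b ≥ 1/2`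
and `h < 1/4` the left-hand argument keeps real part at least `1/8`. -/
theorem ratioTempered_Gammaℝ {b : ℝ} (hb : 1 / 2 ≤ b) :
    RatioTempered (fun z ↦ Gammaℝ (b + z)) := by
  refine RatioTempered.of_bound fun h hh ↦ ?_
  obtain ⟨C, hC, hC'⟩ := norm_Gamma_le_mul_norm_Gamma_add (δ := 1 / 8) (h := h) (by norm_num) hh.1
  refine ⟨Real.pi ^ h * C, by positivity, fun z hz _ ↦ ?_⟩
  have h1 := hC' ((b + (z - h)) / 2) (by
    have := hh.2
    simp; linarith)
  have h2 : (b + (z - h)) / 2 + h = (b + (z + h)) / 2 := by ring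
  rw [h2] at h1
  have hpi : ((Real.pi : ℝ) : ℂ) ^ (-(b + (z - h)) / 2) =
      Real.pi ^ (h : ℂ) * Real.pi ^ (-(b + (z + h)) / 2) := by
    rw [← cpow_add _ _ (by exact_mod_cast Real.pi_ne_zero)]
    congr 1; ring
  rw [Gammaℝ_def, Gammaℝ_def, hpi, norm_mul, norm_mul, norm_mul,
    norm_cpow_eq_rpow_re_of_pos Real.pi_pos, ofReal_re]
  calc _ ≤ Real.pi ^ h * ‖(Real.pi : ℂ) ^ (-(b + (z + h)) / 2)‖ *
        (C * ‖Gamma ((b + (z + h)) / 2)‖) := by gcongr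
    _ = _ := by ring

/-! ### Growth of Dirichlet L-functions and of zeta by Abel summation -/

/-- The Mellin-type integral `∫_1^∞ R(t) t^{-s-1} dt` of a bounded function is holomorphic for
`Re s > 0`. -/
theorem differentiableAt_integral_mul_cpow {R : ℝ → ℂ} (hR : Measurable R) {K : ℝ}
    (hK : ∀ t ∈ Ioi (1 : ℝ), ‖R t‖ ≤ K) {s : ℂ} (hs : 0 < s.re) :
    DifferentiableAt ℂ (fun s : ℂ ↦ ∫ t in Ioi (1 : ℝ), R t * (t : ℂ) ^ (-(s + 1))) s := by
  -- Extended by zero to `(0,1]`, `R` turns the integral into a Mellin transform at `-s`, whose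
  -- convergence at 0 is automatic.
  set f : ℝ → ℂ := (Ioi (1 : ℝ)).indicator R with hf
  have hb : ∀ t, ‖f t‖ ≤ K := by
    intro t
    by_cases ht : t ∈ Ioi (1 : ℝ)
    · rw [hf, indicator_of_mem ht]; exact hK t ht
    · rw [hf, indicator_of_notMem ht, norm_zero]
      exact (norm_nonneg _).trans (hK 2 (by norm_num))
  have hloc : LocallyIntegrable f volume :=
    (memLp_top_of_bound (hR.indicator measurableSet_Ioi).aestronglyMeasurable K
      (Eventually.of_forall hb)).locallyIntegrable le_top
  have hmel : DifferentiableAt ℂ (mellin f) (-s) := by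
    refine mellin_differentiableAt_of_isBigO_rpow (a := 0) (b := -s.re - 1)
      (hloc.locallyIntegrableOn _) ?_ (by simpa) ?_ (by simp)
    · refine Asymptotics.IsBigO.of_bound K (Eventually.of_forall fun t ↦ ?_)
      simpa using hb t
    · refine Asymptotics.IsBigO.of_bound 0 ?_
      filter_upwards [Ioo_mem_nhdsGT (zero_lt_one' ℝ)] with t ht
      rw [hf, indicator_of_notMem (by simpa using ht.2.le)]
      simp
  have heq : (fun s : ℂ ↦ ∫ t in Ioi (1 : ℝ), R t * (t : ℂ) ^ (-(s + 1))) =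
      fun s ↦ mellin f (-s) := by
    funext s
    have h1 : (fun t : ℝ ↦ (t : ℂ) ^ (-s - 1) • f t) =
        (Ioi (1 : ℝ)).indicator (fun t ↦ R t * (t : ℂ) ^ (-(s + 1))) := by
      funext t
      by_cases ht : t ∈ Ioi (1 : ℝ)
      · rw [hf, indicator_of_mem ht, indicator_of_mem ht, smul_eq_mul, mul_comm]
        congr 2; ring
      · rw [hf, indicator_of_notMem ht, indicator_of_notMem ht, smul_zero]
    rw [mellin, h1, setIntegral_indicator measurableSet_Ioi,
      inter_eq_self_of_subset_right (Ioi_subset_Ioi zero_le_one)]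
  rw [heq]
  exact DifferentiableAt.fun_comp' s hmel differentiableAt_id.neg

theorem norm_integral_mul_cpow_le {R : ℝ → ℂ} {K : ℝ}
    (hK : ∀ t ∈ Ioi (1 : ℝ), ‖R t‖ ≤ K) {s : ℂ} (hs : 0 < s.re) :
    ‖∫ t in Ioi (1 : ℝ), R t * (t : ℂ) ^ (-(s + 1))‖ ≤ K / s.re := by
  have h1 : ∫ t in Ioi (1 : ℝ), K * t ^ (-(s.re + 1)) = K / s.re := by
    rw [integral_const_mul, integral_Ioi_rpow_of_lt (by linarith) zero_lt_one]
    simp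
    field_simp
  rw [← h1]
  refine norm_integral_le_of_norm_le
    ((integrableOn_Ioi_rpow_of_lt (by linarith) zero_lt_one).const_mul K) ?_
  refine (ae_restrict_mem measurableSet_Ioi).mono fun t ht ↦ ?_
  have ht0 : (0 : ℝ) < t := zero_lt_one.trans ht
  rw [norm_mul, norm_cpow_eq_rpow_re_of_pos ht0]
  have := hK t ht
  simp only [neg_re, add_re, one_re]
  gcongr

/-- **Abel summation**: an L-series whose coefficient sums are `κ n + O(1)`. -/
theorem exists_LSeries_eq_of_partial_sums {a : ℕ → ℂ} {κ : ℂ} {K : ℝ}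
    (ha : ∀ s : ℂ, 1 < s.re → LSeriesSummable a s)
    (hK : ∀ n : ℕ, ‖∑ k ∈ Finset.Icc 1 n, a k - κ * n‖ ≤ K) :
    ∃ J : ℂ → ℂ, DifferentiableOn ℂ J {s | 0 < s.re} ∧
      (∀ s : ℂ, 0 < s.re → ‖J s‖ ≤ (K + ‖κ‖) / s.re) ∧
      ∀ s : ℂ, 1 < s.re → LSeries a s = κ * s / (s - 1) + s * J s := by
  set R : ℝ → ℂ := fun t ↦ ∑ k ∈ Finset.Icc 1 ⌊t⌋₊, a k - κ * t with hRdef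
  have hRm : Measurable R := by
    have h1 : Measurable (fun n : ℕ ↦ ∑ k ∈ Finset.Icc 1 n, a k) := measurable_from_top
    have h2 : Measurable (fun t : ℝ ↦ ∑ k ∈ Finset.Icc 1 ⌊t⌋₊, a k) := h1.comp Nat.measurable_floor
    exact h2.sub (measurable_const.mul measurable_ofReal)
  have hRK : ∀ t ∈ Ioi (1 : ℝ), ‖R t‖ ≤ K + ‖κ‖ := by
    intro t ht
    have ht0 : (0 : ℝ) ≤ t := (zero_lt_one.trans ht).le
    -- The hypothesis controls integer cut-offs only; the fractional part of `t` costs the extra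
    -- `‖κ‖`.
    have h1 : R t = (∑ k ∈ Finset.Icc 1 ⌊t⌋₊, a k - κ * ⌊t⌋₊) + κ * ((⌊t⌋₊ - t : ℝ) : ℂ) := by
      simp only [hRdef]; push_cast; ring
    rw [h1]
    refine (norm_add_le _ _).trans (add_le_add (hK _) ?_)
    rw [norm_mul, norm_real]
    refine mul_le_of_le_one_right (norm_nonneg _) ?_
    rw [Real.norm_eq_abs, abs_le]
    constructor <;> linarith [Nat.floor_le ht0, Nat.lt_floor_add_one t]
  refine ⟨fun s ↦ ∫ t in Ioi (1 : ℝ), R t * (t : ℂ) ^ (-(s + 1)),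
    fun s hs ↦ (differentiableAt_integral_mul_cpow hRm hRK hs).differentiableWithinAt,
    fun s hs ↦ norm_integral_mul_cpow_le hRK hs, fun s hs ↦ ?_⟩
  have hs0 : 0 < s.re := by linarith
  have hO : (fun n ↦ ∑ k ∈ Finset.Icc 1 n, a k) =O[atTop] fun n ↦ (n : ℝ) ^ (1 : ℝ) := by
    refine Asymptotics.IsBigO.of_bound (K + ‖κ‖) ?_
    filter_upwards [eventually_ge_atTop 1] with n hn
    have hn1 : (1 : ℝ) ≤ n := by exact_mod_cast hn
    have hK0 : 0 ≤ K := (norm_nonneg _).trans (hK 0)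
    rw [Real.rpow_one, Real.norm_of_nonneg (by positivity)]
    calc _ = ‖(∑ k ∈ Finset.Icc 1 n, a k - κ * n) + κ * n‖ := by rw [sub_add_cancel]
      _ ≤ K + ‖κ‖ * n := by
          refine (norm_add_le _ _).trans (add_le_add (hK n) ?_)
          simp
      _ ≤ _ := by nlinarith [norm_nonneg κ]
  rw [LSeries_eq_mul_integral a zero_le_one hs (ha s hs) hO]
  have hi1 : IntegrableOn (fun t : ℝ ↦ R t * (t : ℂ) ^ (-(s + 1))) (Ioi 1) := by
    refine Integrable.bdd_mul (c := K + ‖κ‖) ?_ hRm.aestronglyMeasurable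
      ((ae_restrict_mem measurableSet_Ioi).mono hRK)
    exact integrableOn_Ioi_cpow_of_lt (by simpa using hs0) zero_lt_one
  have hi2 : IntegrableOn (fun t : ℝ ↦ κ * (t : ℂ) ^ (-s)) (Ioi 1) :=
    (integrableOn_Ioi_cpow_of_lt (by simpa using hs) zero_lt_one).const_mul κ
  have h2 : ∫ t in Ioi (1 : ℝ), (∑ k ∈ Finset.Icc 1 ⌊t⌋₊, a k) * (t : ℂ) ^ (-(s + 1)) =
      (∫ t in Ioi (1 : ℝ), R t * (t : ℂ) ^ (-(s + 1))) +
        ∫ t in Ioi (1 : ℝ), κ * (t : ℂ) ^ (-s) := by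
    rw [← integral_add hi1 hi2]
    refine setIntegral_congr_fun measurableSet_Ioi fun t ht ↦ ?_
    have ht0 : (t : ℂ) ≠ 0 := by exact_mod_cast (zero_lt_one.trans ht).ne'
    have h3 : (t : ℂ) ^ (-s) = t * (t : ℂ) ^ (-(s + 1)) := by
      rw [show -s = -(s + 1) + 1 by ring, cpow_add _ _ ht0, cpow_one, mul_comm]
    simp only [hRdef]
    rw [h3]; ring
  have hs1 : s - 1 ≠ 0 := by
    intro h; rw [sub_eq_zero] at h; rw [h] at hs; simp at hs
  have hs1' : -s + 1 ≠ 0 := by rwa [show -s + 1 = -(s - 1) by ring, neg_ne_zero]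
  rw [h2, integral_const_mul, integral_Ioi_cpow_of_lt (by simpa using hs) zero_lt_one]
  simp only [ofReal_one, one_cpow]
  field_simp
  ring

theorem isPreconnected_re_pos : IsPreconnected {s : ℂ | 0 < s.re} :=
  (convex_halfSpace_re_gt 0).isPreconnected

theorem isOpen_re_pos : IsOpen {s : ℂ | 0 < s.re} := isOpen_lt continuous_const continuous_re

/-- Two functions holomorphic in `Re s > 0` that agree on `Re s > 1` agree. -/
theorem eqOn_re_pos_of_eqOn_one_lt_re {f g : ℂ → ℂ} (hf : DifferentiableOn ℂ f {s | 0 < s.re})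
    (hg : DifferentiableOn ℂ g {s | 0 < s.re}) (h : ∀ s : ℂ, 1 < s.re → f s = g s) :
    ∀ s : ℂ, 0 < s.re → f s = g s := by
  have h2 : (2 : ℂ) ∈ {s : ℂ | 0 < s.re} := by simp
  have := (hf.analyticOnNhd isOpen_re_pos).eqOn_of_preconnected_of_eventuallyEq
    (hg.analyticOnNhd isOpen_re_pos) isPreconnected_re_pos h2 ?_
  · exact this
  · filter_upwards [(isOpen_lt continuous_const continuous_re).mem_nhds
      (show (2 : ℂ) ∈ {s : ℂ | 1 < s.re} by simp)] with s hs using h s hs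

/-- Partial sums of a nontrivial Dirichlet character are bounded. -/
theorem DirichletCharacter.exists_norm_sum_Icc_le {N : ℕ} [NeZero N] {χ : DirichletCharacter ℂ N}
    (hχ : χ ≠ 1) : ∃ K : ℝ, ∀ n : ℕ, ‖∑ k ∈ Finset.Icc 1 n, χ k‖ ≤ K := by
  set S : ℕ → ℂ := fun n ↦ ∑ k ∈ Finset.range n, χ ((k + 1 : ℕ) : ZMod N) with hS
  -- Any `N` consecutive integers form a complete residue system, so the partial sums are periodic
  -- and hence bounded.
  have hwin : ∀ m : ℕ, ∑ k ∈ Finset.range N, χ ((m + k : ℕ) : ZMod N) = 0 := by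
    intro m
    rw [← χ.sum_eq_zero_of_ne_one hχ, ← Equiv.sum_comp (Equiv.addLeft (m : ZMod N))]
    refine Finset.sum_nbij' (fun k : ℕ ↦ (k : ZMod N)) ZMod.val (by simp)
      (fun k _ ↦ Finset.mem_range.mpr (ZMod.val_lt k))
      (fun k hk ↦ ZMod.val_cast_of_lt (Finset.mem_range.mp hk)) (by simp) (by simp)
  have hper : Function.Periodic S N := by
    intro n
    simp only [hS]
    rw [Finset.sum_range_add]
    have := hwin (n + 1)
    simp only [add_right_comm] at this ⊢
    rw [this, add_zero]
  refine ⟨∑ n ∈ Finset.range N, ‖S n‖, fun n ↦ ?_⟩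
  have h1 : ∑ k ∈ Finset.Icc 1 n, χ k = S n := by
    simp only [hS]
    rw [Finset.range_eq_Ico, Finset.sum_Ico_add' (fun k : ℕ ↦ χ (k : ZMod N)) 0 n 1]
    rfl
  rw [h1, ← hper.map_mod_nat n]
  exact Finset.single_le_sum (f := fun n ↦ ‖S n‖) (fun _ _ ↦ norm_nonneg _)
    (Finset.mem_range.mpr (Nat.mod_lt n (NeZero.pos N)))

/-- Polynomial growth of `L(s, χ)` in `Re s ≥ 1/4`. -/
theorem DirichletCharacter.exists_norm_LFunction_le {N : ℕ} [NeZero N]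
    {χ : DirichletCharacter ℂ N} (hχ : χ ≠ 1) :
    ∃ K : ℝ, 0 ≤ K ∧ ∀ s : ℂ, 1 / 4 ≤ s.re → ‖LFunction χ s‖ ≤ K * ‖s‖ := by
  obtain ⟨K, hK⟩ := exists_norm_sum_Icc_le hχ
  have hK0 : 0 ≤ K := (norm_nonneg _).trans (hK 0)
  obtain ⟨J, hJd, hJn, hJ⟩ := exists_LSeries_eq_of_partial_sums (a := fun n : ℕ ↦ χ n) (κ := 0) (K := K)
    (fun s hs ↦ LSeriesSummable_of_one_lt_re χ hs) (by simpa using hK)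
  have heq := eqOn_re_pos_of_eqOn_one_lt_re (f := LFunction χ) (g := fun s ↦ s * J s)
    (differentiable_LFunction hχ).differentiableOn (differentiableOn_id.mul hJd) fun s hs ↦ by
      rw [LFunction_eq_LSeries χ hs, hJ s hs]; simp
  refine ⟨4 * K, by positivity, fun s hs ↦ ?_⟩
  have hs0 : 0 < s.re := by linarith
  rw [heq s hs0, norm_mul, mul_comm]
  gcongr
  refine (hJn s hs0).trans ?_
  rw [norm_zero, add_zero, div_le_iff₀ hs0]
  nlinarith

/-- The Riemann xi function `s (s - 1) Λ(s)`, as an entire function. -/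
noncomputable def riemannXi (s : ℂ) : ℂ := s * (s - 1) * completedRiemannZeta₀ s + 1

theorem differentiable_riemannXi : Differentiable ℂ riemannXi := by
  have := differentiable_completedZeta₀
  unfold riemannXi
  fun_prop

theorem riemannXi_one_sub (s : ℂ) : riemannXi (1 - s) = riemannXi s := by
  rw [riemannXi, riemannXi, completedRiemannZeta₀_one_sub]; ring

theorem riemannXi_eq {s : ℂ} (hs : 0 < s.re) (hs1 : s ≠ 1) :
    riemannXi s = s * (s - 1) * (Gammaℝ s * riemannZeta s) := by
  have hs0 : s ≠ 0 := by rintro rfl; simp at hs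
  have h1 : (1 : ℂ) - s ≠ 0 := sub_ne_zero.mpr hs1.symm
  rw [riemannZeta_def_of_ne_zero hs0, mul_div_cancel₀ _ (Gammaℝ_ne_zero_of_re_pos hs),
    completedRiemannZeta_eq, riemannXi]
  field_simp
  ring

/-- The left side is holomorphic at `s = 1` as well, so it serves as the continuation of `(s-1)ζ(s)`
through the pole of `ζ`. -/
theorem riemannXi_div_eq {s : ℂ} (hs : 0 < s.re) (hs1 : s ≠ 1) :
    riemannXi s * (Gammaℝ s)⁻¹ / s = (s - 1) * riemannZeta s := by
  have hs0 : s ≠ 0 := by rintro rfl; simp at hs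
  have := Gammaℝ_ne_zero_of_re_pos hs
  rw [riemannXi_eq hs hs1]
  field_simp

theorem differentiableOn_riemannXi_div :
    DifferentiableOn ℂ (fun s ↦ riemannXi s * (Gammaℝ s)⁻¹ / s) {s | 0 < s.re} :=
  ((differentiable_riemannXi.mul differentiable_Gammaℝ_inv).differentiableOn).div
    differentiableOn_id (fun s hs h ↦ by rw [h] at hs; simp at hs)

/-- Polynomial growth of `(s - 1) ζ(s)` in `Re s ≥ 1/4`. -/
theorem norm_riemannXi_div_le {s : ℂ} (hs : 1 / 4 ≤ s.re) :
    ‖riemannXi s * (Gammaℝ s)⁻¹ / s‖ ≤ 4 * (1 + ‖s‖) ^ 2 := by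
  obtain ⟨J, hJd, hJn, hJ⟩ := exists_LSeries_eq_of_partial_sums (a := 1) (κ := 1) (K := 0)
    (fun s hs ↦ LSeriesSummable_one_iff.mpr hs) (by simp)
  have heq := eqOn_re_pos_of_eqOn_one_lt_re (g := fun s ↦ s + (s - 1) * (s * J s))
    differentiableOn_riemannXi_div
    (differentiableOn_id.add ((differentiableOn_id.sub_const 1).mul (differentiableOn_id.mul hJd)))
    fun s hs ↦ by
      have hs1 : s ≠ 1 := by rintro rfl; simp at hs
      rw [riemannXi_div_eq (by linarith) hs1, ← LSeries_one_eq_riemannZeta hs, hJ s hs]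
      have := sub_ne_zero.mpr hs1
      field_simp
  have hs0 : 0 < s.re := by linarith
  rw [heq s hs0]
  have h1 : ‖J s‖ ≤ 4 := by
    refine (hJn s hs0).trans ?_
    rw [norm_one, zero_add, div_le_iff₀ hs0]
    linarith
  have h2 : ‖s - 1‖ ≤ 1 + ‖s‖ := by
    refine (norm_sub_le _ _).trans ?_; rw [norm_one, add_comm]
  calc _ ≤ ‖s‖ + ‖s - 1‖ * (‖s‖ * ‖J s‖) := by
        refine (norm_add_le _ _).trans ?_; rw [norm_mul, norm_mul]
    _ ≤ ‖s‖ + (1 + ‖s‖) * (‖s‖ * 4) := by gcongr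
    _ ≤ _ := by nlinarith [norm_nonneg s]

/-- For `Re s ≥ 2` the values of a Dirichlet L-function are bounded away from `0` and `∞`. -/
theorem DirichletCharacter.exists_LFunction_bounds {N : ℕ} [NeZero N]
    (χ : DirichletCharacter ℂ N) : ∃ c K : ℝ, 0 < c ∧
      ∀ s : ℂ, 2 ≤ s.re → c ≤ ‖LFunction χ s‖ ∧ ‖LFunction χ s‖ ≤ K := by
  have hsum : HasSum (fun n : ℕ ↦ 1 / (n : ℝ) ^ 2) (Real.pi ^ 2 / 6) := hasSum_zeta_two
  have hs1 : HasSum (fun n : ℕ ↦ if n = 1 then (0 : ℝ) else 1 / (n : ℝ) ^ 2)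
      (Real.pi ^ 2 / 6 - 1) := by
    have := hsum.sub (hasSum_ite_eq 1 (1 : ℝ))
    have he : (fun n : ℕ ↦ if n = 1 then (0 : ℝ) else 1 / (n : ℝ) ^ 2) =
        fun n : ℕ ↦ 1 / (n : ℝ) ^ 2 - if n = 1 then 1 else 0 := by
      funext n
      split_ifs with h <;> simp [h]
    rwa [he]
  -- For `Re s ≥ 2` the tail satisfies `|L - 1| ≤ ζ(2) - 1`, and this being less than 1 keeps `L`
  -- away from 0.
  have hpi : Real.pi ^ 2 / 6 - 1 < 1 := by nlinarith [Real.pi_lt_d2, Real.pi_pos]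
  refine ⟨1 - (Real.pi ^ 2 / 6 - 1), 1 + (Real.pi ^ 2 / 6 - 1), by linarith, fun s hs ↦ ?_⟩
  have hs' : 1 < s.re := by linarith
  have key : ‖LFunction χ s - 1‖ ≤ Real.pi ^ 2 / 6 - 1 := by
    have hL : HasSum (LSeries.term (fun n : ℕ ↦ χ n) s) (LFunction χ s) := by
      rw [LFunction_eq_LSeries χ hs']
      exact (LSeriesSummable_of_one_lt_re χ hs').LSeriesHasSum
    have hL1 := hL.sub (hasSum_ite_eq 1 (1 : ℂ))
    refine hL1.norm_le_of_bounded hs1 fun n ↦ ?_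
    rcases eq_or_ne n 1 with rfl | hn
    · simp [LSeries.term]
    · rw [if_neg hn, if_neg hn, sub_zero]
      rcases eq_or_ne n 0 with rfl | hn0
      · simp
      · rw [LSeries.norm_term_eq, if_neg hn0]
        have hn1 : (1 : ℝ) ≤ n := by exact_mod_cast Nat.one_le_iff_ne_zero.mpr hn0
        have h2 : (n : ℝ) ^ 2 ≤ (n : ℝ) ^ s.re := by
          rw [← Real.rpow_natCast]
          exact Real.rpow_le_rpow_of_exponent_le hn1 (by exact_mod_cast hs)
        exact div_le_div₀ zero_le_one (χ.norm_le_one _) (by positivity) h2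
  constructor
  · have := norm_sub_norm_le (1 : ℂ) (1 - LFunction χ s)
    rw [norm_sub_rev 1 (LFunction χ s)] at this
    simp at this
    linarith
  · have := norm_add_le (LFunction χ s - 1) 1
    simp at this
    linarith

/-! ### Growth of the digamma function -/

theorem norm_exp_sub_one_le_of_re_nonpos {z : ℂ} (hz : z.re ≤ 0) : ‖exp z - 1‖ ≤ ‖z‖ := by
  have h := Convex.norm_image_sub_le_of_norm_hasDerivWithin_le (𝕜 := ℂ) (f := exp) (f' := exp)
    (C := 1) (s := {w : ℂ | w.re ≤ 0}) (x := 0) (y := z)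
    (fun w _ ↦ (hasDerivAt_exp w).hasDerivWithinAt)
    (fun w hw ↦ by rw [norm_exp]; exact Real.exp_le_one_iff.mpr hw)
    (convex_halfSpace_re_le 0) (by simp) hz
  simpa using h

/-- Interpolates between the trivial bound 2 and the Lipschitz bound `|w|(1-t)/t` by a geometric
mean. The factor `√(1-t)` survives to tame a later `(1-t)⁻¹`, at the cost of only `√|w|`. -/
theorem norm_cpow_sub_one_le {t : ℝ} (ht0 : 0 < t) (ht1 : t ≤ 1) {w : ℂ} (hw : 0 ≤ w.re) :
    ‖(t : ℂ) ^ w - 1‖ ≤ 2 * (Real.sqrt ‖w‖ * Real.sqrt ((1 - t) / t)) := by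
  have hlog : Real.log t ≤ 0 := Real.log_nonpos ht0.le ht1
  have hre : (Complex.log t * w).re ≤ 0 := by
    rw [← ofReal_log ht0.le, re_ofReal_mul]
    exact mul_nonpos_of_nonpos_of_nonneg hlog hw
  have he : (t : ℂ) ^ w = exp (Complex.log t * w) := cpow_def_of_ne_zero (by exact_mod_cast ht0.ne') w
  have h1 : ‖(t : ℂ) ^ w - 1‖ ≤ 2 := by
    refine (norm_sub_le _ _).trans ?_
    rw [he, norm_exp, norm_one]
    linarith [Real.exp_le_one_iff.mpr hre]
  have h2 : ‖(t : ℂ) ^ w - 1‖ ≤ ‖w‖ * ((1 - t) / t) := by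
    rw [he]
    refine (norm_exp_sub_one_le_of_re_nonpos hre).trans ?_
    rw [norm_mul, mul_comm, ← ofReal_log ht0.le, norm_real, Real.norm_of_nonpos hlog]
    gcongr
    rw [← Real.log_inv]
    refine (Real.log_le_sub_one_of_pos (by positivity)).trans (le_of_eq ?_)
    field_simp
  have h0 : 0 ≤ (1 - t) / t := div_nonneg (by linarith) ht0.le
  rw [← Real.sqrt_mul (norm_nonneg _)]
  refine (Real.le_sqrt (norm_nonneg _) (by positivity) |>.mpr
    (show ‖(t : ℂ) ^ w - 1‖ ^ 2 ≤ 2 ^ 2 * (‖w‖ * ((1 - t) / t)) by nlinarith [norm_nonneg ((t : ℂ) ^ w - 1)])).trans ?_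
  rw [Real.sqrt_mul (by norm_num), Real.sqrt_sq (by norm_num)]

/-- The integral `∫_0^1 dt / sqrt (t (1 - t))` converges. -/
theorem intervalIntegrable_inv_sqrt :
    IntervalIntegrable (fun t : ℝ ↦ t ^ (-(1 / 2) : ℝ) * (1 - t) ^ (-(1 / 2) : ℝ)) volume 0 1 := by
  have := (betaIntegral_convergent (u := 1 / 2) (v := 1 / 2) (by norm_num) (by norm_num)).norm
  refine this.congr_ae ?_
  rw [uIoc_of_le zero_le_one]
  have h1 : ∀ᵐ t : ℝ ∂(volume.restrict (Ioc (0 : ℝ) 1)), t ≠ 1 :=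
    ae_restrict_of_ae (by simp [ae_iff])
  filter_upwards [h1, ae_restrict_mem measurableSet_Ioc] with t ht1 ht
  have ht1 : t < 1 := lt_of_le_of_ne ht.2 ht1
  rw [norm_mul, norm_cpow_eq_rpow_re_of_pos ht.1,
    show (1 : ℂ) - (t : ℂ) = ((1 - t : ℝ) : ℂ) by simp,
    norm_cpow_eq_rpow_re_of_pos (by linarith)]
  norm_num

/-- Differences of Beta integrals `B(s, h) - B(1, h)` are `O(|s - 1|^{1/2})` uniformly in `h`. -/
theorem norm_betaIntegral_sub_le {s : ℂ} (hs : 1 ≤ s.re) {h : ℝ} (hh : 0 < h) :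
    ‖betaIntegral s h - betaIntegral 1 h‖ ≤ 2 * Real.sqrt ‖s - 1‖ *
      ∫ t : ℝ in (0 : ℝ)..1, t ^ (-(1 / 2) : ℝ) * (1 - t) ^ (-(1 / 2) : ℝ) := by
  have hc1 := betaIntegral_convergent (u := s) (v := h) (by linarith) (by simpa)
  have hc2 := betaIntegral_convergent (u := 1) (v := h) (by simp) (by simpa)
  rw [betaIntegral, betaIntegral, ← intervalIntegral.integral_sub hc1 hc2,
    ← intervalIntegral.integral_const_mul]
  refine intervalIntegral.norm_integral_le_of_norm_le zero_le_one ?_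
    (intervalIntegrable_inv_sqrt.const_mul _)
  have h1 : ∀ᵐ t : ℝ, t ≠ 1 := by simp [ae_iff]
  filter_upwards [h1] with t ht1 ht
  have ht1 : t < 1 := lt_of_le_of_ne ht.2 ht1
  have ht1' : 0 < 1 - t := by linarith
  have ht0 := ht.1
  rw [sub_self, cpow_zero, ← sub_mul, norm_mul,
    show (1 : ℂ) - (t : ℂ) = ((1 - t : ℝ) : ℂ) by simp,
    norm_cpow_eq_rpow_re_of_pos ht1']
  have h2 := norm_cpow_sub_one_le ht0 ht.2 (w := s - 1) (by simpa using hs)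
  -- Discarding `h` gives uniformity as `h → 0`. The non-integrable `(1-t)⁻¹` is compensated by the
  -- vanishing of `t^(s-1) - 1` at `t = 1`.
  have h3 : (1 - t) ^ ((h : ℂ) - 1).re ≤ (1 - t) ^ (-1 : ℝ) :=
    Real.rpow_le_rpow_of_exponent_ge ht1' (by linarith) (by simp; linarith)
  calc _ ≤ 2 * (Real.sqrt ‖s - 1‖ * Real.sqrt ((1 - t) / t)) * (1 - t) ^ (-1 : ℝ) := by gcongr
    _ = _ := by
      rw [Real.sqrt_div ht1'.le, Real.sqrt_eq_rpow (1 - t), Real.sqrt_eq_rpow t,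
        Real.rpow_neg ht0.le, show (-(1 / 2) : ℝ) = 1 / 2 + (-1) by norm_num,
        Real.rpow_add ht1']
      ring

/-- The digamma function grows at most like `|s|^{1/2}` in `Re s ≥ 1`. -/
theorem exists_norm_digamma_sub_le : ∃ K : ℝ, 0 ≤ K ∧ ∀ s : ℂ, 1 ≤ s.re →
    ‖digamma s - digamma 1‖ ≤ K * Real.sqrt ‖s - 1‖ := by
  set J := ∫ t : ℝ in (0 : ℝ)..1, t ^ (-(1 / 2) : ℝ) * (1 - t) ^ (-(1 / 2) : ℝ) with hJ
  have hJ0 : 0 ≤ J := by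
    refine intervalIntegral.integral_nonneg zero_le_one fun t ht ↦ ?_
    exact mul_nonneg (Real.rpow_nonneg ht.1 _) (Real.rpow_nonneg (by linarith [ht.2]) _)
  refine ⟨2 * J, by positivity, fun s hs ↦ ?_⟩
  -- `φ u h = Γ(u) / Γ(u + h)`, whose derivative at `h = 0` is `-ψ(u)`
  have hder : ∀ u : ℂ, 0 < u.re →
      HasDerivAt (fun h : ℝ ↦ Gamma u / Gamma (u + h)) (-digamma u) 0 := by
    intro u hu
    have hne : Gamma u ≠ 0 := Gamma_ne_zero_of_re_pos hu
    have hd : DifferentiableAt ℂ Gamma u := differentiableAt_Gamma u fun m hm ↦ by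
      rw [hm] at hu
      simp at hu
      linarith [(Nat.cast_nonneg m : (0 : ℝ) ≤ m)]
    have h1 : HasDerivAt Gamma (deriv Gamma u) (u + ((0 : ℝ) : ℂ)) := by simpa using hd.hasDerivAt
    have h2 : HasDerivAt (fun t : ℝ ↦ u + (t : ℂ)) 1 0 := by
      simpa using (Complex.ofRealCLM.hasDerivAt (x := (0 : ℝ))).const_add u
    have h3 := h1.comp (0 : ℝ) h2
    have h4 := (hasDerivAt_const (0 : ℝ) (Gamma u)).div h3 (by simpa using hne)
    refine (h4.congr_deriv ?_)
    simp only [Function.comp, ofReal_zero, add_zero, mul_one, zero_mul, zero_sub]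
    rw [digamma_def, logDeriv_apply]
    field_simp
  have hdiff := ((hder s (by linarith)).sub (hder 1 (by simp))).tendsto_slope_zero_right
  -- The factor `Γ(h+1) = hΓ(h)` tends to 1 and turns the difference quotient into `B(s,h) -
  -- B(1,h)`, which is bounded uniformly in `h`.
  have hlim : Tendsto (fun h : ℝ ↦ ‖Gamma (h + 1)‖ * ‖h⁻¹ • ((Gamma s / Gamma (s + h) -
      Gamma 1 / Gamma (1 + h)) - (Gamma s / Gamma (s + (0 : ℝ)) -
      Gamma 1 / Gamma (1 + (0 : ℝ))))‖) (𝓝[>] 0) (𝓝 (‖Gamma (((0 : ℝ) : ℂ) + 1)‖ *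
        ‖-digamma s - -digamma 1‖)) := by
    refine Tendsto.mul ?_ ?_
    · refine Tendsto.norm (Tendsto.mono_left ?_ nhdsWithin_le_nhds)
      have hc : ContinuousAt Gamma (((0 : ℝ) : ℂ) + 1) :=
        (differentiableAt_Gamma _ fun m hm ↦ by
          have := congrArg re hm
          simp at this
          linarith [(Nat.cast_nonneg m : (0 : ℝ) ≤ m)]).continuousAt
      have hc2 : ContinuousAt (fun h : ℝ ↦ (h : ℂ) + 1) 0 := by fun_prop
      exact ContinuousAt.comp (f := fun h : ℝ ↦ (h : ℂ) + 1) hc hc2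
    · simpa using hdiff.norm
  have hle := le_of_tendsto hlim (b := 2 * Real.sqrt ‖s - 1‖ * J) ?_
  · have h1 : -digamma s - -digamma 1 = -(digamma s - digamma 1) := by ring
    simp only [ofReal_zero, zero_add, Gamma_one, norm_one, one_mul] at hle
    rw [h1, norm_neg] at hle
    linarith
  · filter_upwards [self_mem_nhdsWithin] with h hh
    have hh0 : (0 : ℝ) < h := hh
    have hb : ∀ u : ℂ, 0 < u.re → Gamma h * (Gamma u / Gamma (u + h)) = betaIntegral u h := by
      intro u hu
      have := Gamma_mul_Gamma_eq_betaIntegral (s := u) (t := h) hu (by simpa)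
      have hne : Gamma (u + h) ≠ 0 := Gamma_ne_zero_of_re_pos (by simp; linarith)
      rw [mul_div_assoc', mul_comm, this]
      field_simp
    have hz : Gamma s / Gamma (s + (0 : ℝ)) - Gamma 1 / Gamma (1 + (0 : ℝ)) = 0 := by
      have : Gamma s ≠ 0 := Gamma_ne_zero_of_re_pos (by linarith)
      simp [this]
    rw [hz, sub_zero, ← norm_mul, Gamma_add_one _ (by exact_mod_cast hh0.ne')]
    have h3 : (h : ℂ) * Gamma h * (h⁻¹ • (Gamma s / Gamma (s + h) - Gamma 1 / Gamma (1 + h))) =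
        betaIntegral s h - betaIntegral 1 h := by
      rw [← hb s (by linarith), ← hb 1 (by simp), real_smul, ofReal_inv]
      have : (h : ℂ) ≠ 0 := by exact_mod_cast hh0.ne'
      field_simp
    rw [h3]
    exact norm_betaIntegral_sub_le hs hh0

/-- The digamma function grows at most like `|s|^{1/2}` in `Re s ≥ 1/4`. -/
theorem exists_norm_digamma_le : ∃ K : ℝ, 0 ≤ K ∧ ∀ s : ℂ, 1 / 4 ≤ s.re →
    ‖digamma s‖ ≤ K * Real.sqrt (1 + ‖s‖) := by
  obtain ⟨K, hK, h⟩ := exists_norm_digamma_sub_le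
  refine ⟨K + ‖digamma 1‖ + 4, by positivity, fun s hs ↦ ?_⟩
  have hs0 : 0 < s.re := by linarith
  have h1 := h (s + 1) (by simp; linarith)
  rw [add_sub_cancel_right] at h1
  have h2 := digamma_apply_add_one s fun m hm ↦ by
    rw [hm] at hs0
    simp at hs0
    linarith [(Nat.cast_nonneg m : (0 : ℝ) ≤ m)]
  have h3 : ‖s⁻¹‖ ≤ 4 := by
    rw [norm_inv, inv_le_comm₀ (norm_pos_iff.mpr (by rintro rfl; simp at hs0)) (by norm_num)]
    have := (le_abs_self _).trans (abs_re_le_norm s)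
    linarith
  have h4 : digamma s = (digamma (s + 1) - digamma 1) + digamma 1 - s⁻¹ := by rw [h2]; ring
  have h5 : (1 : ℝ) ≤ Real.sqrt (1 + ‖s‖) := by
    rw [Real.one_le_sqrt]; linarith [norm_nonneg s]
  have h6 : Real.sqrt ‖s‖ ≤ Real.sqrt (1 + ‖s‖) := Real.sqrt_le_sqrt (by linarith)
  calc ‖digamma s‖ ≤ K * Real.sqrt ‖s‖ + ‖digamma 1‖ + 4 := by
        rw [h4]
        refine (norm_sub_le _ _).trans (add_le_add ((norm_add_le _ _).trans ?_) h3)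
        gcongr
    _ ≤ K * Real.sqrt (1 + ‖s‖) + ‖digamma 1‖ * Real.sqrt (1 + ‖s‖) +
        4 * Real.sqrt (1 + ‖s‖) := by
        gcongr
        · exact le_mul_of_one_le_right (norm_nonneg _) h5
        · linarith
    _ = _ := by ring

theorem logDeriv_Gammaℝ {s : ℂ} (hs : 0 < s.re) :
    logDeriv Gammaℝ s = -(Complex.log Real.pi) / 2 + digamma (s / 2) / 2 := by
  have hpi : (Real.pi : ℂ) ≠ 0 := by exact_mod_cast Real.pi_ne_zero
  have hs2 : 0 < (s / 2).re := by simpa using hs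
  have hd : DifferentiableAt ℂ Gamma (s / 2) := differentiableAt_Gamma _ fun m hm ↦ by
    rw [hm] at hs2
    simp at hs2
    linarith [(Nat.cast_nonneg m : (0 : ℝ) ≤ m)]
  have h1 : HasDerivAt (fun s : ℂ ↦ (Real.pi : ℂ) ^ (-s / 2))
      ((Real.pi : ℂ) ^ (-s / 2) * Complex.log Real.pi * (-1 / 2)) s :=
    ((hasDerivAt_id s).neg.div_const 2).const_cpow (Or.inl hpi)
  have h2 : HasDerivAt (fun s : ℂ ↦ Gamma (s / 2)) (deriv Gamma (s / 2) * (1 / 2)) s :=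
    hd.hasDerivAt.comp s ((hasDerivAt_id s).div_const 2)
  have h3 : HasDerivAt Gammaℝ _ s := h1.mul h2
  have hne : Gamma (s / 2) ≠ 0 := Gamma_ne_zero_of_re_pos hs2
  have hne2 : (Real.pi : ℂ) ^ (-s / 2) ≠ 0 := by simp [hpi]
  rw [logDeriv_apply, h3.deriv, Gammaℝ_def, digamma_def, logDeriv_apply]
  field_simp

theorem differentiableAt_Gammaℝ {s : ℂ} (hs : 0 < s.re) : DifferentiableAt ℂ Gammaℝ s := by
  have h1 := (differentiable_Gammaℝ_inv s).inv (inv_ne_zero (Gammaℝ_ne_zero_of_re_pos hs))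
  have h2 : (fun s ↦ (Gammaℝ s)⁻¹)⁻¹ = Gammaℝ := by ext; simp
  rwa [h2] at h1

/-- The logarithmic derivative of `Gammaℝ` grows at most like `|s|^{1/2}` in `Re s ≥ 1/2`. -/
theorem exists_norm_logDeriv_Gammaℝ_le : ∃ K : ℝ, 0 ≤ K ∧ ∀ s : ℂ, 1 / 2 ≤ s.re →
    ‖logDeriv Gammaℝ s‖ ≤ K * Real.sqrt (1 + ‖s‖) := by
  obtain ⟨K, hK, h⟩ := exists_norm_digamma_le
  refine ⟨K + ‖Complex.log Real.pi‖, by positivity, fun s hs ↦ ?_⟩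
  have hs0 : 0 < s.re := by linarith
  have h1 := h (s / 2) (by simp; linarith)
  have h5 : (1 : ℝ) ≤ Real.sqrt (1 + ‖s‖) := by
    rw [Real.one_le_sqrt]; linarith [norm_nonneg s]
  have h6 : Real.sqrt (1 + ‖s / 2‖) ≤ Real.sqrt (1 + ‖s‖) := by
    apply Real.sqrt_le_sqrt
    simp
  rw [logDeriv_Gammaℝ hs0]
  refine (norm_add_le _ _).trans ?_
  rw [norm_div, norm_div, norm_neg]
  simp only [norm_ofNat]
  have h7 := mul_le_mul_of_nonneg_left h6 hK
  have h8 := mul_le_mul_of_nonneg_left h5 (norm_nonneg (Complex.log Real.pi))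
  have h9 : 0 ≤ K * Real.sqrt (1 + ‖s‖) := by positivity
  have := norm_nonneg (Complex.log Real.pi)
  linarith

/-! ### The Fejér kernel and Fourier inversion -/

/-- The Fejér-type kernel `T (sinh (Tw/2) / (Tw/2))²`, the two-sided Laplace transform of the
triangle function supported on `[-T, T]`. -/
noncomputable def fejerKernel (T : ℝ) (w : ℂ) : ℂ := T * dslope sinh 0 (T * w / 2) ^ 2

/-- The triangle function `max 0 (1 - |u| / T)`. -/
noncomputable def triangle (T u : ℝ) : ℝ := max 0 (1 - |u| / T)

theorem triangle_nonneg (T u : ℝ) : 0 ≤ triangle T u := le_max_left _ _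

theorem triangle_zero (T : ℝ) : triangle T 0 = 1 := by simp [triangle]

theorem continuous_triangle (T : ℝ) : Continuous (triangle T) := by
  unfold triangle; fun_prop

theorem triangle_eq_zero {T u : ℝ} (hT : 0 < T) (hu : T ≤ |u|) : triangle T u = 0 := by
  rw [triangle, max_eq_left]
  rw [sub_nonpos, one_le_div hT]
  exact hu

theorem triangle_of_nonneg {T u : ℝ} (hT : 0 < T) (h0 : 0 ≤ u) (hu : u ≤ T) :
    triangle T u = 1 - u / T := by
  rw [triangle, abs_of_nonneg h0, max_eq_right]
  rw [sub_nonneg, div_le_one hT]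
  exact hu

theorem triangle_of_nonpos {T u : ℝ} (hT : 0 < T) (h0 : u ≤ 0) (hu : -T ≤ u) :
    triangle T u = 1 + u / T := by
  rw [triangle, abs_of_nonpos h0, max_eq_right]
  · ring
  · rw [sub_nonneg, div_le_one hT]; linarith

theorem differentiable_fejerKernel (T : ℝ) : Differentiable ℂ (fejerKernel T) := by
  have h1 : Differentiable ℂ (dslope sinh 0) := by
    rw [← differentiableOn_univ, Complex.differentiableOn_dslope univ_mem]
    exact differentiable_sinh.differentiableOn
  unfold fejerKernel
  fun_prop

theorem fejerKernel_eq {T : ℝ} (hT : 0 < T) {w : ℂ} (hw : w ≠ 0) :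
    fejerKernel T w = (exp (T * w) + exp (-(T * w)) - 2) / (T * w ^ 2) := by
  have hT' : (T : ℂ) ≠ 0 := by exact_mod_cast hT.ne'
  have hv : (T : ℂ) * w / 2 ≠ 0 := by simp [hT', hw]
  have h1 : exp (T * w) = exp (T * w / 2) ^ 2 := by rw [← exp_nat_mul]; congr 1; push_cast; ring
  have h2 : exp (-(T * w)) = exp (-(T * w / 2)) ^ 2 := by
    rw [← exp_nat_mul]; congr 1; push_cast; ring
  have h3 : exp (T * w / 2) * exp (-(T * w / 2)) = 1 := by rw [← exp_add]; simp
  rw [fejerKernel, dslope_of_ne _ hv, slope_def_field, sinh_zero, sub_zero, sub_zero, sinh, h1, h2]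
  field_simp
  linear_combination -2 * h3

theorem norm_exp_le_exp_abs_re (z : ℂ) : ‖exp z‖ ≤ Real.exp |z.re| := by
  rw [norm_exp]; exact Real.exp_le_exp.mpr (le_abs_self _)

theorem norm_sinh_le (z : ℂ) : ‖sinh z‖ ≤ Real.exp |z.re| := by
  rw [sinh, norm_div]
  have h1 := norm_exp_le_exp_abs_re z
  have h2 := norm_exp_le_exp_abs_re (-z)
  rw [neg_re, abs_neg] at h2
  have := norm_sub_le (exp z) (exp (-z))
  simp only [norm_ofNat]
  linarith

theorem norm_cosh_le (z : ℂ) : ‖cosh z‖ ≤ Real.exp |z.re| := by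
  rw [cosh, norm_div]
  have h1 := norm_exp_le_exp_abs_re z
  have h2 := norm_exp_le_exp_abs_re (-z)
  rw [neg_re, abs_neg] at h2
  have := norm_add_le (exp z) (exp (-z))
  simp only [norm_ofNat]
  linarith

/-- Mean value inequality on the convex strip `|Re w| ≤ |Re v|`, where `cosh` is at most `exp |Re
v|` in modulus. This is the bound useful near 0; `norm_dslope_sinh_mul_le` supplies the decay at
infinity. -/
theorem norm_dslope_sinh_le (v : ℂ) : ‖dslope sinh 0 v‖ ≤ Real.exp |v.re| := by
  rcases eq_or_ne v 0 with rfl | hv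
  · simp [dslope_same, (hasDerivAt_sinh 0).deriv]
  · have h := Convex.norm_image_sub_le_of_norm_hasDerivWithin_le (𝕜 := ℂ) (f := sinh) (f' := cosh)
      (C := Real.exp |v.re|) (s := {w : ℂ | w.re ≤ |v.re|} ∩ {w : ℂ | -|v.re| ≤ w.re}) (x := 0)
      (y := v) (fun w _ ↦ (hasDerivAt_sinh w).hasDerivWithinAt)
      (fun w hw ↦ (norm_cosh_le w).trans (Real.exp_le_exp.mpr (abs_le.mpr ⟨hw.2, hw.1⟩)))
      ((convex_halfSpace_re_le _).inter (convex_halfSpace_re_ge _))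
      ⟨by simp, by simp⟩ ⟨le_abs_self v.re, neg_abs_le v.re⟩
    rw [dslope_of_ne _ hv, slope_def_field, norm_div, div_le_iff₀ (by simpa using hv)]
    exact h

theorem norm_dslope_sinh_mul_le (v : ℂ) : ‖dslope sinh 0 v‖ * ‖v‖ ≤ Real.exp |v.re| := by
  rcases eq_or_ne v 0 with rfl | hv
  · simp
  · rw [dslope_of_ne _ hv, slope_def_field, norm_div, sinh_zero, sub_zero, sub_zero,
      div_mul_cancel₀ _ (norm_ne_zero_iff.mpr hv)]
    exact norm_sinh_le v

theorem norm_fejerKernel_mul_le {T : ℝ} (hT : 0 < T) (w : ℂ) :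
    ‖fejerKernel T w‖ * (1 + ‖w‖ ^ 2) ≤ (T + 4 / T) * Real.exp (T * |w.re|) := by
  set v : ℂ := T * w / 2 with hv
  have hvre : |v.re| = T * |w.re| / 2 := by
    have : v.re = T * w.re / 2 := by simp [hv]
    rw [this, abs_div, abs_mul, abs_of_pos hT]; simp
  have hvn : ‖v‖ = T * ‖w‖ / 2 := by simp [hv, abs_of_pos hT]
  have he : Real.exp (T * |w.re|) = Real.exp |v.re| ^ 2 := by
    rw [hvre, ← Real.exp_nat_mul]; congr 1; push_cast; ring
  have h1 := pow_le_pow_left₀ (norm_nonneg _) (norm_dslope_sinh_le v) 2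
  have h2 := pow_le_pow_left₀ (by positivity) (norm_dslope_sinh_mul_le v) 2
  rw [mul_pow, hvn] at h2
  have hn : ‖fejerKernel T w‖ = T * ‖dslope sinh 0 v‖ ^ 2 := by
    rw [fejerKernel, norm_mul, norm_pow, norm_real, Real.norm_of_nonneg hT.le]
  rw [hn, he]
  have h3 : T * ‖dslope sinh 0 v‖ ^ 2 * ‖w‖ ^ 2 ≤ 4 / T * Real.exp |v.re| ^ 2 := by
    rw [div_mul_eq_mul_div, le_div_iff₀ hT]
    nlinarith
  nlinarith

/-- On the imaginary axis `sinh` becomes `sin`, so the kernel is `T` times the square of a real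
number. This positivity transfers `Re A ≥ 0` to the integral. -/
theorem fejerKernel_mul_I (T y : ℝ) (hT : 0 < T) :
    ∃ r : ℝ, 0 ≤ r ∧ fejerKernel T (y * I) = r := by
  have key : ∃ x : ℝ, dslope sinh 0 (T * (y * I) / 2) = x := by
    rcases eq_or_ne y 0 with rfl | hy
    · exact ⟨1, by simp [dslope_same, (hasDerivAt_sinh 0).deriv]⟩
    · have hv : (T : ℂ) * (y * I) / 2 ≠ 0 := by simp [hT.ne', hy]
      refine ⟨Real.sin (T * y / 2) / (T * y / 2), ?_⟩
      rw [dslope_of_ne _ hv, slope_def_field, sinh_zero, sub_zero, sub_zero,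
        show (T : ℂ) * (y * I) / 2 = (T * y / 2 : ℂ) * I by ring, sinh_mul_I]
      push_cast
      rw [mul_div_mul_right _ _ I_ne_zero]
  obtain ⟨x, hx⟩ := key
  refine ⟨T * x ^ 2, by positivity, ?_⟩
  rw [fejerKernel, hx]
  push_cast; rfl

/-- The Laplace transform of the triangle function is the Fejér kernel. -/
theorem integral_triangle_mul_exp {T : ℝ} (hT : 0 < T) {w : ℂ} (hw : w ≠ 0) :
    ∫ u : ℝ, (triangle T u : ℂ) * exp (u * w) = fejerKernel T w := by
  have hT' : (T : ℂ) ≠ 0 := by exact_mod_cast hT.ne'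
  have hcont : Continuous fun u : ℝ ↦ (triangle T u : ℂ) * exp (u * w) := by
    have := continuous_triangle T
    fun_prop
  have hsupp : ∀ u : ℝ, u ∉ Ioc (-T) T → (triangle T u : ℂ) * exp (u * w) = 0 := by
    intro u hu
    rw [triangle_eq_zero hT, ofReal_zero, zero_mul]
    by_contra h
    rw [not_le, abs_lt] at h
    exact hu ⟨h.1, h.2.le⟩
  rw [← setIntegral_eq_integral_of_forall_compl_eq_zero hsupp,
    ← intervalIntegral.integral_of_le (by linarith),
    ← intervalIntegral.integral_add_adjacent_intervals (b := 0)
      (hcont.intervalIntegrable _ _) (hcont.intervalIntegrable _ _)]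
  have hd : ∀ (a b : ℂ) (u : ℝ),
      HasDerivAt (fun u : ℝ ↦ (a + b * u) * exp (u * w)) (b * exp (u * w) +
        (a + b * u) * (exp (u * w) * w)) u := by
    intro a b u
    have h0 : HasDerivAt (fun u : ℝ ↦ (u : ℂ)) 1 u := Complex.ofRealCLM.hasDerivAt
    have h1 : HasDerivAt (fun u : ℝ ↦ a + b * (u : ℂ)) b u := by
      simpa using (h0.const_mul b).const_add a
    have h2 : HasDerivAt (fun u : ℝ ↦ exp (u * w)) (exp (u * w) * w) u := by
      simpa using (h0.mul_const w).cexp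
    exact h1.mul h2
  have e1 : ∫ u in (-T)..0, (triangle T u : ℂ) * exp (u * w) =
      (1 / w - 1 / (T * w ^ 2)) + 1 / (T * w ^ 2) * exp (-(T * w)) := by
    have hc : ∫ u in (-T)..0, (triangle T u : ℂ) * exp (u * w) = ∫ u in (-T)..0,
        (1 / (T * w) * exp (u * w) + ((1 / w - 1 / (T * w ^ 2)) + 1 / (T * w) * u) *
          (exp (u * w) * w)) := by
      refine intervalIntegral.integral_congr fun u hu ↦ ?_
      rw [uIcc_of_le (by linarith)] at hu
      rw [triangle_of_nonpos hT hu.2 hu.1]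
      push_cast
      field_simp
      ring
    rw [hc, intervalIntegral.integral_eq_sub_of_hasDerivAt (fun u _ ↦ hd _ _ u)
      (Continuous.intervalIntegrable (by fun_prop) _ _)]
    simp only [ofReal_zero, zero_mul, exp_zero, ofReal_neg, neg_mul]
    field_simp
    ring
  have e2 : ∫ u in (0)..T, (triangle T u : ℂ) * exp (u * w) =
      1 / (T * w ^ 2) * exp (T * w) - (1 / w + 1 / (T * w ^ 2)) := by
    have hc : ∫ u in (0)..T, (triangle T u : ℂ) * exp (u * w) = ∫ u in (0)..T,
        (-(1 / (T * w)) * exp (u * w) + ((1 / w + 1 / (T * w ^ 2)) + -(1 / (T * w)) * u) *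
          (exp (u * w) * w)) := by
      refine intervalIntegral.integral_congr fun u hu ↦ ?_
      rw [uIcc_of_le hT.le] at hu
      rw [triangle_of_nonneg hT hu.1 hu.2]
      push_cast
      field_simp
      ring
    rw [hc, intervalIntegral.integral_eq_sub_of_hasDerivAt (fun u _ ↦ hd _ _ u)
      (Continuous.intervalIntegrable (by fun_prop) _ _)]
    simp only [ofReal_zero, zero_mul, exp_zero]
    field_simp
    ring
  rw [e1, e2, fejerKernel_eq hT hw]
  field_simp
  ring

theorem integrable_fejerKernel {T : ℝ} (hT : 0 < T) (x : ℝ) :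
    Integrable fun y : ℝ ↦ fejerKernel T (x + y * I) := by
  have hc : Continuous fun y : ℝ ↦ fejerKernel T (x + y * I) := by
    have := (differentiable_fejerKernel T).continuous
    fun_prop
  refine (integrable_inv_one_add_sq.const_mul ((T + 4 / T) * Real.exp (T * |x|))).mono'
    hc.aestronglyMeasurable (Eventually.of_forall fun y ↦ ?_)
  have h1 := norm_fejerKernel_mul_le hT (x + y * I)
  have h2 : ((x : ℂ) + y * I).re = x := by simp
  have h3 : y ^ 2 ≤ ‖(x : ℂ) + y * I‖ ^ 2 := by
    rw [← normSq_eq_norm_sq, normSq_add_mul_I]; nlinarith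
  rw [h2] at h1
  rw [← div_eq_mul_inv, le_div_iff₀ (by positivity)]
  refine le_trans ?_ h1
  gcongr

/-- Fourier inversion for the Fejér kernel on the line `Re w = 1`. -/
theorem integral_exp_mul_fejerKernel {T : ℝ} (hT : 0 < T) (u : ℝ) :
    ∫ y : ℝ, exp (-(u * (1 + y * I))) * fejerKernel T (1 + y * I) =
      2 * Real.pi * triangle T u := by
  -- The weight `exp v` places the Fourier transform on the line `Re w = 1`, up to the scaling `y =
  -- -2πξ`.
  set φ : ℝ → ℂ := fun v ↦ (triangle T v : ℂ) * exp v with hφ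
  have hφc : Continuous φ := by
    have := continuous_triangle T
    fun_prop
  have hφi : Integrable φ := by
    refine hφc.integrable_of_hasCompactSupport (HasCompactSupport.intro (isCompact_Icc (a := -T)
      (b := T)) fun v hv ↦ ?_)
    rw [hφ]
    simp only
    rw [triangle_eq_zero hT, ofReal_zero, zero_mul]
    by_contra h
    rw [not_le, abs_lt] at h
    exact hv ⟨h.1.le, h.2.le⟩
  have hF : ∀ ξ : ℝ, FourierTransform.fourier φ ξ =
      fejerKernel T (1 + ((-(2 * Real.pi)) * ξ : ℝ) * I) := by
    intro ξ
    rw [Real.fourier_eq', ← integral_triangle_mul_exp hT]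
    · refine integral_congr_ae (Eventually.of_forall fun v ↦ ?_)
      simp only [hφ, smul_eq_mul, RCLike.inner_apply, conj_trivial]
      rw [mul_left_comm, ← exp_add]
      congr 2
      push_cast
      ring
    · intro h
      have := congrArg re h
      simp at this
  have hFi : Integrable (FourierTransform.fourier φ) := by
    have h1 := (integrable_fejerKernel hT 1).comp_mul_left' (g := fun y : ℝ ↦
      fejerKernel T ((1 : ℝ) + y * I)) (R := -(2 * Real.pi)) (by simp [Real.pi_ne_zero])
    refine h1.congr (Eventually.of_forall fun ξ ↦ ?_)
    rw [hF]; simp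
  have hinv := congrFun (hφc.fourierInv_fourier_eq hφi hFi) u
  rw [Real.fourierInv_eq'] at hinv
  set G : ℝ → ℂ := fun y ↦ exp (-(u * y * I)) * fejerKernel T (1 + y * I) with hG
  have h2 : ∫ ξ : ℝ, G (-(2 * Real.pi) * ξ) = φ u := by
    rw [← hinv]
    refine integral_congr_ae (Eventually.of_forall fun ξ ↦ ?_)
    simp only [hG, smul_eq_mul, RCLike.inner_apply, conj_trivial]
    rw [hF]
    congr 2
    push_cast
    ring
  rw [Measure.integral_comp_mul_left] at h2
  have hpi : (0 : ℝ) < 2 * Real.pi := by positivity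
  rw [abs_inv, abs_neg, abs_of_pos hpi, inv_smul_eq_iff₀ hpi.ne'] at h2
  have h3 : ∫ y : ℝ, exp (-(u * (1 + y * I))) * fejerKernel T (1 + y * I) =
      exp (-u) * ∫ y, G y := by
    rw [← integral_const_mul]
    refine integral_congr_ae (Eventually.of_forall fun y ↦ ?_)
    simp only [hG]
    rw [← mul_assoc, ← exp_add]
    congr 2
    ring
  rw [h3, h2, hφ, real_smul]
  have h4 : exp (-(u : ℂ)) * exp u = 1 := by rw [← exp_add]; simp
  push_cast
  linear_combination (2 * Real.pi * triangle T u : ℂ) * h4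

/-! ### Contour shift and evaluation of the individual terms -/

/-- Moving the line of integration from `Re w = 0` to `Re w = 1`. -/
theorem integral_line_shift {G : ℂ → ℂ} {g : ℝ → ℝ}
    (hG : ∀ w : ℂ, 0 ≤ w.re → w.re ≤ 1 → DifferentiableAt ℂ G w)
    (hbd : ∀ x y : ℝ, 0 ≤ x → x ≤ 1 → ‖G (x + y * I)‖ ≤ g y) (hg : Integrable g)
    (htop : Tendsto g atTop (𝓝 0)) (hbot : Tendsto g atBot (𝓝 0)) :
    Integrable (fun y : ℝ ↦ G (y * I)) ∧ Integrable (fun y : ℝ ↦ G (1 + y * I)) ∧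
      ∫ y : ℝ, G (y * I) = ∫ y : ℝ, G (1 + y * I) := by
  have hint : ∀ x : ℝ, 0 ≤ x → x ≤ 1 → Integrable (fun y : ℝ ↦ G (x + y * I)) := by
    intro x h0 h1
    refine hg.mono' (Continuous.aestronglyMeasurable ?_) (Eventually.of_forall fun y ↦ hbd x y h0 h1)
    rw [continuous_iff_continuousAt]
    intro y
    have h2 : ContinuousAt G (x + y * I) := (hG _ (by simpa) (by simpa)).continuousAt
    have h3 : ContinuousAt (fun y : ℝ ↦ (x : ℂ) + y * I) y := by fun_prop
    exact ContinuousAt.comp (f := fun y : ℝ ↦ (x : ℂ) + y * I) h2 h3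
  have hi0 := hint 0 le_rfl zero_le_one
  have hi1 := hint 1 zero_le_one le_rfl
  have hhor : ∀ (l : Filter ℝ), Tendsto g l (𝓝 0) →
      Tendsto (fun R : ℝ ↦ ∫ x : ℝ in (0 : ℝ)..1, G (x + R * I)) l (𝓝 0) := by
    intro l hl
    refine squeeze_zero_norm (fun R ↦ ?_) hl
    have := intervalIntegral.norm_integral_le_of_norm_le_const (a := 0) (b := 1) (C := g R)
      (f := fun x : ℝ ↦ G (x + R * I)) fun x hx ↦ by
        rw [uIoc_of_le zero_le_one] at hx
        exact hbd x R hx.1.le hx.2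
    simpa using this
  have hv : ∀ x : ℝ, Integrable (fun y : ℝ ↦ G (x + y * I)) →
      Tendsto (fun R : ℝ ↦ ∫ y : ℝ in (-R)..R, G (x + y * I)) atTop
        (𝓝 (∫ y : ℝ, G (x + y * I))) := fun x hx ↦
    intervalIntegral_tendsto_integral hx tendsto_neg_atTop_atBot tendsto_id
  -- Cauchy's theorem on the rectangle with corners `-iR` and `1 + iR`; the horizontal sides are
  -- bounded by `g(±R)` and vanish in the limit.
  have hrect : ∀ R : ℝ, (∫ x : ℝ in (0 : ℝ)..1, G (x + (-R : ℝ) * I)) -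
      (∫ x : ℝ in (0 : ℝ)..1, G (x + R * I)) +
      I * (∫ y : ℝ in (-R)..R, G ((1 : ℝ) + y * I)) -
      I * (∫ y : ℝ in (-R)..R, G ((0 : ℝ) + y * I)) = 0 := by
    intro R
    have := integral_boundary_rect_eq_zero_of_differentiableOn G (⟨0, -R⟩ : ℂ) (⟨1, R⟩ : ℂ) ?_
    · simpa using this
    · intro w hw
      rw [mem_reProdIm] at hw
      have h1 := hw.1
      rw [uIcc_of_le (by simp)] at h1
      exact (hG w h1.1 h1.2).differentiableWithinAt
  have hlim := ((((hhor atBot hbot).comp tendsto_neg_atTop_atBot).sub (hhor atTop htop)).add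
    ((hv 1 hi1).const_mul I)).sub ((hv 0 hi0).const_mul I)
  have hz : (0 : ℂ) - 0 + I * (∫ y : ℝ, G ((1 : ℝ) + y * I)) -
      I * (∫ y : ℝ, G ((0 : ℝ) + y * I)) = 0 := by
    refine tendsto_nhds_unique hlim ?_
    refine tendsto_const_nhds.congr fun R ↦ ?_
    exact (hrect R).symm
  have hz2 : ∫ y : ℝ, G ((1 : ℝ) + y * I) = ∫ y : ℝ, G ((0 : ℝ) + y * I) := by
    refine mul_left_cancel₀ I_ne_zero ?_
    linear_combination hz
  simp only [ofReal_zero, zero_add, ofReal_one] at hi0 hi1 hz2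
  exact ⟨hi0, hi1, hz2.symm⟩

/-- The real function `(1 + y²)^{-3/4}` is integrable and tends to zero. -/
theorem integrable_one_add_sq_rpow :
    Integrable fun y : ℝ ↦ (1 + y ^ 2) ^ (-(3 / 2) / 2 : ℝ) := by
  have := integrable_rpow_neg_one_add_norm_sq (E := ℝ) (μ := volume) (r := 3 / 2) (by simp; norm_num)
  simpa using this

theorem tendsto_one_add_sq_rpow {l : Filter ℝ} (hl : Tendsto (fun y : ℝ ↦ |y|) l atTop) :
    Tendsto (fun y : ℝ ↦ (1 + y ^ 2) ^ (-(3 / 2) / 2 : ℝ)) l (𝓝 0) := by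
  have h1 : Tendsto (fun y : ℝ ↦ 1 + y ^ 2) l atTop := by
    have : Tendsto (fun y : ℝ ↦ 1 + |y| ^ 2) l atTop :=
      tendsto_atTop_add_const_left _ _ ((tendsto_pow_atTop two_ne_zero).comp hl)
    simpa using this
  have h2 := (tendsto_rpow_neg_atTop (y := 3 / 4) (by norm_num)).comp h1
  refine h2.congr fun y ↦ ?_
  simp only [Function.comp]
  norm_num

/-- Pointwise bound of `B * fejerKernel` for `B` of growth `|w|^{1/2}`. -/
theorem norm_mul_fejerKernel_le {T : ℝ} (hT : 0 < T) {b : ℂ} {C : ℝ} (hC : 0 ≤ C) (w : ℂ)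
    (hb : ‖b‖ ≤ C * Real.sqrt (1 + ‖w‖)) :
    ‖b * fejerKernel T w‖ ≤
      2 * C * ((T + 4 / T) * Real.exp (T * |w.re|)) * (1 + w.im ^ 2) ^ (-(3 / 2) / 2 : ℝ) := by
  set E := (T + 4 / T) * Real.exp (T * |w.re|) with hE
  have hE0 : 0 ≤ E := by positivity
  have hk := norm_fejerKernel_mul_le hT w
  rw [← hE] at hk
  set X := 1 + ‖w‖ ^ 2 with hX
  have hX1 : 1 ≤ X := by rw [hX]; nlinarith [norm_nonneg w]
  have hX0 : 0 < X := by linarith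
  have h1 : Real.sqrt (1 + ‖w‖) ≤ 2 * X ^ (1 / 4 : ℝ) := by
    refine Real.sqrt_le_iff.mpr ⟨by positivity, ?_⟩
    have h2 : (2 * X ^ (1 / 4 : ℝ)) ^ 2 = 4 * Real.sqrt X := by
      rw [mul_pow, ← Real.rpow_natCast (X ^ (1 / 4 : ℝ)), ← Real.rpow_mul hX0.le,
        Real.sqrt_eq_rpow]
      norm_num
    have h3 : ‖w‖ ≤ Real.sqrt X := Real.le_sqrt_of_sq_le (by rw [hX]; linarith)
    have h4 : 1 ≤ Real.sqrt X := Real.one_le_sqrt.mpr hX1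
    rw [h2]; linarith
  have h5 : ‖fejerKernel T w‖ ≤ E * X⁻¹ := by
    rw [← div_eq_mul_inv, le_div_iff₀ hX0]; exact hk
  have h6 : X ^ (1 / 4 : ℝ) * X⁻¹ = X ^ (-(3 / 2) / 2 : ℝ) := by
    rw [← Real.rpow_neg_one, ← Real.rpow_add hX0]; norm_num
  have h7 : X ^ (-(3 / 2) / 2 : ℝ) ≤ (1 + w.im ^ 2) ^ (-(3 / 2) / 2 : ℝ) := by
    refine Real.rpow_le_rpow_of_nonpos (by positivity) ?_ (by norm_num)
    rw [hX, ← normSq_eq_norm_sq, normSq_apply]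
    nlinarith [mul_self_nonneg w.re]
  rw [norm_mul]
  calc ‖b‖ * ‖fejerKernel T w‖ ≤ (C * (2 * X ^ (1 / 4 : ℝ))) * (E * X⁻¹) := by
        gcongr
        exact hb.trans (by gcongr)
    _ = 2 * C * E * (X ^ (1 / 4 : ℝ) * X⁻¹) := by ring
    _ ≤ _ := by rw [h6]; gcongr

/-- Growth `|w|^(1/2)` against kernel decay `|w|^(-2)` leaves `|y|^(-3/2)`, which is integrable and
tends to 0. Hence a square-root bound for digamma is enough. -/
theorem integral_mul_fejerKernel_shift {T : ℝ} (hT : 0 < T) {B : ℂ → ℂ} {C : ℝ} (hC : 0 ≤ C)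
    (hB : ∀ w : ℂ, 0 ≤ w.re → w.re ≤ 1 → DifferentiableAt ℂ B w)
    (hbd : ∀ w : ℂ, 0 ≤ w.re → w.re ≤ 1 → ‖B w‖ ≤ C * Real.sqrt (1 + ‖w‖)) :
    Integrable (fun y : ℝ ↦ B (y * I) * fejerKernel T (y * I)) ∧
    Integrable (fun y : ℝ ↦ B (1 + y * I) * fejerKernel T (1 + y * I)) ∧
      ∫ y : ℝ, B (y * I) * fejerKernel T (y * I) =
        ∫ y : ℝ, B (1 + y * I) * fejerKernel T (1 + y * I) := by
  refine integral_line_shift (G := fun w ↦ B w * fejerKernel T w)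
    (g := fun y ↦ 2 * C * ((T + 4 / T) * Real.exp T) * (1 + y ^ 2) ^ (-(3 / 2) / 2 : ℝ))
    (fun w h0 h1 ↦ (hB w h0 h1).mul (differentiable_fejerKernel T w)) ?_
    (integrable_one_add_sq_rpow.const_mul _) ?_ ?_
  · intro x y h0 h1
    refine (norm_mul_fejerKernel_le hT hC _ (hbd _ (by simpa) (by simpa))).trans ?_
    simp only [add_re, ofReal_re, mul_re, I_re, mul_zero, ofReal_im, I_im, mul_one, sub_self,
      add_zero, add_im, mul_im, zero_add]
    gcongr
    rw [abs_of_nonneg h0]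
    nlinarith
  · simpa using (tendsto_one_add_sq_rpow tendsto_abs_atTop_atTop).const_mul _
  · simpa using (tendsto_one_add_sq_rpow tendsto_abs_atBot_atTop).const_mul _

/-- On the imaginary axis a function of growth `|w|^{1/2}` integrates against the Fejér kernel
to `O(T)`. -/
theorem exists_norm_integral_mul_fejerKernel_le : ∃ D : ℝ, 0 ≤ D ∧
    ∀ (T : ℝ) (B : ℂ → ℂ) (C : ℝ), 1 ≤ T → 0 ≤ C →
      (∀ y : ℝ, ‖B (y * I)‖ ≤ C * Real.sqrt (1 + ‖(y : ℂ) * I‖)) →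
      ‖∫ y : ℝ, B (y * I) * fejerKernel T (y * I)‖ ≤ D * C * T := by
  set J := ∫ y : ℝ, (1 + y ^ 2) ^ (-(3 / 2) / 2 : ℝ) with hJ
  have hJ0 : 0 ≤ J := integral_nonneg fun y ↦ by positivity
  refine ⟨10 * J, by positivity, fun T B C hT hC hB ↦ ?_⟩
  have hT0 : 0 < T := by linarith
  have h1 : ‖∫ y : ℝ, B (y * I) * fejerKernel T (y * I)‖ ≤
      ∫ y : ℝ, 2 * C * (5 * T) * (1 + y ^ 2) ^ (-(3 / 2) / 2 : ℝ) := by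
    refine norm_integral_le_of_norm_le (integrable_one_add_sq_rpow.const_mul _)
      (Eventually.of_forall fun y ↦ ?_)
    refine (norm_mul_fejerKernel_le hT0 hC _ (hB y)).trans ?_
    simp only [mul_re, ofReal_re, I_re, mul_zero, ofReal_im, I_im, mul_one, sub_self, abs_zero,
      Real.exp_zero, mul_im, add_zero]
    gcongr
    have : 4 / T ≤ 4 * T := by rw [div_le_iff₀ hT0]; nlinarith
    linarith
  rw [integral_const_mul, ← hJ] at h1
  refine h1.trans (le_of_eq ?_)
  ring

/-- Integrating `1 / (w + a)` against the Fejér kernel. -/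
theorem integral_inv_mul_fejerKernel {T : ℝ} (hT : 0 < T) {a : ℝ} (ha : 0 < 1 + a) :
    ∫ y : ℝ, (1 + y * I + a : ℂ)⁻¹ * fejerKernel T (1 + y * I) =
      2 * Real.pi * ((∫ u in (0 : ℝ)..T, (1 - u / T) * Real.exp (-(a * u)) : ℝ) : ℂ) := by
  have hH := integrable_fejerKernel hT 1
  simp only [ofReal_one] at hH
  -- Written as a Laplace integral, convergent since `1 + a > 0`, the fraction is paired with the
  -- kernel by Fubini and Fourier inversion, which cuts the `u`-integral off at `T`.
  have hlap : ∀ y : ℝ, (1 + y * I + a : ℂ)⁻¹ =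
      ∫ u in Ioi (0 : ℝ), exp (-(u * (1 + y * I)) - a * u) := by
    intro y
    have hre : 0 < (1 + y * I + a : ℂ).re := by simpa using ha
    have := integral_exp_mul_complex_Ioi (a := -(1 + y * I + a : ℂ)) (by
      rw [neg_re]; linarith) 0
    have h2 : ∀ u : ℝ, -(u * (1 + y * I)) - a * u = -(1 + y * I + a : ℂ) * u := fun u ↦ by ring
    simp only [h2]
    rw [this, ofReal_zero, mul_zero, exp_zero, neg_div_neg_eq, one_div]
  have hint : Integrable (Function.uncurry fun (y u : ℝ) ↦
      exp (-(u * (1 + y * I)) - a * u) * fejerKernel T (1 + y * I))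
      (volume.prod (volume.restrict (Ioi (0 : ℝ)))) := by
    have hexp : Integrable (fun u : ℝ ↦ Real.exp (-((1 + a) * u))) (volume.restrict (Ioi 0)) := by
      have := exp_neg_integrableOn_Ioi 0 ha
      refine this.congr (Eventually.of_forall fun u ↦ ?_)
      simp only [neg_mul]
    refine (hH.norm.mul_prod hexp).mono' ?_ ?_
    · refine Continuous.aestronglyMeasurable ?_
      have := (differentiable_fejerKernel T).continuous
      simp only [Function.uncurry_def]
      fun_prop
    · refine Eventually.of_forall fun p ↦ ?_
      simp only [Function.uncurry, norm_mul, norm_exp]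
      rw [mul_comm]
      gcongr
      simp
      linarith
  have hswap := integral_integral_swap hint
  have h1 : ∀ y : ℝ, (1 + y * I + a : ℂ)⁻¹ * fejerKernel T (1 + y * I) =
      ∫ u in Ioi (0 : ℝ), exp (-(u * (1 + y * I)) - a * u) * fejerKernel T (1 + y * I) := by
    intro y
    rw [hlap y, ← integral_mul_const]
  simp only [h1]
  rw [hswap]
  have h2 : ∀ u : ℝ, ∫ y : ℝ, exp (-(u * (1 + y * I)) - a * u) * fejerKernel T (1 + y * I) =
      2 * Real.pi * ((triangle T u * Real.exp (-(a * u)) : ℝ) : ℂ) := by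
    intro u
    have h3 : ∀ y : ℝ, exp (-(u * (1 + y * I)) - a * u) * fejerKernel T (1 + y * I) =
        exp (-(a * u)) * (exp (-(u * (1 + y * I))) * fejerKernel T (1 + y * I)) := by
      intro y
      rw [← mul_assoc, ← exp_add]
      congr 2
      ring
    simp only [h3]
    rw [integral_const_mul, integral_exp_mul_fejerKernel hT]
    push_cast
    ring
  simp only [h2]
  rw [integral_const_mul, integral_complex_ofReal]
  congr 2
  have h4 : ∫ u in Ioi (0 : ℝ), triangle T u * Real.exp (-(a * u)) =
      ∫ u in Ioc (0 : ℝ) T, triangle T u * Real.exp (-(a * u)) := by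
    refine setIntegral_eq_of_subset_of_forall_sdiff_eq_zero measurableSet_Ioi
      Ioc_subset_Ioi_self fun u hu ↦ ?_
    rw [triangle_eq_zero hT, zero_mul]
    have h0 : 0 < u := hu.1
    rw [abs_of_pos h0]
    by_contra h
    exact hu.2 ⟨h0, (not_le.mp h).le⟩
  rw [h4, intervalIntegral.integral_of_le hT.le]
  refine setIntegral_congr_fun measurableSet_Ioc fun u hu ↦ ?_
  rw [triangle_of_nonneg hT hu.1.le hu.2]

/-- A Dirichlet series whose coefficients have nonnegative real part integrates against the Fejér
kernel to something with nonnegative real part. -/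
theorem re_integral_LSeries_mul_fejerKernel_nonneg {T : ℝ} (hT : 0 < T) {b : ℕ → ℂ} {σ : ℝ}
    (hb : LSeriesSummable b σ) (hre : ∀ n, 0 ≤ (b n).re) :
    0 ≤ (∫ y : ℝ, LSeries b (σ + y * I) * fejerKernel T (1 + y * I)).re := by
  have hH := integrable_fejerKernel hT 1
  simp only [ofReal_one] at hH
  -- Splitting off `n^(1-σ)` leaves `n^(-(1+iy))`, so each term integrates to a nonnegative multiple
  -- of `b n`, with weight `triangle T (log n)`.
  have hterm : ∀ (n : ℕ) (y : ℝ), LSeries.term b (σ + y * I) n =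
      (if n = 0 then 0 else b n * ((n : ℝ) ^ (1 - σ) : ℝ)) *
        exp (-(Real.log n * (1 + y * I))) := by
    intro n y
    rcases eq_or_ne n 0 with rfl | hn
    · simp
    · have hn0 : (0 : ℝ) < n := by exact_mod_cast Nat.pos_of_ne_zero hn
      have hnc : (n : ℂ) ≠ 0 := by exact_mod_cast hn
      rw [LSeries.term_of_ne_zero hn, if_neg hn, ofReal_cpow hn0.le, div_eq_mul_inv,
        ← cpow_neg, mul_assoc]
      congr 1
      have hl : ((Real.log n : ℝ) : ℂ) = Complex.log n := by
        rw [ofReal_log hn0.le]; simp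
      rw [hl, cpow_def_of_ne_zero hnc, ofReal_natCast, cpow_def_of_ne_zero hnc, ← exp_add]
      congr 1
      push_cast
      ring
  have hnorm : ∀ (n : ℕ) (y : ℝ), ‖LSeries.term b (σ + y * I) n‖ = ‖LSeries.term b σ n‖ := by
    intro n y
    rw [LSeries.norm_term_eq, LSeries.norm_term_eq]
    simp
  have hint : ∀ n, Integrable fun y : ℝ ↦
      LSeries.term b (σ + y * I) n * fejerKernel T (1 + y * I) := by
    intro n
    refine Integrable.bdd_mul (c := ‖LSeries.term b σ n‖) hH ?_
      (Eventually.of_forall fun y ↦ (hnorm n y).le)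
    simp only [hterm]
    exact Continuous.aestronglyMeasurable (by fun_prop)
  have hsum : Summable fun n ↦ ∫ y : ℝ,
      ‖LSeries.term b (σ + y * I) n * fejerKernel T (1 + y * I)‖ := by
    have h1 : ∀ n, ∫ y : ℝ, ‖LSeries.term b (σ + y * I) n * fejerKernel T (1 + y * I)‖ =
        ‖LSeries.term b σ n‖ * ∫ y : ℝ, ‖fejerKernel T (1 + y * I)‖ := by
      intro n
      rw [← integral_const_mul]
      refine integral_congr_ae (Eventually.of_forall fun y ↦ ?_)
      simp only [norm_mul, hnorm]
    simp only [h1]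
    exact (hb.norm).mul_right _
  have hs := hasSum_integral_of_summable_integral_norm hint hsum
  have heq : ∫ y : ℝ, ∑' n, LSeries.term b (σ + y * I) n * fejerKernel T (1 + y * I) =
      ∫ y : ℝ, LSeries b (σ + y * I) * fejerKernel T (1 + y * I) := by
    refine integral_congr_ae (Eventually.of_forall fun y ↦ ?_)
    simp only [LSeries]
    rw [tsum_mul_right]
  rw [heq] at hs
  refine (hasSum_re hs).nonneg fun n ↦ ?_
  have hval : ∫ y : ℝ, LSeries.term b (σ + y * I) n * fejerKernel T (1 + y * I) =
      (if n = 0 then 0 else b n * ((n : ℝ) ^ (1 - σ) : ℝ)) *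
        (2 * Real.pi * triangle T (Real.log n)) := by
    simp only [hterm, mul_assoc]
    rw [integral_const_mul, integral_exp_mul_fejerKernel hT]
    ring
  rw [hval]
  split_ifs with hn
  · simp
  · have h2 : b n * ((n : ℝ) ^ (1 - σ) : ℝ) * (2 * Real.pi * triangle T (Real.log n)) =
        b n * (((n : ℝ) ^ (1 - σ) * (2 * Real.pi * triangle T (Real.log n)) : ℝ) : ℂ) := by
      push_cast; ring
    rw [h2, re_mul_ofReal]
    have := triangle_nonneg T (Real.log n)
    exact mul_nonneg (hre n) (by positivity)

theorem continuous_inv_line {a : ℝ} (ha : 0 < 1 + a) :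
    Continuous fun y : ℝ ↦ (1 + y * I + a : ℂ)⁻¹ := by
  refine Continuous.inv₀ (by fun_prop) fun y h ↦ ?_
  have := congrArg re h
  simp at this
  linarith

theorem norm_inv_line_le {a : ℝ} (ha : 0 < 1 + a) (y : ℝ) :
    ‖(1 + y * I + a : ℂ)⁻¹‖ ≤ (1 + a)⁻¹ := by
  rw [norm_inv]
  refine inv_anti₀ ha ?_
  have := (le_abs_self _).trans (abs_re_le_norm (1 + y * I + a : ℂ))
  simpa using this

theorem integrable_inv_mul_fejerKernel {T : ℝ} (hT : 0 < T) {a : ℝ} (ha : 0 < 1 + a) :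
    Integrable fun y : ℝ ↦ (1 + y * I + a : ℂ)⁻¹ * fejerKernel T (1 + y * I) := by
  have hH := integrable_fejerKernel hT 1
  simp only [ofReal_one] at hH
  exact hH.bdd_mul (c := (1 + a)⁻¹) (continuous_inv_line ha).aestronglyMeasurable
    (Eventually.of_forall fun y ↦ norm_inv_line_le ha y)

/-- This is the contribution of the pole of `ζ`, the only term exponential in `T`. The
antiderivative `(2 + 4/T - 2u/T) e^(u/2)` takes the value `4 e^(T/2)/T` at `T`, and its value at 0
is positive and dropped. -/
theorem integral_triangle_exp_half {T : ℝ} (hT : 0 < T) :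
    ∫ u in (0 : ℝ)..T, (1 - u / T) * Real.exp (u / 2) ≤ 4 * Real.exp (T / 2) / T := by
  have hd : ∀ u : ℝ, HasDerivAt (fun u : ℝ ↦ ((2 + 4 / T) - 2 / T * u) * Real.exp (u / 2))
      ((1 - u / T) * Real.exp (u / 2)) u := by
    intro u
    have h1 : HasDerivAt (fun u : ℝ ↦ (2 + 4 / T) - 2 / T * u) (-(2 / T)) u := by
      simpa using ((hasDerivAt_id u).const_mul (2 / T)).const_sub (2 + 4 / T)
    have h2 : HasDerivAt (fun u : ℝ ↦ Real.exp (u / 2)) (Real.exp (u / 2) * (1 / 2)) u :=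
      ((hasDerivAt_id u).div_const 2).exp
    refine (h1.mul h2).congr_deriv ?_
    field_simp
    ring
  rw [intervalIntegral.integral_eq_sub_of_hasDerivAt (fun u _ ↦ hd u)
    (Continuous.intervalIntegrable (by fun_prop) _ _)]
  have h3 : 2 / T * T = 2 := by field_simp
  have h4 : 0 < 4 / T := by positivity
  rw [h3, zero_div, Real.exp_zero, mul_div_right_comm]
  linarith

theorem integral_triangle_exp_neg_le {T a : ℝ} (hT : 0 < T) (ha : 0 ≤ a) :
    ∫ u in (0 : ℝ)..T, (1 - u / T) * Real.exp (-(a * u)) ≤ T := by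
  have h : ∫ u in (0 : ℝ)..T, (1 - u / T) * Real.exp (-(a * u)) ≤ ∫ _ in (0 : ℝ)..T, (1 : ℝ) := by
    refine intervalIntegral.integral_mono_on hT.le
      (Continuous.intervalIntegrable (by fun_prop) _ _)
      (Continuous.intervalIntegrable (by fun_prop) _ _) fun u hu ↦ ?_
    have h1 : 0 ≤ u / T := div_nonneg hu.1 hT.le
    have h2 : Real.exp (-(a * u)) ≤ 1 := Real.exp_le_one_iff.mpr (by nlinarith [mul_nonneg ha hu.1])
    have h3 : u / T ≤ 1 := (div_le_one hT).mpr hu.2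
    nlinarith [Real.exp_pos (-(a * u))]
  simpa using h

theorem le_integral_triangle_exp_neg {T a : ℝ} (hT : 0 < T) (ha : 0 ≤ a) :
    Real.exp (-(a * T)) * (T / 2) ≤ ∫ u in (0 : ℝ)..T, (1 - u / T) * Real.exp (-(a * u)) := by
  have h0 : ∫ u in (0 : ℝ)..T, Real.exp (-(a * T)) * (1 - u / T) =
      Real.exp (-(a * T)) * (T / 2) := by
    rw [intervalIntegral.integral_const_mul, intervalIntegral.integral_sub
      (Continuous.intervalIntegrable (by fun_prop) _ _)
      (Continuous.intervalIntegrable (by fun_prop) _ _), intervalIntegral.integral_div, integral_id]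
    simp
    field_simp
    norm_num
  rw [← h0]
  refine intervalIntegral.integral_mono_on hT.le
    (Continuous.intervalIntegrable (by fun_prop) _ _)
    (Continuous.intervalIntegrable (by fun_prop) _ _) fun u hu ↦ ?_
  have h3 : u / T ≤ 1 := (div_le_one hT).mpr hu.2
  rw [mul_comm]
  refine mul_le_mul_of_nonneg_left (Real.exp_le_exp.mpr ?_) (by linarith)
  nlinarith [mul_le_mul_of_nonneg_left hu.2 ha]

/-! ### The explicit inequality -/

theorem sqrt_one_add_norm_le {z w : ℂ} (h : ‖z‖ ≤ ‖w‖ + 3) :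
    Real.sqrt (1 + ‖z‖) ≤ 2 * Real.sqrt (1 + ‖w‖) := by
  rw [show (2 : ℝ) = Real.sqrt 4 by rw [show (4 : ℝ) = 2 ^ 2 by norm_num]; simp,
    ← Real.sqrt_mul (by norm_num)]
  apply Real.sqrt_le_sqrt
  linarith [norm_nonneg w]

/-- The integral of a function with nonnegative real part against the Fejér kernel along the
imaginary axis has nonnegative real part. -/
theorem re_integral_mul_fejerKernel_nonneg {T : ℝ} (hT : 0 < T) {B : ℂ → ℂ}
    (hi : Integrable fun y : ℝ ↦ B (y * I) * fejerKernel T (y * I))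
    (hB : ∀ y : ℝ, 0 ≤ (B (y * I)).re) :
    0 ≤ (∫ y : ℝ, B (y * I) * fejerKernel T (y * I)).re := by
  have h1 := reCLM.integral_comp_comm hi
  simp only [reCLM_apply] at h1
  rw [← h1]
  refine integral_nonneg fun y ↦ ?_
  obtain ⟨r, hr, hr'⟩ := fejerKernel_mul_I T y hT
  simp only [Pi.zero_apply]
  rw [hr', re_mul_ofReal]
  exact mul_nonneg (hB y) hr

/-- The growth of a function with nonnegative real part in the right half-plane is controlled by
its growth on a vertical line. -/
theorem exists_norm_le_of_re_nonneg {A : ℂ → ℂ} (hA : DifferentiableOn ℂ A {z | 0 < z.re})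
    (hre : ∀ z : ℂ, 0 < z.re → 0 ≤ (A z).re) {C : ℝ} (hC : 0 ≤ C)
    (hbd : ∀ z : ℂ, 1 ≤ z.re → z.re ≤ 2 → ‖A z‖ ≤ C * Real.sqrt (1 + ‖z‖)) {ε : ℝ} (hε : 0 < ε)
    (hε1 : ε ≤ 1) : ∃ C' : ℝ, 0 ≤ C' ∧ ∀ w : ℂ, 0 ≤ w.re → w.re ≤ 1 →
      ‖A (w + ε)‖ ≤ C' * Real.sqrt (1 + ‖w‖) := by
  refine ⟨(1 + ε / 2 + 1) / (1 + ε / 2 - 1) * (C * 2),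
    mul_nonneg (div_nonneg (by linarith) (by linarith)) (by linarith), fun w h0 h1 ↦ ?_⟩
  -- The ball of radius `1 + ε/2` about `c₀` stays in the half-plane, and `w + ε` lies within
  -- distance 1 of `c₀`, where `A` is already controlled.
  set c₀ : ℂ := ((1 + ε : ℝ) : ℂ) + w.im * I with hc₀
  have hc₀re : c₀.re = 1 + ε := by simp [hc₀]
  have hball : ∀ v ∈ Metric.ball c₀ (1 + ε / 2), 0 < v.re := by
    intro v hv
    rw [Metric.mem_ball, dist_eq_norm] at hv
    have h2 := (abs_re_le_norm (v - c₀)).trans_lt hv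
    rw [sub_re, hc₀re] at h2
    have := (abs_lt.mp h2).1
    linarith
  have hw : ‖w + ε - c₀‖ ≤ 1 := by
    have : w + ε - c₀ = ((w.re - 1 : ℝ) : ℂ) := by apply Complex.ext <;> simp [hc₀]
    rw [this, norm_real, Real.norm_eq_abs, abs_le]
    constructor <;> linarith
  have h3 := norm_le_of_re_nonneg zero_le_one (by linarith : (1 : ℝ) < 1 + ε / 2)
    (hA.mono hball) (fun v hv ↦ hre v (hball v hv)) hw
  refine h3.trans ?_
  rw [mul_assoc]
  refine mul_le_mul_of_nonneg_left ?_ (div_nonneg (by linarith) (by linarith))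
  refine (hbd c₀ (by linarith) (by linarith)).trans ?_
  rw [mul_assoc]
  refine mul_le_mul_of_nonneg_left (sqrt_one_add_norm_le ?_) hC
  have h4 : ‖c₀‖ ≤ |1 + ε| + |w.im| := by
    refine (norm_add_le _ _).trans ?_
    simp [-ofReal_add]
  have h5 := abs_im_le_norm w
  rw [abs_of_pos (by linarith)] at h4
  linarith

/-- The inequality obtained by pairing a function with nonnegative real part in the right
half-plane, given by an explicit-formula type expression, with the Fejér kernel. -/
theorem exists_explicit_inequality : ∃ D : ℝ, 0 ≤ D ∧
    ∀ (A g : ℂ → ℂ) (b : ℕ → ℂ) (n : ℕ) (a K T : ℝ),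
      1 ≤ T → 0 ≤ K → DifferentiableOn ℂ A {z | 0 < z.re} →
      (∀ z : ℂ, 0 < z.re → 0 ≤ (A z).re) →
      DifferentiableOn ℂ g {z | 0 < z.re} →
      (∀ z : ℂ, 0 < z.re → ‖g z‖ ≤ K * Real.sqrt (1 + ‖z‖)) →
      (∀ s : ℂ, 3 / 2 ≤ s.re → LSeriesSummable b s) → (∀ k, 0 ≤ (b k).re) →
      (∀ z : ℂ, 1 ≤ z.re → A z = -(n * z⁻¹) + a + (z + 1 / 2)⁻¹ + (z - 1 / 2)⁻¹ + g z -
        LSeries b (1 / 2 + z)) →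
      n * (T / 2) ≤ a + 4 * Real.exp (T / 2) / T + T + D * K * T := by
  obtain ⟨D, hD, hDle⟩ := exists_norm_integral_mul_fejerKernel_le
  refine ⟨D, hD, fun A g b n a K T hT hK hA hAre hg hgb hb hbre hAeq ↦ ?_⟩
  have hT0 : 0 < T := by linarith
  have hpi : 0 < 2 * Real.pi := by positivity
  have hH := integrable_fejerKernel hT0 1
  simp only [ofReal_one] at hH
  -- growth of `A` on vertical lines in the region of absolute convergence
  obtain ⟨C, hC, hAb⟩ : ∃ C : ℝ, 0 ≤ C ∧ ∀ z : ℂ, 1 ≤ z.re → z.re ≤ 2 →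
      ‖A z‖ ≤ C * Real.sqrt (1 + ‖z‖) := by
    set S := ∑' k, ‖LSeries.term b (3 / 2 : ℝ) k‖ with hS
    have hsum : Summable fun k ↦ ‖LSeries.term b (3 / 2 : ℝ) k‖ := (hb _ (by simp)).norm
    have hS0 : 0 ≤ S := tsum_nonneg fun _ ↦ norm_nonneg _
    refine ⟨n + |a| + 1 + 2 + K + S, by positivity, fun z hz _ ↦ ?_⟩
    have hLS : ‖LSeries b (1 / 2 + z)‖ ≤ S := by
      refine tsum_of_norm_bounded hsum.hasSum fun k ↦ ?_
      refine LSeries.norm_term_le_of_re_le_re b ?_ k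
      simp; linarith
    have hinv : ∀ c : ℝ, -1 < c → ‖(z + c)⁻¹‖ ≤ (1 + c)⁻¹ := by
      intro c hc
      rw [norm_inv]
      refine inv_anti₀ (by linarith) ?_
      have := (le_abs_self _).trans (abs_re_le_norm (z + c))
      simp at this
      linarith
    have i0 := hinv 0 (by norm_num)
    have i1 := hinv (1 / 2) (by norm_num)
    have i2 := hinv (-(1 / 2)) (by norm_num)
    have e1 : z + ((1 / 2 : ℝ) : ℂ) = z + 1 / 2 := by push_cast; ring
    have e2 : z + ((-(1 / 2) : ℝ) : ℂ) = z - 1 / 2 := by push_cast; ring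
    rw [e1] at i1
    rw [e2] at i2
    simp only [ofReal_zero, add_zero, inv_one] at i0
    have hsq : (1 : ℝ) ≤ Real.sqrt (1 + ‖z‖) := by
      rw [Real.one_le_sqrt]; linarith [norm_nonneg z]
    rw [hAeq z hz]
    have i3 : ‖-((n : ℂ) * z⁻¹)‖ ≤ n := by
      rw [norm_neg, norm_mul, norm_natCast]
      exact mul_le_of_le_one_right (Nat.cast_nonneg n) i0
    have i4 : ‖(a : ℂ)‖ = |a| := norm_real a
    have i5 := hgb z (by linarith)
    have tri : ‖-(n * z⁻¹) + a + (z + 1 / 2)⁻¹ + (z - 1 / 2)⁻¹ + g z - LSeries b (1 / 2 + z)‖ ≤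
        n + |a| + 1 + 2 + K * Real.sqrt (1 + ‖z‖) + S := by
      refine (norm_sub_le _ _).trans (add_le_add ?_ hLS)
      refine (norm_add_le _ _).trans (add_le_add ?_ i5)
      refine (norm_add_le _ _).trans (add_le_add ?_ (i2.trans (by norm_num)))
      refine (norm_add_le _ _).trans (add_le_add ?_ (i1.trans (by norm_num)))
      exact (norm_add_le _ _).trans (add_le_add i3 i4.le)
    refine tri.trans ?_
    have : (n + |a| + 1 + 2 + S) * 1 ≤ (n + |a| + 1 + 2 + S) * Real.sqrt (1 + ‖z‖) := by gcongr
    linarith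
  -- Nothing is assumed about `A` on the imaginary axis, where poles may occur, so all integrals use
  -- the shift `w + ε`. Constants depending on `ε` only justify moving the contour and do not enter
  -- the inequality, so `ε → 0` is harmless.
  have key : ∀ ε : ℝ, 0 < ε → ε ≤ 1 →
      n * (Real.exp (-(ε * T)) * (T / 2)) ≤ a + 4 * Real.exp (T / 2) / T + T + D * K * T := by
    intro ε hε hε1
    have hdA : ∀ w : ℂ, 0 ≤ w.re → w.re ≤ 1 → DifferentiableAt ℂ (fun w ↦ A (w + ε)) w := by
      intro w h0 _
      have : DifferentiableAt ℂ A (w + ε) :=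
        (hA _ (by simpa using by linarith)).differentiableAt
          (isOpen_re_pos.mem_nhds (by simpa using by linarith))
      exact DifferentiableAt.fun_comp' w this (by fun_prop)
    have hdg : ∀ w : ℂ, 0 ≤ w.re → w.re ≤ 1 → DifferentiableAt ℂ (fun w ↦ g (w + ε)) w := by
      intro w h0 _
      have : DifferentiableAt ℂ g (w + ε) :=
        (hg _ (by simpa using by linarith)).differentiableAt
          (isOpen_re_pos.mem_nhds (by simpa using by linarith))
      exact DifferentiableAt.fun_comp' w this (by fun_prop)
    obtain ⟨C', hC', hAb'⟩ := exists_norm_le_of_re_nonneg hA hAre hC hAb hε hε1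
    obtain ⟨hiA0, hiA1, hAshift⟩ := integral_mul_fejerKernel_shift hT0 hC' hdA hAb'
    have hgb' : ∀ w : ℂ, 0 ≤ w.re → ‖g (w + ε)‖ ≤ K * 2 * Real.sqrt (1 + ‖w‖) := by
      intro w h0
      refine (hgb _ (by simpa using by linarith)).trans ?_
      rw [mul_assoc]
      refine mul_le_mul_of_nonneg_left (sqrt_one_add_norm_le ?_) hK
      refine (norm_add_le _ _).trans ?_
      rw [norm_real, Real.norm_of_nonneg hε.le]
      linarith
    obtain ⟨hig0, hig1, hgshift⟩ := integral_mul_fejerKernel_shift hT0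
      (by positivity : 0 ≤ K * 2) hdg (fun w h0 _ ↦ hgb' w h0)
    -- The Gamma part is estimated on the imaginary axis, where the kernel integral costs `O(T)`; on
    -- `Re w = 1` the available kernel bound has a factor `e^T`.
    have hgle := hDle T (fun w ↦ g (w + ε)) (K * 2) hT (by positivity)
      (fun y ↦ hgb' _ (by simp))
    have hpos := re_integral_mul_fejerKernel_nonneg (B := fun w ↦ A (w + ε)) hT0 hiA0
      (fun y ↦ hAre _ (by simpa using hε))
    have hLpos := re_integral_LSeries_mul_fejerKernel_nonneg hT0 (b := b) (σ := 3 / 2 + ε)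
      (hb _ (by simp; linarith)) hbre
    have j1 := integral_inv_mul_fejerKernel hT0 (a := ε) (by linarith)
    have j2 := integral_inv_mul_fejerKernel hT0 (a := 1 / 2 + ε) (by linarith)
    have j3 := integral_inv_mul_fejerKernel hT0 (a := ε - 1 / 2) (by linarith)
    have k1 := integrable_inv_mul_fejerKernel hT0 (a := ε) (by linarith)
    have k2 := integrable_inv_mul_fejerKernel hT0 (a := 1 / 2 + ε) (by linarith)
    have k3 := integrable_inv_mul_fejerKernel hT0 (a := ε - 1 / 2) (by linarith)
    have j0 : ∫ y : ℝ, fejerKernel T (1 + y * I) = 2 * Real.pi := by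
      have := integral_exp_mul_fejerKernel hT0 0
      simpa [triangle_zero] using this
    set I1 := ∫ u in (0 : ℝ)..T, (1 - u / T) * Real.exp (-(ε * u)) with hI1
    set I2 := ∫ u in (0 : ℝ)..T, (1 - u / T) * Real.exp (-((1 / 2 + ε) * u)) with hI2
    set I3 := ∫ u in (0 : ℝ)..T, (1 - u / T) * Real.exp (-((ε - 1 / 2) * u)) with hI3
    have hL : ∀ y : ℝ, LSeries b ((3 / 2 + ε : ℝ) + y * I) * fejerKernel T (1 + y * I) =
        (-(n : ℂ)) * ((1 + y * I + ε : ℂ)⁻¹ * fejerKernel T (1 + y * I)) +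
        a * fejerKernel T (1 + y * I) +
        (1 + y * I + (1 / 2 + ε : ℝ) : ℂ)⁻¹ * fejerKernel T (1 + y * I) +
        (1 + y * I + (ε - 1 / 2 : ℝ) : ℂ)⁻¹ * fejerKernel T (1 + y * I) +
        g (1 + y * I + ε) * fejerKernel T (1 + y * I) -
        A (1 + y * I + ε) * fejerKernel T (1 + y * I) := by
      intro y
      rw [hAeq (1 + y * I + ε) (by simpa using hε.le)]
      have e1 : (1 / 2 : ℂ) + (1 + y * I + ε) = (3 / 2 + ε : ℝ) + y * I := by push_cast; ring
      have e2 : (1 + y * I + ε : ℂ) + 1 / 2 = 1 + y * I + (1 / 2 + ε : ℝ) := by push_cast; ring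
      have e3 : (1 + y * I + ε : ℂ) - 1 / 2 = 1 + y * I + (ε - 1 / 2 : ℝ) := by push_cast; ring
      rw [e1, e2, e3]
      ring
    simp only [hL] at hLpos
    rw [integral_sub (((((k1.const_mul _).fun_add (hH.const_mul _)).fun_add k2).fun_add k3).fun_add hig1) hiA1,
      integral_add ((((k1.const_mul _).fun_add (hH.const_mul _)).fun_add k2).fun_add k3) hig1,
      integral_add (((k1.const_mul _).fun_add (hH.const_mul _)).fun_add k2) k3,
      integral_add ((k1.const_mul _).fun_add (hH.const_mul _)) k2,
      integral_add (k1.const_mul _) (hH.const_mul _), integral_const_mul, integral_const_mul,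
      j0, j1, j2, j3, ← hAshift, ← hgshift] at hLpos
    have hgre := (abs_le.mp ((abs_re_le_norm _).trans hgle)).2
    have hre : ((-(n : ℂ)) * (2 * Real.pi * I1) + a * (2 * Real.pi) + 2 * Real.pi * I2 +
        2 * Real.pi * I3).re = 2 * Real.pi * (-(n * I1) + a + I2 + I3) := by
      have : (-(n : ℂ)) * (2 * Real.pi * I1) + a * (2 * Real.pi) + 2 * Real.pi * I2 +
        2 * Real.pi * I3 = ((2 * Real.pi * (-(n * I1) + a + I2 + I3) : ℝ) : ℂ) := by
        push_cast; ring
      rw [this, ofReal_re]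
    rw [sub_re, add_re, hre] at hLpos
    have h1 : 0 ≤ 2 * Real.pi * (-(n * I1) + a + I2 + I3) + D * (K * 2) * T := by linarith
    have h2 : 0 ≤ -(n * I1) + a + I2 + I3 + D * K * T := by
      -- Dividing by `2π` absorbs the factor 2 that came from replacing `|w + ε|` by `|w|`.
      have hp : 2 ≤ 2 * Real.pi := by linarith [Real.pi_gt_three]
      have h3 : D * (K * 2) * T ≤ 2 * Real.pi * (D * K * T) := by
        have : 0 ≤ D * K * T := by positivity
        nlinarith
      have h4 : 0 ≤ 2 * Real.pi * (-(n * I1) + a + I2 + I3 + D * K * T) := by linarith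
      exact nonneg_of_mul_nonneg_right h4 hpi
    have l1 := le_integral_triangle_exp_neg hT0 hε.le
    have l2 := integral_triangle_exp_neg_le hT0 (a := 1 / 2 + ε) (by linarith)
    have l3 : I3 ≤ 4 * Real.exp (T / 2) / T := by
      refine le_trans ?_ (integral_triangle_exp_half hT0)
      refine intervalIntegral.integral_mono_on hT0.le
        (Continuous.intervalIntegrable (by fun_prop) _ _)
        (Continuous.intervalIntegrable (by fun_prop) _ _) fun u hu ↦ ?_
      have h3 : u / T ≤ 1 := (div_le_one hT0).mpr hu.2
      refine mul_le_mul_of_nonneg_left (Real.exp_le_exp.mpr ?_) (by linarith)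
      nlinarith [mul_nonneg hε.le hu.1]
    have l4 := mul_le_mul_of_nonneg_left l1 (Nat.cast_nonneg n : (0 : ℝ) ≤ n)
    linarith
  have hlim : Tendsto (fun ε : ℝ ↦ n * (Real.exp (-(ε * T)) * (T / 2))) (𝓝[>] 0)
      (𝓝 (n * (Real.exp (-(0 * T)) * (T / 2)))) :=
    Tendsto.mono_left (Continuous.tendsto (by fun_prop) 0) nhdsWithin_le_nhds
  have := le_of_tendsto hlim (eventually_of_mem (Ioo_mem_nhdsGT zero_lt_one)
    fun ε hε ↦ key ε hε.1 hε.2.le)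
  simpa using this

/-! ### Conjugation symmetry and functional equations -/

/-- Two entire functions that are related by conjugation on `Re s > 1` are so everywhere. -/
theorem eq_conj_conj_of_one_lt_re {f g : ℂ → ℂ} (hf : Differentiable ℂ f)
    (hg : Differentiable ℂ g) (h : ∀ s : ℂ, 1 < s.re → f s = conj (g (conj s))) (s : ℂ) :
    f s = conj (g (conj s)) := by
  have hg' : Differentiable ℂ (fun s ↦ conj (g (conj s))) := fun s ↦
    differentiableAt_conj_conj_iff.mpr (hg (conj s))
  have := (hf.differentiableOn.analyticOnNhd isOpen_univ).eqOn_of_preconnected_of_eventuallyEq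
    (hg'.differentiableOn.analyticOnNhd isOpen_univ) isPreconnected_univ (mem_univ (2 : ℂ)) ?_
  · exact this (mem_univ s)
  · filter_upwards [(isOpen_lt continuous_const continuous_re).mem_nhds
      (show (2 : ℂ) ∈ {s : ℂ | 1 < s.re} by simp)] with s hs using h s hs

theorem Gammaℝ_conj (s : ℂ) : Gammaℝ (conj s) = conj (Gammaℝ s) := by
  have harg : ((Real.pi : ℝ) : ℂ).arg ≠ Real.pi := by
    rw [arg_ofReal_of_nonneg Real.pi_pos.le]; exact Real.pi_pos.ne
  have h1 : -conj s / 2 = conj (-s / 2) := by simp [map_ofNat]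
  have h2 : conj s / 2 = conj (s / 2) := by simp [map_ofNat]
  rw [Gammaℝ_def, Gammaℝ_def, h1, h2, Gamma_conj, cpow_conj _ _ harg, conj_ofReal, map_mul]

namespace DirichletCharacter

variable {N : ℕ}

theorem gammaFactor_inv (χ : DirichletCharacter ℂ N) (s : ℂ) :
    gammaFactor χ⁻¹ s = gammaFactor χ s := by
  rcases χ.even_or_odd with h | h
  · have h' : χ⁻¹.Even := by
      rw [DirichletCharacter.Even, MulChar.inv_apply_eq_inv', h, inv_one]
    rw [h.gammaFactor_def, h'.gammaFactor_def]
  · have h' : χ⁻¹.Odd := by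
      rw [DirichletCharacter.Odd, MulChar.inv_apply_eq_inv', h]; norm_num
    rw [h.gammaFactor_def, h'.gammaFactor_def]

theorem gammaFactor_conj (χ : DirichletCharacter ℂ N) (s : ℂ) :
    gammaFactor χ (conj s) = conj (gammaFactor χ s) := by
  rcases χ.even_or_odd with h | h
  · rw [h.gammaFactor_def, h.gammaFactor_def, Gammaℝ_conj]
  · rw [h.gammaFactor_def, h.gammaFactor_def, ← Gammaℝ_conj, map_add, map_one]

theorem gammaFactor_ne_zero (χ : DirichletCharacter ℂ N) {s : ℂ} (hs : 0 < s.re) :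
    gammaFactor χ s ≠ 0 := by
  rcases χ.even_or_odd with h | h
  · rw [h.gammaFactor_def]; exact Gammaℝ_ne_zero_of_re_pos hs
  · rw [h.gammaFactor_def]; exact Gammaℝ_ne_zero_of_re_pos (by simp; linarith)

variable [NeZero N]

theorem completedLFunction_eq (χ : DirichletCharacter ℂ N) {s : ℂ} (hs : 0 < s.re) :
    completedLFunction χ s = gammaFactor χ s * LFunction χ s := by
  rw [LFunction_eq_completed_div_gammaFactor χ s (Or.inl (by rintro rfl; simp at hs)),
    mul_div_cancel₀ _ (gammaFactor_ne_zero χ hs)]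

theorem LFunction_inv_eq_conj (χ : DirichletCharacter ℂ N) {s : ℂ} (hs : 1 < s.re) :
    LFunction χ⁻¹ s = conj (LFunction χ (conj s)) := by
  rw [LFunction_eq_LSeries _ hs, LFunction_eq_LSeries _ (by simpa using hs), LSeries, LSeries,
    conj_tsum]
  refine tsum_congr fun n ↦ ?_
  rcases eq_or_ne n 0 with rfl | hn
  · simp
  · have harg : (n : ℂ).arg ≠ Real.pi := by
      rw [natCast_arg]; exact Real.pi_pos.ne
    rw [LSeries.term_of_ne_zero hn, LSeries.term_of_ne_zero hn, map_div₀, cpow_conj _ _ harg,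
      conj_conj, conj_natCast, ← MulChar.star_apply', RCLike.star_def]

theorem completedLFunction_inv_eq_conj {χ : DirichletCharacter ℂ N} (hχ : χ ≠ 1) (s : ℂ) :
    completedLFunction χ⁻¹ s = conj (completedLFunction χ (conj s)) := by
  refine eq_conj_conj_of_one_lt_re (differentiable_completedLFunction (inv_ne_one.mpr hχ))
    (differentiable_completedLFunction hχ) (fun s hs ↦ ?_) s
  rw [completedLFunction_eq _ (by linarith), completedLFunction_eq _ (by simpa using by linarith),
    map_mul, LFunction_inv_eq_conj χ hs, gammaFactor_inv, gammaFactor_conj, conj_conj]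

theorem norm_completedLFunction_one_sub_conj_aux {χ : DirichletCharacter ℂ N} (hχ : χ ≠ 1)
    (hp : χ.IsPrimitive) (s : ℂ) : ‖completedLFunction χ (1 - conj s)‖ =
      (N : ℝ) ^ (s.re - 1 / 2) * ‖rootNumber χ‖ * ‖completedLFunction χ s‖ := by
  have hN : (0 : ℝ) < N := by exact_mod_cast NeZero.pos N
  rw [hp.completedLFunction_one_sub, completedLFunction_inv_eq_conj hχ, conj_conj, norm_mul,
    norm_mul, RCLike.norm_conj, ← ofReal_natCast, norm_cpow_eq_rpow_re_of_pos hN]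
  simp

/-- The reflection `s ↦ 1 - s̄` is an involution. Using the functional equation at 2 and at its
mirror image returns to the same nonzero value with factor `|rootNumber|²`, the powers of `N`
cancelling. No Gauss sum evaluation is needed. -/
theorem norm_rootNumber {χ : DirichletCharacter ℂ N} (hχ : χ ≠ 1) (hp : χ.IsPrimitive) :
    ‖rootNumber χ‖ = 1 := by
  have hN : (0 : ℝ) < N := by exact_mod_cast NeZero.pos N
  have h1 := norm_completedLFunction_one_sub_conj_aux hχ hp 2
  have h2 := norm_completedLFunction_one_sub_conj_aux hχ hp (1 - conj 2)
  have h3 : (1 : ℂ) - conj (1 - conj 2) = 2 := by simp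
  rw [h3, h1] at h2
  have hne : ‖completedLFunction χ 2‖ ≠ 0 := by
    rw [norm_ne_zero_iff, completedLFunction_eq χ (by simp)]
    exact mul_ne_zero (gammaFactor_ne_zero χ (by simp))
      (LFunction_ne_zero_of_one_le_re χ (Or.inl hχ) (by simp))
  have h4 : (N : ℝ) ^ ((1 - conj (2 : ℂ)).re - 1 / 2) * (N : ℝ) ^ ((2 : ℂ).re - 1 / 2) = 1 := by
    rw [← Real.rpow_add hN]
    norm_num
  have h5 : ‖completedLFunction χ 2‖ * ‖rootNumber χ‖ ^ 2 = ‖completedLFunction χ 2‖ * 1 := by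
    rw [mul_one]
    conv_rhs => rw [h2]
    linear_combination (-(‖completedLFunction χ 2‖ * ‖rootNumber χ‖ ^ 2)) * h4
  have h6 := mul_left_cancel₀ hne h5
  nlinarith [norm_nonneg (rootNumber χ), sq_nonneg (‖rootNumber χ‖ - 1)]

theorem norm_completedLFunction_one_sub_conj {χ : DirichletCharacter ℂ N} (hχ : χ ≠ 1)
    (hp : χ.IsPrimitive) (s : ℂ) : ‖completedLFunction χ (1 - conj s)‖ =
      (N : ℝ) ^ (s.re - 1 / 2) * ‖completedLFunction χ s‖ := by
  rw [norm_completedLFunction_one_sub_conj_aux hχ hp, norm_rootNumber hχ hp, mul_one]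

end DirichletCharacter

theorem riemannXi_eq_conj (s : ℂ) : riemannXi s = conj (riemannXi (conj s)) := by
  refine eq_conj_conj_of_one_lt_re differentiable_riemannXi differentiable_riemannXi
    (fun s hs ↦ ?_) s
  have h1 : s ≠ 1 := by rintro rfl; simp at hs
  have h2 : conj s ≠ 1 := by
    intro h
    apply h1
    have := congrArg conj h
    simpa using this
  rw [riemannXi_eq (by linarith) h1, riemannXi_eq (by simpa using by linarith) h2, Gammaℝ_conj,
    riemannZeta_conj]
  simp

theorem norm_riemannXi_one_sub_conj (s : ℂ) : ‖riemannXi (1 - conj s)‖ = ‖riemannXi s‖ := by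
  rw [riemannXi_one_sub, riemannXi_eq_conj s, RCLike.norm_conj]

/-! ### Removing the central zero -/

/-- Division of an entire function by a power which divides it locally. -/
theorem exists_differentiable_eq_pow_mul {F h : ℂ → ℂ} {z₀ : ℂ} {n : ℕ} (hF : Differentiable ℂ F)
    (hh : DifferentiableAt ℂ h z₀) (heq : ∀ᶠ z in 𝓝 z₀, F z = (z - z₀) ^ n * h z) :
    ∃ g : ℂ → ℂ, Differentiable ℂ g ∧ ∀ z, F z = (z - z₀) ^ n * g z := by
  classical
  set g : ℂ → ℂ := Function.update (fun z ↦ F z / (z - z₀) ^ n) z₀ (h z₀) with hg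
  have hgne : ∀ z, z ≠ z₀ → g z = F z / (z - z₀) ^ n := fun z hz ↦ by
    rw [hg, Function.update_of_ne hz]
  refine ⟨g, fun z ↦ ?_, fun z ↦ ?_⟩
  · rcases eq_or_ne z z₀ with rfl | hz
    · refine hh.congr_of_eventuallyEq ?_
      filter_upwards [heq] with w hw
      rcases eq_or_ne w z with rfl | hwz
      · simp [hg]
      · rw [hgne w hwz, hw, mul_div_cancel_left₀ _ (pow_ne_zero _ (sub_ne_zero.mpr hwz))]
    · have h1 : DifferentiableAt ℂ (fun z ↦ F z / (z - z₀) ^ n) z :=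
        (hF z).div (by fun_prop) (pow_ne_zero _ (sub_ne_zero.mpr hz))
      refine h1.congr_of_eventuallyEq ?_
      filter_upwards [isOpen_ne.mem_nhds hz] with w hw using hgne w hw
  · rcases eq_or_ne z z₀ with rfl | hz
    · have := heq.self_of_nhds
      rw [this]; simp [hg]
    · rw [hgne z hz, mul_div_cancel₀ _ (pow_ne_zero _ (sub_ne_zero.mpr hz))]

theorem DirichletCharacter.differentiableAt_gammaFactor {N : ℕ} [NeZero N]
    (χ : DirichletCharacter ℂ N) {s : ℂ} (hs : 0 < s.re) :
    DifferentiableAt ℂ (gammaFactor χ) s := by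
  rcases χ.even_or_odd with h | h
  · have : gammaFactor χ = Gammaℝ := funext h.gammaFactor_def
    rw [this]; exact differentiableAt_Gammaℝ hs
  · have : gammaFactor χ = fun s ↦ Gammaℝ (s + 1) := funext h.gammaFactor_def
    rw [this]
    have h1 : DifferentiableAt ℂ Gammaℝ (s + 1) := differentiableAt_Gammaℝ (by simp; linarith)
    exact DifferentiableAt.fun_comp' s h1 (by fun_prop)

/-- Dividing out the central zero of the completed L-function. -/
theorem exists_completedLFunction_eq {N : ℕ} [NeZero N] {χ : DirichletCharacter ℂ N}
    (hχ : χ ≠ 1) : ∃ g : ℂ → ℂ, Differentiable ℂ g ∧ ∀ s,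
      DirichletCharacter.completedLFunction χ s = (s - 1 / 2) ^ centralOrder χ * g s := by
  obtain ⟨han, hord⟩ := centralOrder_spec χ hχ
  obtain ⟨l, hl, -, heq⟩ := han.analyticOrderAt_eq_natCast.mp hord.symm
  refine exists_differentiable_eq_pow_mul (h := fun s ↦ χ.gammaFactor s * l s)
    (DirichletCharacter.differentiable_completedLFunction hχ)
    ((χ.differentiableAt_gammaFactor (by norm_num)).mul hl.differentiableAt) ?_
  filter_upwards [heq, isOpen_re_pos.mem_nhds (show (1 / 2 : ℂ) ∈ {s : ℂ | 0 < s.re} by norm_num)]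
    with s hs hs0
  rw [DirichletCharacter.completedLFunction_eq χ hs0, hs, smul_eq_mul]
  ring

/-! ### Non-vanishing under GRH and ratio bounds for the factors -/

namespace DirichletCharacter

variable {N : ℕ} [NeZero N]

theorem LFunction_ne_zero_of_GRH (hGRH : GRH) {χ : DirichletCharacter ℂ N} {s : ℂ}
    (hχ : χ ≠ 1 ∨ s ≠ 1) (hs : 1 / 2 < s.re) : LFunction χ s ≠ 0 := by
  rcases lt_or_ge s.re 1 with h | h
  · intro h0
    exact absurd (hGRH N χ s (by linarith) h h0) hs.ne'
  · exact LFunction_ne_zero_of_one_le_re χ hχ h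

end DirichletCharacter

theorem riemannZeta_ne_zero_of_GRH (hGRH : GRH) {s : ℂ} (h1 : s ≠ 1) (hs : 1 / 2 < s.re) :
    riemannZeta s ≠ 0 := by
  have := DirichletCharacter.LFunction_ne_zero_of_GRH hGRH
    (χ := (1 : DirichletCharacter ℂ 1)) (Or.inr h1) hs
  rwa [DirichletCharacter.LFunction_modOne_eq] at this

theorem riemannXi_ne_zero_of_GRH (hGRH : GRH) {s : ℂ} (hs : 1 / 2 < s.re) :
    riemannXi s ≠ 0 := by
  have h0 : 0 < s.re := by linarith
  by_cases h1 : s = 1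
  · simp [h1, riemannXi]
  · rw [riemannXi_eq h0 h1]
    refine mul_ne_zero (mul_ne_zero ?_ (sub_ne_zero.mpr h1))
      (mul_ne_zero (Gammaℝ_ne_zero_of_re_pos h0) (riemannZeta_ne_zero_of_GRH hGRH h1 hs))
    rintro rfl; simp at h0

theorem ratioTempered_LFunction (hGRH : GRH) {N : ℕ} [NeZero N] {χ : DirichletCharacter ℂ N}
    (hχ : χ ≠ 1) : RatioTempered (fun z ↦ DirichletCharacter.LFunction χ (1 / 2 + z)) := by
  obtain ⟨K, hK0, hK⟩ := DirichletCharacter.exists_norm_LFunction_le hχ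
  obtain ⟨c, K', hc, hcK⟩ := DirichletCharacter.exists_LFunction_bounds χ
  have hd := DirichletCharacter.differentiable_LFunction hχ
  refine ratioTempered_of_bounds (K := max K K') (c := c) (k := 1)
    (hd.comp (differentiable_const _ |>.add differentiable_id)).differentiableOn
    (fun z hz ↦ DirichletCharacter.LFunction_ne_zero_of_GRH hGRH (Or.inl hχ) ?_) (fun z hz ↦ ?_) hc
    (fun z hz ↦ (hcK _ ?_).1) (fun z hz ↦ (hcK _ ?_).2.trans (le_max_right _ _))
  · simp; linarith
  · refine (hK _ (by simp; linarith)).trans ?_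
    rw [pow_one]
    gcongr
    · exact le_max_left _ _
    · refine (norm_add_le _ _).trans ?_
      gcongr
      norm_num
  · simp; linarith
  · simp; linarith

/-- The function is `(s-1)ζ(s)/(s+1)` with `s = 1/2 + z`. The extra denominator is there because
`ratioTempered_of_bounds` asks for two-sided constant bounds far to the right, which `(s-1)ζ(s)`
violates. -/
theorem ratioTempered_riemannXi_div (hGRH : GRH) :
    RatioTempered (fun z ↦ (3 / 2 + z)⁻¹ *
      (riemannXi (1 / 2 + z) * (Gammaℝ (1 / 2 + z))⁻¹ / (1 / 2 + z))) := by
  obtain ⟨c, K, hc, hcK⟩ := DirichletCharacter.exists_LFunction_bounds (1 : DirichletCharacter ℂ 1)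
  rw [DirichletCharacter.LFunction_modOne_eq] at hcK
  have hne : ∀ z : ℂ, -1 < z.re → 3 / 2 + z ≠ 0 := fun z hz h ↦ by
    have := congrArg re h
    simp at this; linarith
  have key : ∀ z : ℂ, 3 / 2 ≤ z.re → (3 / 2 + z)⁻¹ *
      (riemannXi (1 / 2 + z) * (Gammaℝ (1 / 2 + z))⁻¹ / (1 / 2 + z)) =
      (z - 1 / 2) / (z + 3 / 2) * riemannZeta (1 / 2 + z) := fun z hz ↦ by
    rw [riemannXi_div_eq (by simp; linarith) (by intro h; have := congrArg re h; simp at this; linarith)]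
    rw [add_comm z (3 / 2)]
    ring
  have hup : ∀ z : ℂ, 3 / 2 ≤ z.re → ‖z - 1 / 2‖ / ‖z + 3 / 2‖ ≤ 1 := fun z hz ↦ by
    refine div_le_one_of_le₀ ?_ (norm_nonneg _)
    rw [norm_eq_sqrt_sq_add_sq, norm_eq_sqrt_sq_add_sq]
    apply Real.sqrt_le_sqrt
    simp
    nlinarith
  have hlow : ∀ z : ℂ, 3 / 2 ≤ z.re → 1 / 3 ≤ ‖z - 1 / 2‖ / ‖z + 3 / 2‖ := fun z hz ↦ by
    have h1 : 1 ≤ ‖z - 1 / 2‖ := le_trans (by simp; linarith) (re_le_norm _)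
    have h2 : ‖z + 3 / 2‖ ≤ ‖z - 1 / 2‖ + 2 := by
      calc ‖z + 3 / 2‖ = ‖(z - 1 / 2) + 2‖ := by congr 1; ring
        _ ≤ _ := by simpa using norm_add_le (z - 1 / 2) 2
    have h3 : 0 < ‖z + 3 / 2‖ := norm_pos_iff.mpr (by rw [add_comm]; exact hne z (by linarith))
    rw [le_div_iff₀ h3]; linarith
  refine ratioTempered_of_bounds (K := max 36 K) (c := 1 / 3 * c) (k := 2) ?_ (fun z hz ↦ ?_)
    (fun z hz ↦ ?_) (by positivity) (fun z hz ↦ ?_) (fun z hz ↦ ?_)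
  · refine DifferentiableOn.mul (fun z hz ↦ ?_) ?_
    · have := hne z (by have : 0 < z.re := hz
                        linarith)
      exact (((differentiableAt_const _).add differentiableAt_id).inv this).differentiableWithinAt
    · exact differentiableOn_riemannXi_div.comp
        ((differentiable_const _).add differentiable_id).differentiableOn
        (fun z hz ↦ by
          have : 0 < z.re := hz
          simp; linarith)
  · have hs : (1 : ℝ) / 2 < (1 / 2 + z).re := by simp; linarith
    have hs0 : 0 < (1 / 2 + z).re := by linarith
    refine mul_ne_zero (inv_ne_zero (hne z (by linarith))) (div_ne_zero (mul_ne_zero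
      (riemannXi_ne_zero_of_GRH hGRH hs) (inv_ne_zero (Gammaℝ_ne_zero_of_re_pos hs0))) ?_)
    intro h; rw [h] at hs0; simp at hs0
  · have h1 : (1 : ℝ) ≤ ‖3 / 2 + z‖ := le_trans (by simp; linarith) (re_le_norm _)
    rw [norm_mul, norm_inv]
    calc ‖3 / 2 + z‖⁻¹ * _ ≤ 1 * (4 * (1 + ‖1 / 2 + z‖) ^ 2) := by
          gcongr
          · exact inv_le_one_of_one_le₀ h1
          · exact norm_riemannXi_div_le (by simp; linarith)
      _ ≤ 4 * (3 * (1 + ‖z‖)) ^ 2 := by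
          rw [one_mul]
          gcongr
          have : ‖1 / 2 + z‖ ≤ 1 / 2 + ‖z‖ := by simpa using norm_add_le (1 / 2 : ℂ) z
          linarith [norm_nonneg z]
      _ = 36 * (1 + ‖z‖) ^ 2 := by ring
      _ ≤ _ := by gcongr; exact le_max_left _ _
  · rw [key z hz, norm_mul, norm_div]
    have := (hcK (1 / 2 + z) (by simp; linarith)).1
    exact mul_le_mul (hlow z hz) this hc.le (by positivity)
  · rw [key z hz, norm_mul, norm_div]
    have := (hcK (1 / 2 + z) (by simp; linarith)).2
    calc _ ≤ 1 * K := by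
          gcongr
          exact hup z hz
      _ ≤ _ := by rw [one_mul]; exact le_max_right _ _

theorem ratioTempered_gammaFactor {N : ℕ} (χ : DirichletCharacter ℂ N) :
    RatioTempered (fun z ↦ DirichletCharacter.gammaFactor χ (1 / 2 + z)) := by
  rcases χ.even_or_odd with h | h
  · refine (ratioTempered_Gammaℝ (b := 1 / 2) le_rfl).congr fun z _ _ ↦ ?_
    rw [h.gammaFactor_def]; push_cast; rfl
  · refine (ratioTempered_Gammaℝ (b := 3 / 2) (by norm_num)).congr fun z _ _ ↦ ?_
    rw [h.gammaFactor_def]; congr 1; push_cast; ring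

/-! ### The reduced product -/

/-- The function `ξ(s) q^{(s - 1/2) / 2} g(s)` at `s = 1/2 + z`, where `g` is obtained from the
completed `L`-function by removing its central zero. -/
noncomputable def reducedProduct (q : ℕ) (g : ℂ → ℂ) (z : ℂ) : ℂ :=
  riemannXi (1 / 2 + z) * exp ((Real.log q / 2 : ℝ) * z) * g (1 / 2 + z)

section ReducedProduct

theorem differentiable_reducedProduct (q : ℕ) {g : ℂ → ℂ} (hg : Differentiable ℂ g) :
    Differentiable ℂ (reducedProduct q g) := by
  have := differentiable_riemannXi
  unfold reducedProduct
  fun_prop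

variable {N : ℕ} [NeZero N] {χ : DirichletCharacter ℂ N} {g : ℂ → ℂ}

theorem reducedProduct_eq
    (hg : ∀ s, DirichletCharacter.completedLFunction χ s = (s - 1 / 2) ^ centralOrder χ * g s)
    {z : ℂ} (hz : z ≠ 0) (hre : -(1 / 2) < z.re) :
    reducedProduct N g z = (z ^ centralOrder χ)⁻¹ * riemannXi (1 / 2 + z) *
      exp ((Real.log N / 2 : ℝ) * z) * DirichletCharacter.gammaFactor χ (1 / 2 + z) *
      DirichletCharacter.LFunction χ (1 / 2 + z) := by
  have h := hg (1 / 2 + z)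
  rw [DirichletCharacter.completedLFunction_eq χ (by simp; linarith), add_sub_cancel_left] at h
  rw [reducedProduct, mul_assoc _ (DirichletCharacter.gammaFactor _ _), h]
  field_simp

theorem reducedProduct_ne_zero
    (hg : ∀ s, DirichletCharacter.completedLFunction χ s = (s - 1 / 2) ^ centralOrder χ * g s)
    (hGRH : GRH) (hχ : χ ≠ 1) {z : ℂ} (hz : 0 < z.re) :
    reducedProduct N g z ≠ 0 := by
  have hs : 1 / 2 < (1 / 2 + z).re := by simpa using hz
  have hz0 : z ≠ 0 := by rintro rfl; simp at hz
  rw [reducedProduct_eq hg hz0 (by linarith)]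
  exact mul_ne_zero (mul_ne_zero (mul_ne_zero (mul_ne_zero (inv_ne_zero (pow_ne_zero _ hz0))
    (riemannXi_ne_zero_of_GRH hGRH hs)) (exp_ne_zero _))
    (χ.gammaFactor_ne_zero (by linarith)))
    (DirichletCharacter.LFunction_ne_zero_of_GRH hGRH (Or.inl hχ) hs)

/-- The functional equation of the completed L-function carries a factor `N^(Re z)`, which the
exponential `N^(z/2)` splits evenly between the two sides. Removing `z^n` does no harm, as `|z|` is
itself symmetric. -/
theorem norm_reducedProduct_neg_conj
    (hg : ∀ s, DirichletCharacter.completedLFunction χ s = (s - 1 / 2) ^ centralOrder χ * g s)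
    (hχ : χ ≠ 1) (hp : χ.IsPrimitive) (z : ℂ) :
    ‖reducedProduct N g (-conj z)‖ = ‖reducedProduct N g z‖ := by
  rcases eq_or_ne z 0 with rfl | hz
  · simp
  have hN : (0 : ℝ) < N := by exact_mod_cast Nat.pos_of_ne_zero (NeZero.ne N)
  have hs : 1 / 2 + -conj z = 1 - conj (1 / 2 + z) := by
    simp only [map_add, map_div₀, map_one, map_ofNat]; ring
  have key := DirichletCharacter.norm_completedLFunction_one_sub_conj hχ hp (1 / 2 + z)
  rw [← hs, hg, hg, norm_mul, norm_mul, add_sub_cancel_left, add_sub_cancel_left, norm_pow,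
    norm_pow, norm_neg, norm_conj] at key
  have hzn : ‖z‖ ^ centralOrder χ ≠ 0 := pow_ne_zero _ (norm_ne_zero_iff.mpr hz)
  have key' : ‖g (1 / 2 + -conj z)‖ = (N : ℝ) ^ z.re * ‖g (1 / 2 + z)‖ := by
    refine mul_left_cancel₀ hzn (key.trans ?_)
    have : (1 / 2 + z).re - 1 / 2 = z.re := by simp
    rw [this]; ring
  simp only [reducedProduct, norm_mul]
  rw [key', hs, norm_riemannXi_one_sub_conj, norm_exp, norm_exp, re_ofReal_mul, re_ofReal_mul,
    Real.rpow_def_of_pos hN, mul_assoc, ← mul_assoc (Real.exp _), ← Real.exp_add, neg_re, conj_re,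
    ← mul_assoc]
  congr 3
  ring

/-- Here `ξ` is split as `s(s+1)Gammaℝ(s)` times `(s-1)ζ(s)/(s+1)`; each remaining factor has its
own ratio bound. -/
theorem ratioTempered_reducedProduct
    (hg : ∀ s, DirichletCharacter.completedLFunction χ s = (s - 1 / 2) ^ centralOrder χ * g s)
    (hGRH : GRH) (hχ : χ ≠ 1) :
    RatioTempered (reducedProduct N g) := by
  have hN : 0 ≤ Real.log N / 2 := div_nonneg (Real.log_natCast_nonneg N) (by norm_num)
  refine ((((((ratioTempered_inv_pow (centralOrder χ)).mul
    ((ratioTempered_const_add (a := 1 / 2) (by norm_num)).mul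
      (ratioTempered_const_add (a := 3 / 2) (by norm_num)))).mul
      ((ratioTempered_Gammaℝ (b := 1 / 2) le_rfl).mul
      (ratioTempered_riemannXi_div hGRH))).mul (ratioTempered_exp_mul hN)).mul
      (ratioTempered_gammaFactor χ)).mul (ratioTempered_LFunction hGRH hχ)).congr
      fun z hz hz1 ↦ ?_
  have hz0 : z ≠ 0 := by rintro rfl; norm_num at hz1
  have hs : 0 < (1 / 2 + z).re := by simp; linarith
  have h1 : (1 / 2 + z) ≠ 0 := fun h ↦ by rw [h] at hs; simp at hs
  have h2 : (3 / 2 + z) ≠ 0 := fun h ↦ by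
    have := congrArg re h
    simp at this; linarith
  have h3 := Gammaℝ_ne_zero_of_re_pos hs
  rw [reducedProduct_eq hg hz0 (by linarith)]
  congr 3
  rw [mul_assoc (z ^ _)⁻¹]
  congr 1
  push_cast
  generalize riemannXi (1 / 2 + z) = x
  generalize Gammaℝ (1 / 2 + z) = y at h3 ⊢
  generalize 1 / 2 + z = u at h1 ⊢
  generalize 3 / 2 + z = v at h2 ⊢
  field_simp

end ReducedProduct

/-! ### Logarithmic derivatives -/

theorem DifferentiableOn.logDeriv {f : ℂ → ℂ} {U : Set ℂ} (hf : DifferentiableOn ℂ f U)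
    (hU : IsOpen U) (hne : ∀ z ∈ U, f z ≠ 0) : DifferentiableOn ℂ (logDeriv f) U :=
  (hf.deriv hU).div hf hne

theorem logDeriv_const_add_comp (f : ℂ → ℂ) (c z : ℂ) :
    logDeriv (fun w ↦ f (c + w)) z = logDeriv f (c + z) := by
  rw [logDeriv_apply, logDeriv_apply, deriv_comp_const_add]

theorem logDeriv_mul₅ {f₁ f₂ f₃ f₄ f₅ : ℂ → ℂ} {z : ℂ} (h₁ : f₁ z ≠ 0) (h₂ : f₂ z ≠ 0)
    (h₃ : f₃ z ≠ 0) (h₄ : f₄ z ≠ 0) (h₅ : f₅ z ≠ 0) (d₁ : DifferentiableAt ℂ f₁ z)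
    (d₂ : DifferentiableAt ℂ f₂ z) (d₃ : DifferentiableAt ℂ f₃ z) (d₄ : DifferentiableAt ℂ f₄ z)
    (d₅ : DifferentiableAt ℂ f₅ z) :
    logDeriv (fun w ↦ f₁ w * f₂ w * f₃ w * f₄ w * f₅ w) z = logDeriv f₁ z + logDeriv f₂ z +
      logDeriv f₃ z + logDeriv f₄ z + logDeriv f₅ z := by
  rw [logDeriv_mul (f := fun w ↦ f₁ w * f₂ w * f₃ w * f₄ w) (g := f₅) z
      (mul_ne_zero (mul_ne_zero (mul_ne_zero h₁ h₂) h₃) h₄) h₅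
      (((d₁.mul d₂).mul d₃).mul d₄) d₅,
    logDeriv_mul (f := fun w ↦ f₁ w * f₂ w * f₃ w) (g := f₄) z
      (mul_ne_zero (mul_ne_zero h₁ h₂) h₃) h₄ ((d₁.mul d₂).mul d₃) d₄,
    logDeriv_mul (f := fun w ↦ f₁ w * f₂ w) (g := f₃) z (mul_ne_zero h₁ h₂) h₃ (d₁.mul d₂) d₃,
    logDeriv_mul z h₁ h₂ d₁ d₂]

namespace DirichletCharacter

theorem logDeriv_LFunction {N : ℕ} [NeZero N] (χ : DirichletCharacter ℂ N) {s : ℂ}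
    (hs : 1 < s.re) :
    logDeriv (LFunction χ) s =
      -LSeries ((fun n : ℕ ↦ χ n) * fun n ↦ (ArithmeticFunction.vonMangoldt n : ℂ)) s := by
  rw [LSeries_twist_vonMangoldt_eq χ hs, logDeriv_apply, deriv_LFunction_eq_deriv_LSeries χ hs,
    LFunction_eq_LSeries χ hs, neg_div, neg_neg]

theorem differentiableOn_gammaFactor {N : ℕ} [NeZero N] (χ : DirichletCharacter ℂ N) :
    DifferentiableOn ℂ (gammaFactor χ) {s | 0 < s.re} :=
  fun _ hs ↦ (differentiableAt_gammaFactor χ hs).differentiableWithinAt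

/-- The character enters only through its parity, giving a shift by 0 or 1, so one constant serves
all characters; this is where uniformity of the error term originates. -/
theorem exists_norm_logDeriv_gammaFactor_le : ∃ K : ℝ, 0 ≤ K ∧ ∀ (N : ℕ)
    (χ : DirichletCharacter ℂ N) (z : ℂ), 0 < z.re →
      ‖logDeriv Gammaℝ (1 / 2 + z) + logDeriv (gammaFactor χ) (1 / 2 + z)‖ ≤ K * √(1 + ‖z‖) := by
  obtain ⟨K, hK0, hK⟩ := exists_norm_logDeriv_Gammaℝ_le
  refine ⟨4 * K, by positivity, fun N χ z hz ↦ ?_⟩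
  have h1 : ‖logDeriv Gammaℝ (1 / 2 + z)‖ ≤ K * (2 * √(1 + ‖z‖)) := by
    refine (hK _ (by simp; linarith)).trans ?_
    gcongr
    refine sqrt_one_add_norm_le ?_
    have : ‖1 / 2 + z‖ ≤ 1 / 2 + ‖z‖ := by simpa using norm_add_le (1 / 2 : ℂ) z
    linarith
  have h2 : ‖logDeriv (gammaFactor χ) (1 / 2 + z)‖ ≤ K * (2 * √(1 + ‖z‖)) := by
    rcases χ.even_or_odd with h | h
    · rwa [show gammaFactor χ = Gammaℝ from funext h.gammaFactor_def]
    · rw [show gammaFactor χ = fun s ↦ Gammaℝ (1 + s) from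
        funext fun s ↦ by rw [h.gammaFactor_def, add_comm], logDeriv_const_add_comp]
      refine (hK _ (by simp; linarith)).trans ?_
      gcongr
      refine sqrt_one_add_norm_le ?_
      have : ‖1 + (1 / 2 + z)‖ ≤ 1 + (1 / 2 + ‖z‖) := by
        refine (norm_add_le _ _).trans ?_
        gcongr
        · simp
        · simpa using norm_add_le (1 / 2 : ℂ) z
      linarith
  exact (norm_add_le _ _).trans (by linarith)

end DirichletCharacter

theorem logDeriv_riemannZeta {s : ℂ} (hs : 1 < s.re) :
    logDeriv riemannZeta s = -LSeries (fun n ↦ (ArithmeticFunction.vonMangoldt n : ℂ)) s := by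
  rw [ArithmeticFunction.LSeries_vonMangoldt_eq_deriv_riemannZeta_div hs, logDeriv_apply, neg_div,
    neg_neg]

theorem logDeriv_riemannXi {s : ℂ} (hs : 1 < s.re) :
    logDeriv riemannXi s = s⁻¹ + (s - 1)⁻¹ + logDeriv Gammaℝ s + logDeriv riemannZeta s := by
  have h0 : s ≠ 0 := by rintro rfl; norm_num at hs
  have h1 : s ≠ 1 := by rintro rfl; norm_num at hs
  have hpos : 0 < s.re := by linarith
  have hev : riemannXi =ᶠ[𝓝 s] fun w ↦ w * (w - 1) * Gammaℝ w * riemannZeta w := by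
    filter_upwards [isOpen_re_pos.mem_nhds hpos, isOpen_ne.mem_nhds h1] with w hw hw1
    rw [riemannXi_eq hw hw1]; ring
  have hz := riemannZeta_ne_zero_of_one_le_re hs.le
  have hG := Gammaℝ_ne_zero_of_re_pos hpos
  have dG := differentiableAt_Gammaℝ hpos
  have dz := differentiableAt_riemannZeta h1
  have d1 : DifferentiableAt ℂ (fun w : ℂ ↦ w - 1) s := by fun_prop
  have h1' := sub_ne_zero.mpr h1
  rw [logDeriv_apply, hev.deriv_eq, hev.eq_of_nhds, ← logDeriv_apply,
    logDeriv_mul (f := fun w ↦ w * (w - 1) * Gammaℝ w) s (mul_ne_zero (mul_ne_zero h0 h1') hG) hz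
      ((differentiableAt_id.mul d1).mul dG) dz,
    logDeriv_mul (f := fun w ↦ w * (w - 1)) s (mul_ne_zero h0 h1') hG
      (differentiableAt_id.mul d1) dG,
    logDeriv_mul (f := fun w ↦ w) s h0 h1' differentiableAt_id d1]
  simp [logDeriv_apply]

section

variable {N : ℕ} [NeZero N] {χ : DirichletCharacter ℂ N} {g : ℂ → ℂ}

/-- `Re z ≥ 1` puts `1/2 + z` in the region of absolute convergence. The terms `(z ± 1/2)⁻¹` come
from the factors `s` and `s - 1` of `ξ`, and `(log N)/2` from the exponential. -/
theorem logDeriv_reducedProduct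
    (hg : ∀ s, DirichletCharacter.completedLFunction χ s = (s - 1 / 2) ^ centralOrder χ * g s)
    (hχ : χ ≠ 1) {z : ℂ} (hz : 1 ≤ z.re) :
    logDeriv (reducedProduct N g) z = -(centralOrder χ * z⁻¹) + (Real.log N / 2 : ℝ) +
      (z + 1 / 2)⁻¹ + (z - 1 / 2)⁻¹ + (logDeriv Gammaℝ (1 / 2 + z) +
        logDeriv (DirichletCharacter.gammaFactor χ) (1 / 2 + z)) -
      LSeries ((fun n ↦ (ArithmeticFunction.vonMangoldt n : ℂ)) +
        (fun n : ℕ ↦ χ n) * fun n ↦ (ArithmeticFunction.vonMangoldt n : ℂ)) (1 / 2 + z) := by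
  have hs : 1 < (1 / 2 + z).re := by simp; linarith
  have hpos : 0 < (1 / 2 + z).re := by linarith
  have hz0 : z ≠ 0 := by rintro rfl; norm_num at hz
  have hev : reducedProduct N g =ᶠ[𝓝 z] fun z ↦ (z ^ centralOrder χ)⁻¹ * riemannXi (1 / 2 + z) *
      exp ((Real.log N / 2 : ℝ) * z) * DirichletCharacter.gammaFactor χ (1 / 2 + z) *
      DirichletCharacter.LFunction χ (1 / 2 + z) := by
    filter_upwards [isOpen_re_pos.mem_nhds (show 0 < z.re by linarith)] with w hw
    have hw : 0 < w.re := hw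
    exact reducedProduct_eq hg (by rintro rfl; simp at hw) (by linarith)
  have dadd : DifferentiableAt ℂ (fun w : ℂ ↦ 1 / 2 + w) z := by fun_prop
  have hξ : riemannXi (1 / 2 + z) ≠ 0 := by
    rw [riemannXi_eq hpos (by rintro h; rw [h] at hs; simp at hs)]
    refine mul_ne_zero (mul_ne_zero ?_ (sub_ne_zero.mpr ?_))
      (mul_ne_zero (Gammaℝ_ne_zero_of_re_pos hpos) (riemannZeta_ne_zero_of_one_le_re hs.le)) <;>
    · rintro h; rw [h] at hs; norm_num at hs
  have hpow : logDeriv (fun w : ℂ ↦ (w ^ centralOrder χ)⁻¹) z = -(centralOrder χ * z⁻¹) := by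
    have := logDeriv_zpow z (-(centralOrder χ : ℤ))
    simp only [zpow_neg, zpow_natCast] at this
    rw [this]; push_cast; ring
  have hexp : logDeriv (fun w : ℂ ↦ exp ((Real.log N / 2 : ℝ) * w)) z = (Real.log N / 2 : ℝ) := by
    have hd : HasDerivAt (fun w : ℂ ↦ exp ((Real.log N / 2 : ℝ) * w))
        (exp ((Real.log N / 2 : ℝ) * z) * ((Real.log N / 2 : ℝ) * 1)) z :=
      ((hasDerivAt_id z).const_mul _).cexp
    rw [logDeriv_apply, hd.deriv, mul_one, mul_div_cancel_left₀ _ (exp_ne_zero _)]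
  rw [logDeriv_apply, hev.deriv_eq, hev.eq_of_nhds, ← logDeriv_apply,
    logDeriv_mul₅ (f₁ := fun w ↦ (w ^ centralOrder χ)⁻¹)
    (f₂ := fun w ↦ riemannXi (1 / 2 + w)) (f₃ := fun w ↦ exp ((Real.log N / 2 : ℝ) * w))
    (f₄ := fun w ↦ DirichletCharacter.gammaFactor χ (1 / 2 + w))
    (f₅ := fun w ↦ DirichletCharacter.LFunction χ (1 / 2 + w)) (inv_ne_zero (pow_ne_zero _ hz0)) hξ (exp_ne_zero _)
    (χ.gammaFactor_ne_zero hpos) (DirichletCharacter.LFunction_ne_zero_of_one_le_re χ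
      (Or.inl hχ) hs.le) ((differentiableAt_id.pow _).inv (pow_ne_zero _ hz0))
    ((differentiable_riemannXi _).comp z dadd) (by fun_prop)
    ((DirichletCharacter.differentiableAt_gammaFactor χ hpos).comp z dadd)
    ((DirichletCharacter.differentiable_LFunction hχ _).comp z dadd), hpow, hexp,
    logDeriv_const_add_comp, logDeriv_const_add_comp, logDeriv_const_add_comp,
    logDeriv_riemannXi hs, logDeriv_riemannZeta hs, χ.logDeriv_LFunction hs,
    LSeries_add (ArithmeticFunction.LSeriesSummable_vonMangoldt hs)
      (χ.LSeriesSummable_twist_vonMangoldt hs), show 1 / 2 + z - 1 = z - 1 / 2 by ring,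
    add_comm z (1 / 2)]
  ring

end

/-! ### The inequality for primitive characters -/

theorem exists_centralOrder_mul_le (hGRH : GRH) : ∃ C : ℝ, 0 ≤ C ∧ ∀ (N : ℕ) [NeZero N]
    (χ : DirichletCharacter ℂ N), χ ≠ 1 → χ.IsPrimitive → ∀ T : ℝ, 1 ≤ T →
      centralOrder χ * (T / 2) ≤ Real.log N / 2 + 4 * Real.exp (T / 2) / T + C * T := by
  obtain ⟨D, hD0, hD⟩ := exists_explicit_inequality
  obtain ⟨K, hK0, hK⟩ := DirichletCharacter.exists_norm_logDeriv_gammaFactor_le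
  refine ⟨1 + D * K, by positivity, fun N _ χ hχ hp T hT ↦ ?_⟩
  obtain ⟨g, hgd, hg⟩ := exists_completedLFunction_eq hχ
  have hfd := differentiable_reducedProduct N hgd
  have hmaps : MapsTo (fun z : ℂ ↦ 1 / 2 + z) {z | 0 < z.re} {z | 0 < z.re} := fun z hz ↦ by
    have hz : 0 < z.re := hz
    simp; linarith
  have hadd : DifferentiableOn ℂ (fun z : ℂ ↦ 1 / 2 + z) {z | 0 < z.re} := by fun_prop
  have key := hD (logDeriv (reducedProduct N g)) (fun z ↦ logDeriv Gammaℝ (1 / 2 + z) +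
        logDeriv (DirichletCharacter.gammaFactor χ) (1 / 2 + z))
    ((fun n ↦ (ArithmeticFunction.vonMangoldt n : ℂ)) +
        (fun n : ℕ ↦ χ n) * fun n ↦ (ArithmeticFunction.vonMangoldt n : ℂ))
    (centralOrder χ) (Real.log N / 2) K T hT hK0
    (hfd.differentiableOn.logDeriv isOpen_re_pos fun z hz ↦ reducedProduct_ne_zero hg hGRH hχ hz)
    (fun z hz ↦ re_logDeriv_nonneg hfd (norm_reducedProduct_neg_conj hg hχ hp)
      (fun z hz ↦ reducedProduct_ne_zero hg hGRH hχ hz) (ratioTempered_reducedProduct hg hGRH hχ)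
      hz)
    (.add (.comp (.logDeriv (fun s hs ↦ (differentiableAt_Gammaℝ hs).differentiableWithinAt)
      isOpen_re_pos fun s hs ↦ Gammaℝ_ne_zero_of_re_pos hs) hadd hmaps)
      (.comp (.logDeriv (DirichletCharacter.differentiableOn_gammaFactor χ) isOpen_re_pos
        fun s hs ↦ χ.gammaFactor_ne_zero hs) hadd hmaps))
    (fun z hz ↦ hK N χ z hz)
    (fun s hs ↦ (ArithmeticFunction.LSeriesSummable_vonMangoldt (by linarith)).add
      (χ.LSeriesSummable_twist_vonMangoldt (by linarith)))
    (fun k ↦ ?_) (fun z hz ↦ logDeriv_reducedProduct hg hχ hz)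
  · linarith
  -- This is where including `ξ` pays off: `Re (1 + χ(k)) ≥ 0`, so all coefficients `Λ(k)(1 + χ(k))`
  -- have nonnegative real part.
  · have h1 : -1 ≤ (χ k).re := by
      have := (abs_re_le_norm (χ k)).trans (DirichletCharacter.norm_le_one χ k)
      exact (abs_le.mp this).1
    have h2 := ArithmeticFunction.vonMangoldt_nonneg (n := k)
    simp only [Pi.add_apply, Pi.mul_apply, add_re, re_mul_ofReal, ofReal_re]
    nlinarith

/-! ### Reduction to primitive characters and choice of `T` -/

namespace DirichletCharacter

theorem IsPrimitive.ne_one {N : ℕ} [NeZero N] {χ : DirichletCharacter ℂ N} (hp : χ.IsPrimitive)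
    (hN : 1 < N) : χ ≠ 1 := by
  rintro rfl
  rw [isPrimitive_def, conductor_one] at hp
  omega

theorem IsPrimitive.three_le {N : ℕ} [NeZero N] {χ : DirichletCharacter ℂ N} (hp : χ.IsPrimitive)
    (hN : 1 < N) : 3 ≤ N := by
  have h2 : N ≠ 2 := by
    rintro rfl
    refine hp.ne_one hN (MulChar.ext fun a ↦ ?_)
    have ha : a = 1 := by revert a; decide
    simp [ha]
  omega

end DirichletCharacter

/-- Raising the level multiplies `L` by finitely many factors `1 - χ(p) p^(-s)`, none of which
vanishes at `1/2` because `|χ(p) p^(-1/2)| < 1`. -/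
theorem centralOrder_changeLevel {M N : ℕ} [NeZero M] [NeZero N] (hMN : M ∣ N)
    {χ : DirichletCharacter ℂ M} (hχ : χ ≠ 1) :
    centralOrder (DirichletCharacter.changeLevel hMN χ) = centralOrder χ := by
  have hfun : DirichletCharacter.LFunction (DirichletCharacter.changeLevel hMN χ) =
      DirichletCharacter.LFunction χ *
        fun s : ℂ ↦ ∏ p ∈ N.primeFactors, (1 - χ p * (p : ℂ) ^ (-s)) :=
    funext fun s ↦ DirichletCharacter.LFunction_changeLevel hMN χ (Or.inl hχ)
  have han : AnalyticAt ℂ (fun s : ℂ ↦ ∏ p ∈ N.primeFactors, (1 - χ p * (p : ℂ) ^ (-s)))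
      (1 / 2) := by
    refine Differentiable.analyticAt ?_ _
    refine Differentiable.fun_finsetProd fun p hp ↦ ?_
    have : (p : ℂ) ≠ 0 := by exact_mod_cast (Nat.prime_of_mem_primeFactors hp).ne_zero
    exact (differentiable_const _).sub ((differentiable_const _).mul
      (differentiable_neg.const_cpow (Or.inl this)))
  have hne : ∏ p ∈ N.primeFactors, (1 - χ p * (p : ℂ) ^ (-(1 / 2) : ℂ)) ≠ 0 := by
    refine Finset.prod_ne_zero_iff.mpr fun p hp h0 ↦ ?_
    have hp' := Nat.prime_of_mem_primeFactors hp
    have h1 : ‖χ p * (p : ℂ) ^ (-(1 / 2) : ℂ)‖ = 1 := by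
      rw [← sub_eq_zero.mp h0, norm_one]
    have h2 : ‖(p : ℂ) ^ (-(1 / 2) : ℂ)‖ < 1 := by
      rw [norm_natCast_cpow_of_pos hp'.pos]
      exact Real.rpow_lt_one_of_one_lt_of_neg (by exact_mod_cast hp'.one_lt) (by norm_num)
    rw [norm_mul] at h1
    nlinarith [DirichletCharacter.norm_le_one χ (p : ZMod M), norm_nonneg (χ p),
      norm_nonneg ((p : ℂ) ^ (-(1 / 2) : ℂ))]
  rw [centralOrder, centralOrder, analyticOrderNatAt, analyticOrderNatAt, hfun,
    analyticOrderAt_mul ((DirichletCharacter.differentiable_LFunction hχ).analyticAt _) han,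
    han.analyticOrderAt_eq_zero.mpr hne, add_zero]

theorem le_asymptotic_of_forall_mul_le {C : ℝ} (hC : 0 ≤ C) {n L : ℝ} (hL : 1 < L)
    (h : ∀ T : ℝ, 1 ≤ T → n * (T / 2) ≤ L / 2 + 4 * Real.exp (T / 2) / T + C * T) :
    n ≤ L / (2 * Real.log L) + (Real.log 4 + 1) * L / (2 * Real.log L ^ 2) +
      (Real.log 4 ^ 2 + 4 * Real.log 4 + 12 * C + (17 + 2 * C) * (2 * Real.log 4) ^ 3) *
        (L / Real.log L ^ 3) := by
  set ℓ := Real.log L with hℓ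
  set c := Real.log 4 with hc
  have hc1 : 1 / 2 ≤ c := by
    rw [hc, show (4 : ℝ) = 2 ^ 2 by norm_num, Real.log_pow]
    have := Real.log_two_gt_d9
    push_cast; linarith
  have hℓ0 : 0 < ℓ := Real.log_pos hL
  have hL0 : 0 < L := by linarith
  have hexp : Real.exp ℓ = L := Real.exp_log hL0
  rcases le_or_gt (2 * c) ℓ with hbig | hsmall
  · have hx : 0 < ℓ - c := by linarith
    have hx2 : ℓ / 2 ≤ ℓ - c := by linarith
    -- With `e^(T/2) = aL` the coefficient of `L/ℓ²` is `-(log a)/2 + 2a`, least at `a = 1/4`; hence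
    -- `c = log 4`. The case `ℓ ≥ 2c` ensures `T ≥ 1` and `ℓ - c ≥ ℓ/2`.
    have hT := h (2 * (ℓ - c)) (by linarith)
    have he : Real.exp (2 * (ℓ - c) / 2) = L / 4 := by
      rw [mul_div_cancel_left₀ _ two_ne_zero, Real.exp_sub, hexp, hc, Real.exp_log (by norm_num)]
    rw [he] at hT
    have h1 : n ≤ L / 2 * (1 / (ℓ - c)) + L / 2 * (1 / (ℓ - c) ^ 2) + 2 * C := by
      have e : L / 2 * (1 / (ℓ - c)) + L / 2 * (1 / (ℓ - c) ^ 2) + 2 * C =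
          (L / 2 + 4 * (L / 4) / (2 * (ℓ - c)) + C * (2 * (ℓ - c))) / (ℓ - c) := by
        field_simp
      rw [e, le_div_iff₀ hx]
      linarith
    have h2 : 1 / (ℓ - c) ≤ 1 / ℓ + c / ℓ ^ 2 + 2 * c ^ 2 / ℓ ^ 3 := by
      rw [show 1 / ℓ + c / ℓ ^ 2 + 2 * c ^ 2 / ℓ ^ 3 = (ℓ ^ 2 + c * ℓ + 2 * c ^ 2) / ℓ ^ 3 by
        field_simp, div_le_div_iff₀ hx (by positivity)]
      nlinarith [mul_nonneg (sq_nonneg c) (sub_nonneg.mpr hbig)]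
    have h3 : 1 / (ℓ - c) ^ 2 ≤ 1 / ℓ ^ 2 + 8 * c / ℓ ^ 3 := by
      rw [show 1 / ℓ ^ 2 + 8 * c / ℓ ^ 3 = (ℓ + 8 * c) / ℓ ^ 3 by field_simp,
        div_le_div_iff₀ (by positivity) (by positivity)]
      have hcc : 0 ≤ c := by linarith
      nlinarith [mul_nonneg (mul_nonneg hcc hℓ0.le) (sub_nonneg.mpr hbig), pow_nonneg hcc 3,
        mul_nonneg (sq_nonneg c) (sub_nonneg.mpr hbig)]
    -- The bounded remainder `2C` is absorbed into the error term through `e^ℓ ≥ ℓ³/6`.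
    have h4 : 1 ≤ 6 * (L / ℓ ^ 3) := by
      have := Real.pow_div_factorial_le_exp ℓ hℓ0.le 3
      rw [hexp] at this
      rw [← mul_div_assoc, le_div_iff₀ (by positivity)]
      norm_num [Nat.factorial] at this
      linarith
    have h5 : 0 ≤ (17 + 2 * C) * (2 * c) ^ 3 * (L / ℓ ^ 3) := by positivity
    calc n ≤ L / 2 * (1 / (ℓ - c)) + L / 2 * (1 / (ℓ - c) ^ 2) + 2 * C := h1
      _ ≤ L / 2 * (1 / ℓ + c / ℓ ^ 2 + 2 * c ^ 2 / ℓ ^ 3) + L / 2 * (1 / ℓ ^ 2 + 8 * c / ℓ ^ 3) +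
          2 * C * (6 * (L / ℓ ^ 3)) + (17 + 2 * C) * (2 * c) ^ 3 * (L / ℓ ^ 3) := by
        have := mul_le_mul_of_nonneg_left h4 (show 0 ≤ 2 * C by positivity)
        have := mul_le_mul_of_nonneg_left h2 (show 0 ≤ L / 2 by positivity)
        have := mul_le_mul_of_nonneg_left h3 (show 0 ≤ L / 2 by positivity)
        linarith
      _ = _ := by field_simp; ring
  -- For `ℓ < 2c` the trivial choice `T = 1` gives `n = O(L)`, and `(2c/ℓ)³ ≥ 1` turns this into the
  -- error term.
  · have hT := h 1 le_rfl
    have he : Real.exp (1 / 2) ≤ 2 := by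
      rw [← Real.le_log_iff_exp_le two_pos]
      linarith [Real.log_two_gt_d9]
    have h1 : n ≤ (17 + 2 * C) * L := by nlinarith
    have h2 : 1 ≤ (2 * c) ^ 3 / ℓ ^ 3 := by
      rw [one_le_div (by positivity)]
      gcongr
    have hc0 : 0 < c := by linarith
    calc n ≤ (17 + 2 * C) * L := h1
      _ ≤ (17 + 2 * C) * L * ((2 * c) ^ 3 / ℓ ^ 3) := le_mul_of_one_le_right (by positivity) h2
      _ = (17 + 2 * C) * (2 * c) ^ 3 * (L / ℓ ^ 3) := by ring
      _ ≤ L / (2 * ℓ) + (c + 1) * L / (2 * ℓ ^ 2) + (c ^ 2 + 4 * c + 12 * C) * (L / ℓ ^ 3) +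
          (17 + 2 * C) * (2 * c) ^ 3 * (L / ℓ ^ 3) := le_add_of_nonneg_left (by positivity)
      _ = _ := by ring

theorem theorem2 (hGRH : GRH) :
    ∃ C : ℝ, ∀ (N : ℕ) [NeZero N] (χ : DirichletCharacter ℂ N) (q : ℕ),
      χ.conductor = q → 1 < q →
        (centralOrder χ : ℝ) ≤
          Real.log q / (2 * Real.log (Real.log q))
            + (Real.log 4 + 1) * Real.log q / (2 * Real.log (Real.log q) ^ 2)
            + C * (Real.log q / Real.log (Real.log q) ^ 3) := by
  obtain ⟨C, hC0, hC⟩ := exists_centralOrder_mul_le hGRH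
  refine ⟨Real.log 4 ^ 2 + 4 * Real.log 4 + 12 * C + (17 + 2 * C) * (2 * Real.log 4) ^ 3,
    fun N _ χ q hq h1 ↦ ?_⟩
  subst hq
  have : NeZero χ.conductor := ⟨χ.conductor_ne_zero⟩
  have hp := χ.primitiveCharacter_isPrimitive
  have hne := hp.ne_one h1
  -- There is no primitive character modulo 2, so the conductor is at least `3 > e`.
  have hL : 1 < Real.log χ.conductor := by
    rw [Real.lt_log_iff_exp_lt (by positivity)]
    have : (3 : ℝ) ≤ χ.conductor := by exact_mod_cast hp.three_le h1
    linarith [Real.exp_one_lt_d9]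
  have hord : centralOrder χ = centralOrder χ.primitiveCharacter := by
    rw [← centralOrder_changeLevel χ.conductor_dvd_level hne, χ.changeLevel_primitiveCharacter]
  rw [hord]
  exact le_asymptotic_of_forall_mul_le hC0 hL fun T hT ↦ hC _ _ hne hp T hT
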